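/- Let $\mathcal V$ be a symmetric monoidal closed category with small limits and colimits (small products, equalizers, small coproducts and coequalizers), with unit $I$. Let $\mathcal A,\mathcal B$ be small $\mathcal V$-categories and $\mathcal X$ a $\mathcal V$-category; $[\mathcal A,\mathcal X]$ is the $\mathcal V$-category of $\mathcal V$-functors, with $[\mathcal A,\mathcal X](F,G)=\int_A\mathcal X(FA,GA)$. A module $M:\mathcal C\to\mathcal D$ is a $\mathcal V$-functor $\mathcal D^{\mathrm{op}}\otimes\mathcal C\to\mathcal V$, written $(D,C)\mapsto M(D,C)$. *Promonoidal $\mathcal V$-categories.* A promonoidal structure on $\mathcal A$ consists of modules $P:\mathcal A\to\mathcal A\otimes\mathcal A$ and $J:\mathcal A\to\mathcal I$ (values $P(A_1,A_2,A)$ and $JA$; $\mathcal I$ is the unit $\mathcal V$-category) and isomorphisms, $\mathcal V$-natural in all the variables, $$\int^{U}P(A_1,A_2,U)\otimes P(U,A_3,A)\cong\int^{U}P(A_2,A_3,U)\otimes P(A_1,U,A),$$ $$\int^{U}JU\otimes P(U,A_1,A)\cong\mathcal A(A_1,A)\cong\int^{U}JU\otimes P(A_1,U,A),$$ satisfying the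 pentagon and triangle axioms. Let $\mathcal A$ and $\mathcal B$ be promonoidal. *Promonoidal modules.* A promonoidal module $K:\mathcal B\to\mathcal A$ (a lax morphism of pseudomonoids in $\mathcal V\text{-}\mathrm{Mod}^{\mathrm{op}}$) is a module $K$, with values $K(A,B)$, together with $\mathcal V$-natural families $$\phi_{A_1,A_2,B}:\int^{B_1,B_2}K(A_1,B_1)\otimes K(A_2,B_2)\otimes P(B_1,B_2,B)\longrightarrow\int^{A}P(A_1,A_2,A)\otimes K(A,B),$$ $$\phi_{0,B}:JB\longrightarrow\int^{A}JA\otimes K(A,B),$$ compatible with the associativity constraints and with the left and right unit constraints of $\mathcal A$ and $\mathcal B$. It is *strong* if all $\phi_{A_1,A_2,B}$ and $\phi_{0,B}$ are invertible. *Day convolution.* Let $\mathcal X$ be a monoidal $\mathcal V$-category with tensor $\otimes$ and unit $E$, such that for each object $Z$ of $\mathcal X$ the $\mathcal V$-functors $-\otimes Z$ and $Z\otimes-$ preserve all existing small weighted colimits. Suppose that the colimits $$(F\ast G)A=\operatorname{colim}_{A_1,A_2}\bigl(P(A_1,A_2,A),FA_1\otimes GA_2\bigr),\qquad NA=\operatorname{colim}(JA,E)$$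 exist in $\mathcal X$ for all $\mathcal V$-functors $F,G:\mathcal A\to\mathcal X$ and all $A$, and likewise with $\mathcal B$ in place of $\mathcal A$. A Day convolution structure on $[\mathcal A,\mathcal X]$ is a monoidal $\mathcal V$-category structure with tensor $\ast$ and unit $N$ whose associativity and unit constraints are those induced, on the coprojections of the colimits, by the constraints of $\mathcal X$ and of the promonoidal $\mathcal V$-category $\mathcal A$; similarly for $[\mathcal B,\mathcal X]$. **Theorem.** In this situation let $K:\mathcal B\to\mathcal A$ be a promonoidal module such that the colimits $$(\exists_KF)B=\operatorname{colim}_A\bigl(K(A,B),FA\bigr)$$ exist for all $F:\mathcal A\to\mathcal X$ and all $B$, so that there is a $\mathcal V$-functor $\exists_K:[\mathcal A,\mathcal X]\to[\mathcal B,\mathcal X]$. Then Day convolution structures on $[\mathcal A,\mathcal X]$ and on $[\mathcal B,\mathcal X]$ exist, and for these structures $\exists_K$ is a (lax) monoidal $\mathcal V$-functor, with a structure $$\mu_{F,G}:\exists_KF\ast\exists_KG\to\exists_K(F\ast G),\qquad \varepsilon:N_{\mathcal B}\to\exists_KN_{\mathcal A}$$ which is the one induced by $\phi$ and $\phi_0$.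 Explicitly, in generalized elements: the composite of the coprojections of $\exists_KF$ at $(A_1,B_1)$, of $\exists_KG$ at $(A_2,B_2)$ and of $\exists_KF\ast\exists_KG$ at $(B_1,B_2,B)$ with $(\mu_{F,G})_B$ is the map $$K(A_1,B_1)\otimes K(A_2,B_2)\otimes P(B_1,B_2,B)\longrightarrow\mathcal X\bigl(FA_1\otimes GA_2,(\exists_K(F\ast G))B\bigr)$$ obtained from $\phi_{A_1,A_2,B}$ followed by the map $\int^AP(A_1,A_2,A)\otimes K(A,B)\to\mathcal X(FA_1\otimes GA_2,(\exists_K(F\ast G))B)$ given by the coprojections of $F\ast G$ and of $\exists_K(F\ast G)$; and the composite of the coprojection of $N_{\mathcal B}$ at $B$ with $\varepsilon_B$ is $\phi_{0,B}$ followed by the map $\int^AJA\otimes K(A,B)\to\mathcal X(E,(\exists_KN_{\mathcal A})B)$ given by the coprojections of $N_{\mathcal A}$ and of $\exists_KN_{\mathcal A}$. If $K$ is strong, then $\exists_K$ with this structure is strong monoidal, that is, all $\mu_{F,G}$ and $\varepsilon$ are invertible. -/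

import Mathlib

open CategoryTheory MonoidalCategory BraidedCategory

universe w u u₁ u₂ u₃ u₄ v

set_option linter.unusedSectionVars false

attribute [-instance] CategoryTheory.catToReflQuiver

noncomputable section

namespace Enr

variable {V : Type v} [Category.{w} V] [MonoidalCategory V] [SymmetricCategory V]

section Composition

variable {X : Type u₁} [EnrichedCategory V X] {Y : Type u₂} [EnrichedCategory V Y]

/-- Composition (in diagrammatic order) of generalized elements of hom-objects. -/
def ecmp {x y z : X} {p q : V} (f : p ⟶ (x ⟶[V] y)) (g : q ⟶ (y ⟶[V] z)) : p ⊗ q ⟶ (x ⟶[V] z) :=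
  (f ⊗ₘ g) ≫ eComp V x y z

infixr:70 " ⨟ " => ecmp

theorem eId_comp' (a a' : X) :
    eId V a ▷ (a ⟶[V] a') ≫ eComp V a a a' = (λ_ _).hom := by
  rw [← cancel_epi (λ_ _).inv, Iso.inv_hom_id]; exact e_id_comp V a a'

theorem comp_eId' (a a' : X) :
    (a ⟶[V] a') ◁ eId V a' ≫ eComp V a a' a' = (ρ_ _).hom := by
  rw [← cancel_epi (ρ_ _).inv, Iso.inv_hom_id]; exact e_comp_id V a a'

theorem ecmp_assoc {x y z t : X} {p q r : V} (f : p ⟶ (x ⟶[V] y)) (g : q ⟶ (y ⟶[V] z))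
    (h : r ⟶ (z ⟶[V] t)) : (f ⨟ g) ⨟ h = (α_ p q r).hom ≫ (f ⨟ (g ⨟ h)) := by
  have e1 : (f ⨟ g) ⨟ h = ((f ⊗ₘ g) ⊗ₘ h) ≫ eComp V x y z ▷ _ ≫ eComp V x z t := by
    rw [← tensorHom_id, tensorHom_comp_tensorHom_assoc, Category.comp_id]; rfl
  have e2 : f ⨟ (g ⨟ h) = (f ⊗ₘ (g ⊗ₘ h)) ≫ _ ◁ eComp V y z t ≫ eComp V x y t := by
    rw [← id_tensorHom, tensorHom_comp_tensorHom_assoc, Category.comp_id]; rfl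
  rw [e1, e2, ← e_assoc', associator_naturality_assoc]

theorem comp_ecmp {x y z : X} {p' p q : V} (k : p' ⟶ p) (f : p ⟶ (x ⟶[V] y))
    (g : q ⟶ (y ⟶[V] z)) : (k ≫ f) ⨟ g = k ▷ q ≫ (f ⨟ g) := by
  rw [ecmp, ecmp, ← tensorHom_id, tensorHom_comp_tensorHom_assoc, Category.id_comp]

theorem ecmp_comp {x y z : X} {p q' q : V} (k : q' ⟶ q) (f : p ⟶ (x ⟶[V] y))
    (g : q ⟶ (y ⟶[V] z)) : f ⨟ (k ≫ g) = p ◁ k ≫ (f ⨟ g) := by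
  rw [ecmp, ecmp, ← id_tensorHom, tensorHom_comp_tensorHom_assoc, Category.id_comp]

theorem eId_ecmp {x y : X} {p : V} (f : p ⟶ (x ⟶[V] y)) :
    eId V x ⨟ f = (λ_ p).hom ≫ f := by
  rw [ecmp, tensorHom_def', Category.assoc, eId_comp', leftUnitor_naturality]

theorem ecmp_eId {x y : X} {p : V} (f : p ⟶ (x ⟶[V] y)) :
    f ⨟ eId V y = (ρ_ p).hom ≫ f := by
  rw [ecmp, MonoidalCategory.tensorHom_def, Category.assoc, comp_eId', rightUnitor_naturality]

theorem ecmp_map (F : EnrichedFunctor V X Y) {x y z : X} {p q : V} (f : p ⟶ (x ⟶[V] y))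
    (g : q ⟶ (y ⟶[V] z)) :
    (f ⨟ g) ≫ F.map x z = (f ≫ F.map x y) ⨟ (g ≫ F.map y z) := by
  rw [ecmp, ecmp, Category.assoc, F.map_comp, tensorHom_comp_tensorHom_assoc]

end Composition

section Products

variable {A : Type u₁} [EnrichedCategory V A] {B : Type u₂} [EnrichedCategory V B]
  {X : Type u₃} [EnrichedCategory V X] {Y : Type u₄} [EnrichedCategory V Y]

theorem eId_tensor_eId (a : A) :
    (eId V a ⊗ₘ eId V a) ≫ eComp V a a a = (λ_ _).hom ≫ eId V a := by
  rw [tensorHom_def', Category.assoc, eId_comp', leftUnitor_naturality]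

instance prodCat : EnrichedCategory V (A × B) where
  Hom p q := (p.1 ⟶[V] q.1) ⊗ (p.2 ⟶[V] q.2)
  id p := (λ_ (𝟙_ V)).inv ≫ (eId V p.1 ⊗ₘ eId V p.2)
  comp p q r := tensorμ _ _ _ _ ≫ (eComp V p.1 q.1 r.1 ⊗ₘ eComp V p.2 q.2 r.2)
  id_comp p q := by
    rw [Iso.inv_comp_eq, comp_whiskerRight_assoc, tensorμ_natural_left_assoc,
      tensorHom_comp_tensorHom, Category.comp_id, tensor_left_unitality]
    congr 3
    · exact eId_comp' _ _
    · exact eId_comp' _ _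
  comp_id p q := by
    rw [Iso.inv_comp_eq, MonoidalCategory.whiskerLeft_comp_assoc, tensorμ_natural_right_assoc,
      tensorHom_comp_tensorHom, Category.comp_id, tensor_right_unitality]
    congr 3
    · exact comp_eId' _ _
    · exact comp_eId' _ _
  assoc p q r s := by
    rw [Iso.inv_comp_eq, comp_whiskerRight_assoc, MonoidalCategory.whiskerLeft_comp_assoc,
      tensorμ_natural_left_assoc, tensorμ_natural_right_assoc, tensorHom_comp_tensorHom,
      tensorHom_comp_tensorHom, ← e_assoc', ← e_assoc', ← tensorHom_comp_tensorHom,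
      tensor_associativity_assoc]

theorem prod_hom (p q : A × B) : (p ⟶[V] q) = ((p.1 ⟶[V] q.1) ⊗ (p.2 ⟶[V] q.2)) := rfl

theorem prod_eId (p : A × B) :
    eId V p = (λ_ (𝟙_ V)).inv ≫ (eId V p.1 ⊗ₘ eId V p.2) := rfl

theorem prod_eComp (p q r : A × B) :
    eComp V p q r = tensorμ _ _ _ _ ≫ (eComp V p.1 q.1 r.1 ⊗ₘ eComp V p.2 q.2 r.2) := rfl

instance unitCat : EnrichedCategory V PUnit.{u + 1} where
  Hom _ _ := 𝟙_ V
  id _ := 𝟙 _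
  comp _ _ _ := (λ_ (𝟙_ V)).hom
  id_comp _ _ := by simp
  comp_id _ _ := by simp [unitors_equal]
  assoc _ _ _ _ := by simp [unitors_equal]

/-- The product `F ⊗ G : A ⊗ B → X ⊗ Y` of two `V`-functors. -/
@[simps]
def prodFunctor (F : EnrichedFunctor V A X) (G : EnrichedFunctor V B Y) :
    EnrichedFunctor V (A × B) (X × Y) where
  obj p := (F.obj p.1, G.obj p.2)
  map p q := F.map p.1 q.1 ⊗ₘ G.map p.2 q.2
  map_id p := by simp [prod_eId]
  map_comp p q r := by
    rw [prod_eComp, prod_eComp, Category.assoc, tensorHom_comp_tensorHom, tensorμ_natural_assoc,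
      tensorHom_comp_tensorHom, F.map_comp, G.map_comp]

/-- The `V`-functor `(a, -) : B → A ⊗ B`. -/
@[simps]
def secR (a : A) : EnrichedFunctor V B (A × B) where
  obj b := (a, b)
  map b b' := (λ_ _).inv ≫ eId V a ▷ (b ⟶[V] b')
  map_id b := by
    rw [prod_eId, leftUnitor_inv_naturality_assoc, tensorHom_def']
  map_comp b b' b'' := by
    rw [prod_eComp]
    have h : (((λ_ (b ⟶[V] b')).inv ≫ eId V a ▷ (b ⟶[V] b')) ⊗ₘ
        ((λ_ (b' ⟶[V] b'')).inv ≫ eId V a ▷ (b' ⟶[V] b''))) =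
        ((λ_ (b ⟶[V] b')).inv ⊗ₘ (λ_ (b' ⟶[V] b'')).inv) ≫
          ((eId V a ⊗ₘ 𝟙 _) ⊗ₘ (eId V a ⊗ₘ 𝟙 _)) := by simp
    have h2 := leftUnitor_monoidal (b ⟶[V] b') (b' ⟶[V] b'')
    rw [h, Category.assoc, tensorμ_natural_assoc, tensorHom_comp_tensorHom, eId_tensor_eId,
      id_tensorHom_id, Category.id_comp, leftUnitor_inv_naturality_assoc, ← tensorHom_def',
      ← cancel_epi ((λ_ (b ⟶[V] b')).hom ⊗ₘ (λ_ (b' ⟶[V] b'')).hom), tensorHom_comp_tensorHom_assoc,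
      Iso.hom_inv_id, Iso.hom_inv_id, id_tensorHom_id, Category.id_comp, h2]
    simp only [Category.assoc, Iso.hom_inv_id_assoc]
    rw [← tensorHom_id, tensorHom_comp_tensorHom, Category.id_comp]

/-- The `V`-functor `(-, b) : A → A ⊗ B`. -/
@[simps]
def secL (b : B) : EnrichedFunctor V A (A × B) where
  obj a := (a, b)
  map a a' := (ρ_ _).inv ≫ (a ⟶[V] a') ◁ eId V b
  map_id a := by
    rw [prod_eId, rightUnitor_inv_naturality_assoc, MonoidalCategory.tensorHom_def, unitors_inv_equal]
  map_comp a a' a'' := by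
    rw [prod_eComp]
    have h : (((ρ_ (a ⟶[V] a')).inv ≫ (a ⟶[V] a') ◁ eId V b) ⊗ₘ
        ((ρ_ (a' ⟶[V] a'')).inv ≫ (a' ⟶[V] a'') ◁ eId V b)) =
        ((ρ_ (a ⟶[V] a')).inv ⊗ₘ (ρ_ (a' ⟶[V] a'')).inv) ≫
          ((𝟙 _ ⊗ₘ eId V b) ⊗ₘ (𝟙 _ ⊗ₘ eId V b)) := by simp
    have h2 := rightUnitor_monoidal (a ⟶[V] a') (a' ⟶[V] a'')
    rw [h, Category.assoc, tensorμ_natural_assoc, tensorHom_comp_tensorHom, eId_tensor_eId,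
      id_tensorHom_id, Category.id_comp, rightUnitor_inv_naturality_assoc, ← MonoidalCategory.tensorHom_def,
      ← cancel_epi ((ρ_ (a ⟶[V] a')).hom ⊗ₘ (ρ_ (a' ⟶[V] a'')).hom), tensorHom_comp_tensorHom_assoc,
      Iso.hom_inv_id, Iso.hom_inv_id, id_tensorHom_id, Category.id_comp, h2]
    simp only [Category.assoc, Iso.hom_inv_id_assoc]
    rw [← id_tensorHom, tensorHom_comp_tensorHom, Category.id_comp]

end Products

section FunctorCategory

open Limits

variable {A : Type u} [EnrichedCategory V A] {X : Type u₁} [EnrichedCategory V X]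
  {Y : Type u₂} [EnrichedCategory V Y]

/-- A family `v ⟶ X(F a, G a)` is `V`-natural in `a`; such families are the generalized elements at
stage `v` of the end `∫ₐ X(F a, G a)`. For `v = I` they are the `V`-natural transformations. -/
def IsVNat (F G : EnrichedFunctor V A X) (v : V) (t : ∀ a, v ⟶ (F.obj a ⟶[V] G.obj a)) : Prop :=
  ∀ a b, t a ⨟ G.map a b = (β_ v (a ⟶[V] b)).hom ≫ (F.map a b ⨟ t b)

variable [MonoidalClosed V] [HasProducts.{u} V] [HasEqualizers V]

/-- The first map in the equalizer diagram of the end `∫ₐ X(F a, G a)`. -/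
def funMapL (F G : EnrichedFunctor V A X) :
    (∏ᶜ fun a => (F.obj a ⟶[V] G.obj a)) ⟶
      ∏ᶜ fun p : A × A => (ihom (p.1 ⟶[V] p.2)).obj (F.obj p.1 ⟶[V] G.obj p.2) :=
  Pi.lift fun p => MonoidalClosed.curry
    ((β_ _ _).hom ≫ (Pi.π (fun a => (F.obj a ⟶[V] G.obj a)) p.1 ⊗ₘ G.map p.1 p.2) ≫ eComp V _ _ _)

/-- The second map in the equalizer diagram of the end `∫ₐ X(F a, G a)`. -/
def funMapR (F G : EnrichedFunctor V A X) :
    (∏ᶜ fun a => (F.obj a ⟶[V] G.obj a)) ⟶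
      ∏ᶜ fun p : A × A => (ihom (p.1 ⟶[V] p.2)).obj (F.obj p.1 ⟶[V] G.obj p.2) :=
  Pi.lift fun p => MonoidalClosed.curry
    ((F.map p.1 p.2 ⊗ₘ Pi.π (fun a => (F.obj a ⟶[V] G.obj a)) p.2) ≫ eComp V _ _ _)

/-- The hom-object `[A, X](F, G) = ∫ₐ X(F a, G a)` of the functor `V`-category. -/
def funHom (F G : EnrichedFunctor V A X) : V := equalizer (funMapL F G) (funMapR F G)

/-- The inclusion of the end in the product. -/
def funIncl (F G : EnrichedFunctor V A X) :
    funHom F G ⟶ (∏ᶜ fun a => (F.obj a ⟶[V] G.obj a)) :=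
  equalizer.ι (funMapL F G) (funMapR F G)

/-- The projection `[A, X](F, G) ⟶ X(F a, G a)`. -/
def funProj (F G : EnrichedFunctor V A X) (a : A) : funHom F G ⟶ (F.obj a ⟶[V] G.obj a) :=
  funIncl F G ≫ Pi.π (fun a => (F.obj a ⟶[V] G.obj a)) a

theorem fun_condition_iff {F G : EnrichedFunctor V A X} {v : V}
    (f : v ⟶ ∏ᶜ fun a => (F.obj a ⟶[V] G.obj a)) :
    f ≫ funMapL F G = f ≫ funMapR F G ↔
      IsVNat F G v (fun a => f ≫ Pi.π (fun a => (F.obj a ⟶[V] G.obj a)) a) := by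
  have key : ∀ a b,
      (f ≫ funMapL F G ≫ Pi.π _ (a, b) = f ≫ funMapR F G ≫ Pi.π _ (a, b)) ↔
      ((f ≫ Pi.π (fun a => (F.obj a ⟶[V] G.obj a)) a) ⨟ G.map a b =
      (β_ v (a ⟶[V] b)).hom ≫ (F.map a b ⨟
        (f ≫ Pi.π (fun a => (F.obj a ⟶[V] G.obj a)) b))) := by
    intro a b
    rw [funMapL, funMapR, Pi.lift_π, Pi.lift_π, ← MonoidalClosed.curry_natural_left,
      ← MonoidalClosed.curry_natural_left, MonoidalClosed.curry_injective.eq_iff,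
      braiding_naturality_right_assoc, ← cancel_epi (β_ v (a ⟶[V] b)).hom,
      SymmetricCategory.symmetry_assoc, comp_ecmp, ecmp_comp]
    rfl
  constructor
  · intro h a b
    rw [← key a b, ← Category.assoc, h, Category.assoc]
  · intro h
    apply Pi.hom_ext
    rintro ⟨a, b⟩
    rw [Category.assoc, Category.assoc]
    exact (key a b).2 (h a b)

theorem IsVNat.precomp {F G : EnrichedFunctor V A X} {v v' : V}
    {t : ∀ a, v ⟶ (F.obj a ⟶[V] G.obj a)} (h : IsVNat F G v t) (k : v' ⟶ v) :
    IsVNat F G v' (fun a => k ≫ t a) := by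
  intro a b
  rw [comp_ecmp, ecmp_comp, h a b, braiding_naturality_left_assoc]

theorem isVNat_funProj (F G : EnrichedFunctor V A X) : IsVNat F G (funHom F G) (funProj F G) :=
  (fun_condition_iff _).1 (equalizer.condition (funMapL F G) (funMapR F G))

theorem fun_hom_ext {F G : EnrichedFunctor V A X} {v : V} {f g : v ⟶ funHom F G}
    (h : ∀ a, f ≫ funProj F G a = g ≫ funProj F G a) : f = g := by
  have : f ≫ funIncl F G = g ≫ funIncl F G := by
    apply Pi.hom_ext
    intro a
    rw [Category.assoc, Category.assoc]
    exact h a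
  exact equalizer.hom_ext this

/-- The map into `[A, X](F, G)` given by a `V`-natural family. -/
def funLift {F G : EnrichedFunctor V A X} {v : V} (t : ∀ a, v ⟶ (F.obj a ⟶[V] G.obj a))
    (h : IsVNat F G v t) : v ⟶ funHom F G :=
  equalizer.lift (Pi.lift t) ((fun_condition_iff _).2 (by simpa using h))

theorem funLift_proj {F G : EnrichedFunctor V A X} {v : V} (t : ∀ a, v ⟶ (F.obj a ⟶[V] G.obj a))
    (h : IsVNat F G v t) (a : A) : funLift t h ≫ funProj F G a = t a := by
  have : funLift t h ≫ funIncl F G = Pi.lift t := equalizer.lift_ι _ _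
  rw [funProj, ← Category.assoc, this, Pi.lift_π]

theorem isVNat_id (F : EnrichedFunctor V A X) : IsVNat F F (𝟙_ V) (fun a => eId V (F.obj a)) := by
  intro a b
  rw [eId_ecmp, ecmp_eId, ← Category.assoc, braiding_rightUnitor]

theorem IsVNat.comp {F G H : EnrichedFunctor V A X} {v v' : V}
    {t : ∀ a, v ⟶ (F.obj a ⟶[V] G.obj a)} (h : IsVNat F G v t)
    {t' : ∀ a, v' ⟶ (G.obj a ⟶[V] H.obj a)} (h' : IsVNat G H v' t') :
    IsVNat F H (v ⊗ v') (fun a => t a ⨟ t' a) := by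
  intro a b
  rw [ecmp_assoc, h' a b, ecmp_comp, ← cancel_epi (α_ _ _ _).inv, Iso.inv_hom_id_assoc,
    ← Iso.inv_hom_id_assoc (α_ _ _ _) (t a ⨟ _), ← ecmp_assoc, h a b, comp_ecmp, ecmp_assoc,
    braiding_tensor_left_hom]
  simp only [Category.assoc, Iso.inv_hom_id_assoc]

/-- The functor `V`-category `[A, X]`. -/
instance funCat : EnrichedCategory V (EnrichedFunctor V A X) where
  Hom F G := funHom F G
  id F := funLift _ (isVNat_id F)
  comp F G H := funLift _ ((isVNat_funProj F G).comp (isVNat_funProj G H))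
  id_comp F G := by
    apply fun_hom_ext
    intro a
    rw [Category.assoc, Category.assoc, funLift_proj, ← comp_ecmp, funLift_proj, eId_ecmp,
      Iso.inv_hom_id_assoc, Category.id_comp]
  comp_id F G := by
    apply fun_hom_ext
    intro a
    rw [Category.assoc, Category.assoc, funLift_proj, ← ecmp_comp, funLift_proj, ecmp_eId,
      Iso.inv_hom_id_assoc, Category.id_comp]
  assoc F G H K := by
    apply fun_hom_ext
    intro a
    rw [Category.assoc, Category.assoc, Category.assoc, funLift_proj, ← comp_ecmp, funLift_proj,
      funLift_proj, ← ecmp_comp, funLift_proj, ecmp_assoc, Iso.inv_hom_id_assoc]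

/-- The projection `[A, X](F, G) ⟶ X(F a, G a)`, with source the hom-object of `[A, X]`. -/
def proj (F G : EnrichedFunctor V A X) (a : A) : (F ⟶[V] G) ⟶ (F.obj a ⟶[V] G.obj a) :=
  funProj F G a

theorem hom_ext {F G : EnrichedFunctor V A X} {v : V} {f g : v ⟶ (F ⟶[V] G)}
    (h : ∀ a, f ≫ proj F G a = g ≫ proj F G a) : f = g := fun_hom_ext h

/-- The map into `[A, X](F, G)` given by a `V`-natural family. -/
def lift {F G : EnrichedFunctor V A X} {v : V} (t : ∀ a, v ⟶ (F.obj a ⟶[V] G.obj a))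
    (h : IsVNat F G v t) : v ⟶ (F ⟶[V] G) := funLift t h

theorem lift_proj {F G : EnrichedFunctor V A X} {v : V} (t : ∀ a, v ⟶ (F.obj a ⟶[V] G.obj a))
    (h : IsVNat F G v t) (a : A) : lift t h ≫ proj F G a = t a := funLift_proj t h a

theorem isVNat_proj {F G : EnrichedFunctor V A X} {v : V} (f : v ⟶ (F ⟶[V] G)) :
    IsVNat F G v (fun a => f ≫ proj F G a) := (isVNat_funProj F G).precomp f

theorem eId_proj (F : EnrichedFunctor V A X) (a : A) :
    eId V F ≫ proj F F a = eId V (F.obj a) := funLift_proj _ (isVNat_id F) a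

theorem eComp_proj (F G H : EnrichedFunctor V A X) (a : A) :
    eComp V F G H ≫ proj F H a = proj F G a ⨟ proj G H a :=
  funLift_proj _ ((isVNat_funProj F G).comp (isVNat_funProj G H)) a

theorem ecmp_proj {F G H : EnrichedFunctor V A X} {p q : V} (f : p ⟶ (F ⟶[V] G))
    (g : q ⟶ (G ⟶[V] H)) (a : A) :
    (f ⨟ g) ≫ proj F H a = (f ≫ proj F G a) ⨟ (g ≫ proj G H a) := by
  rw [ecmp, Category.assoc, eComp_proj, ecmp, ecmp, tensorHom_comp_tensorHom_assoc]

end FunctorCategory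

section External

open Limits

variable {A : Type u} [EnrichedCategory V A] {B : Type u} [EnrichedCategory V B]
  {X : Type u₁} [EnrichedCategory V X] {Y : Type u₂} [EnrichedCategory V Y]
  {Z : Type u₃} [EnrichedCategory V Z]

theorem tensorμ_braid (a b c d : V) :
    tensorμ a b c d ≫ ((β_ a c).hom ⊗ₘ (β_ b d).hom) = (β_ (a ⊗ b) (c ⊗ d)).hom ≫
      tensorμ c d a b := by
  simp [tensorμ, SymmetricCategory.braiding_swap_eq_inv_braiding d a,
    MonoidalCategory.tensorHom_def]

theorem tensorμ_braid_assoc (a b c d : V) {e : V} (k : (c ⊗ a) ⊗ (d ⊗ b) ⟶ e) :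
    tensorμ a b c d ≫ ((β_ a c).hom ⊗ₘ (β_ b d).hom) ≫ k = (β_ (a ⊗ b) (c ⊗ d)).hom ≫
      tensorμ c d a b ≫ k := by
  rw [← Category.assoc, tensorμ_braid, Category.assoc]

/-- The action of a `V`-functor of two variables on a pair of generalized elements. -/
def mapPair (T : EnrichedFunctor V (X × Y) Z) {x x' : X} {y y' : Y} {p q : V}
    (f : p ⟶ (x ⟶[V] x')) (g : q ⟶ (y ⟶[V] y')) :
    p ⊗ q ⟶ (T.obj (x, y) ⟶[V] T.obj (x', y')) :=
  (f ⊗ₘ g) ≫ T.map (x, y) (x', y')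

theorem mapPair_ecmp (T : EnrichedFunctor V (X × Y) Z) {x x' x'' : X} {y y' y'' : Y}
    {v₁ v₂ v₃ v₄ : V} (f : v₁ ⟶ (x ⟶[V] x')) (g : v₂ ⟶ (y ⟶[V] y'))
    (f' : v₃ ⟶ (x' ⟶[V] x'')) (g' : v₄ ⟶ (y' ⟶[V] y'')) :
    mapPair T f g ⨟ mapPair T f' g' = tensorμ v₁ v₂ v₃ v₄ ≫ mapPair T (f ⨟ f') (g ⨟ g') := by
  have h : ecmp (x := (x, y)) (y := (x', y')) (z := (x'', y'')) (f ⊗ₘ g) (f' ⊗ₘ g') =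
      tensorμ v₁ v₂ v₃ v₄ ≫ ((f ⨟ f') ⊗ₘ (g ⨟ g')) := by
    rw [ecmp, prod_eComp, tensorμ_natural_assoc, tensorHom_comp_tensorHom]; rfl
  rw [mapPair, mapPair, mapPair, ← Category.assoc, ← h, ecmp_map]

theorem mapPair_comp (T : EnrichedFunctor V (X × Y) Z) {x x' : X} {y y' : Y} {p q p' q' : V}
    (k : p' ⟶ p) (l : q' ⟶ q) (f : p ⟶ (x ⟶[V] x')) (g : q ⟶ (y ⟶[V] y')) :
    mapPair T (k ≫ f) (l ≫ g) = (k ⊗ₘ l) ≫ mapPair T f g := by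
  rw [mapPair, mapPair, tensorHom_comp_tensorHom_assoc]

theorem mapPair_eId (T : EnrichedFunctor V (X × Y) Z) (x : X) (y : Y) :
    mapPair T (eId V x) (eId V y) = (λ_ _).hom ≫ eId V (T.obj (x, y)) := by
  rw [mapPair, ← T.map_id, prod_eId, Category.assoc, Iso.hom_inv_id_assoc]

variable [MonoidalClosed V] [HasProducts.{u} V] [HasEqualizers V]

/-- The `V`-functor `(a, b) ↦ T(F a, G b)`. -/
def extObj (T : EnrichedFunctor V (X × Y) Z) (F : EnrichedFunctor V A X)
    (G : EnrichedFunctor V B Y) : EnrichedFunctor V (A × B) Z :=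
  (prodFunctor F G).comp V T

theorem extObj_map (T : EnrichedFunctor V (X × Y) Z) (F : EnrichedFunctor V A X)
    (G : EnrichedFunctor V B Y) (p q : A × B) :
    (extObj T F G).map p q = mapPair T (F.map p.1 q.1) (G.map p.2 q.2) := rfl

/-- The action on hom-objects of `(F, G) ↦ T(F -, G -)`. -/
def extHom (T : EnrichedFunctor V (X × Y) Z) (F F' : EnrichedFunctor V A X)
    (G G' : EnrichedFunctor V B Y) :
    (F ⟶[V] F') ⊗ (G ⟶[V] G') ⟶ (extObj T F G ⟶[V] extObj T F' G') :=
  lift (fun p => mapPair T (proj F F' p.1) (proj G G' p.2)) (by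
    intro p q
    have h1 : proj F F' p.1 ⨟ F'.map p.1 q.1 = _ := isVNat_funProj F F' p.1 q.1
    have h2 : proj G G' p.2 ⨟ G'.map p.2 q.2 = _ := isVNat_funProj G G' p.2 q.2
    rw [extObj_map, extObj_map]
    refine (mapPair_ecmp T _ _ _ _).trans ?_
    refine Eq.trans ?_ (congrArg _ (mapPair_ecmp T _ _ _ _).symm)
    rw [h1, h2, mapPair_comp]
    exact tensorμ_braid_assoc _ _ _ _ _)

theorem extHom_proj (T : EnrichedFunctor V (X × Y) Z) (F F' : EnrichedFunctor V A X)
    (G G' : EnrichedFunctor V B Y) (p : A × B) :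
    extHom T F F' G G' ≫ proj (extObj T F G) (extObj T F' G') p =
      mapPair T (proj F F' p.1) (proj G G' p.2) := lift_proj _ _ p

/-- The `V`-functor `[A, X] ⊗ [B, Y] → [A ⊗ B, Z]` sending `(F, G)` to `(a, b) ↦ T(F a, G b)`. -/
def extTensor (A B : Type u) [EnrichedCategory V A] [EnrichedCategory V B]
    (T : EnrichedFunctor V (X × Y) Z) :
    EnrichedFunctor V (EnrichedFunctor V A X × EnrichedFunctor V B Y)
      (EnrichedFunctor V (A × B) Z) where
  obj F := extObj T F.1 F.2
  map F G := extHom T F.1 G.1 F.2 G.2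
  map_id F := by
    apply hom_ext
    intro p
    rw [Category.assoc, extHom_proj, eId_proj, prod_eId]
    refine (Category.assoc _ _ _).trans ?_
    refine (congrArg _ (mapPair_comp T _ _ _ _).symm).trans ?_
    rw [eId_proj, eId_proj, mapPair_eId]
    exact Iso.inv_hom_id_assoc _ _
  map_comp F G H := by
    apply hom_ext
    intro p
    have h : (extHom T F.1 G.1 F.2 G.2 ≫ proj _ _ p) ⨟ (extHom T G.1 H.1 G.2 H.2 ≫ proj _ _ p) =
        mapPair T (proj F.1 G.1 p.1) (proj F.2 G.2 p.2) ⨟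
          mapPair T (proj G.1 H.1 p.1) (proj G.2 H.2 p.2) := by
      rw [extHom_proj, extHom_proj]; rfl
    rw [Category.assoc, extHom_proj]
    change _ = (extHom T _ _ _ _ ⨟ extHom T _ _ _ _) ≫ _
    rw [ecmp_proj, h, mapPair_ecmp, prod_eComp]
    refine (Category.assoc _ _ _).trans ?_
    refine (congrArg _ (mapPair_comp T _ _ _ _).symm).trans ?_
    rw [eComp_proj, eComp_proj]
    rfl

end External

section Modules

/-- A `V`-functor `Aᵒᵖ → V`, given by its (left) action. -/
structure Psh (V : Type v) [Category.{w} V] [MonoidalCategory V] (A : Type u₁)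
    [EnrichedCategory V A] where
  /-- the values -/
  obj : A → V
  /-- the action of the hom-objects -/
  act : ∀ a b, (a ⟶[V] b) ⊗ obj b ⟶ obj a
  act_id : ∀ a, eId V a ▷ obj a ≫ act a a = (λ_ _).hom
  act_comp : ∀ a b c, eComp V a b c ▷ obj c ≫ act a c =
    (α_ _ _ _).hom ≫ (a ⟶[V] b) ◁ act b c ≫ act a b

/-- A `V`-functor `A → V`, given by its (right) action. -/
structure CoPsh (V : Type v) [Category.{w} V] [MonoidalCategory V] (A : Type u₁)
    [EnrichedCategory V A] where
  /-- the values -/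
  obj : A → V
  /-- the action of the hom-objects -/
  act : ∀ a b, obj a ⊗ (a ⟶[V] b) ⟶ obj b
  act_id : ∀ a, obj a ◁ eId V a ≫ act a a = (ρ_ _).hom
  act_comp : ∀ a b c, (α_ _ _ _).hom ≫ obj a ◁ eComp V a b c ≫ act a c =
    act a b ▷ (b ⟶[V] c) ≫ act b c

/-- A `V`-module `C → D`, that is, a `V`-functor `Dᵒᵖ ⊗ C → V`, given by its two commuting
actions. The value at `(d, c)` is `obj d c`: contravariant in `d : D` and covariant in `c : C`. -/
structure VMod (V : Type v) [Category.{w} V] [MonoidalCategory V] (C : Type u₁)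
    [EnrichedCategory V C] (D : Type u₂) [EnrichedCategory V D] where
  /-- the values -/
  obj : D → C → V
  /-- the contravariant action of `D` -/
  lact : ∀ d d' c, (d ⟶[V] d') ⊗ obj d' c ⟶ obj d c
  /-- the covariant action of `C` -/
  ract : ∀ d c c', obj d c ⊗ (c ⟶[V] c') ⟶ obj d c'
  lact_id : ∀ d c, eId V d ▷ obj d c ≫ lact d d c = (λ_ _).hom
  lact_comp : ∀ d d' d'' c, eComp V d d' d'' ▷ obj d'' c ≫ lact d d'' c =
    (α_ _ _ _).hom ≫ (d ⟶[V] d') ◁ lact d' d'' c ≫ lact d d' c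
  ract_id : ∀ d c, obj d c ◁ eId V c ≫ ract d c c = (ρ_ _).hom
  ract_comp : ∀ d c c' c'', (α_ _ _ _).hom ≫ obj d c ◁ eComp V c c' c'' ≫ ract d c c'' =
    ract d c c' ▷ (c' ⟶[V] c'') ≫ ract d c' c''
  lact_ract : ∀ d d' c c', lact d d' c ▷ (c ⟶[V] c') ≫ ract d c c' =
    (α_ _ _ _).hom ≫ (d ⟶[V] d') ◁ ract d' c c' ≫ lact d d' c'

variable {A : Type u₁} [EnrichedCategory V A] {B : Type u₂} [EnrichedCategory V B]
  {C : Type u₃} [EnrichedCategory V C] {D : Type u₄} [EnrichedCategory V D]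

/-- The `V`-functor `M(-, c) : Dᵒᵖ → V`. -/
@[reducible]
def VMod.psh (M : VMod V C D) (c : C) : Psh V D where
  obj d := M.obj d c
  act d d' := M.lact d d' c
  act_id d := M.lact_id d c
  act_comp d d' d'' := M.lact_comp d d' d'' c

/-- The `V`-functor `M(d, -) : C → V`. -/
@[reducible]
def VMod.copsh (M : VMod V C D) (d : D) : CoPsh V C where
  obj c := M.obj d c
  act c c' := M.ract d c c'
  act_id c := M.ract_id d c
  act_comp c c' c'' := M.ract_comp d c c' c''

/-- The restriction of a `V`-functor `Bᵒᵖ → V` along a `V`-functor `F : A → B`. -/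
@[reducible]
def Psh.restrict (N : Psh V B) (F : EnrichedFunctor V A B) : Psh V A where
  obj a := N.obj (F.obj a)
  act a b := F.map a b ▷ _ ≫ N.act (F.obj a) (F.obj b)
  act_id a := by rw [← comp_whiskerRight_assoc, F.map_id, N.act_id]
  act_comp a b c := by
    rw [← comp_whiskerRight_assoc, F.map_comp, comp_whiskerRight_assoc, N.act_comp,
      MonoidalCategory.whiskerLeft_comp_assoc]
    rw [MonoidalCategory.tensorHom_def', comp_whiskerRight_assoc, associator_naturality_left_assoc,
      associator_naturality_middle_assoc, whisker_exchange_assoc, whisker_exchange_assoc,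
      whisker_exchange_assoc]

/-- The external product `(a, b) ↦ L a ⊗ L' b` of two covariant `V`-functors. -/
@[reducible]
def CoPsh.ext (L : CoPsh V A) (L' : CoPsh V B) : CoPsh V (A × B) where
  obj p := L.obj p.1 ⊗ L'.obj p.2
  act p q := tensorμ _ _ _ _ ≫ (L.act p.1 q.1 ⊗ₘ L'.act p.2 q.2)
  act_id p := by
    have h1 := L.act_id p.1
    have h2 := L'.act_id p.2
    rw [prod_eId, MonoidalCategory.whiskerLeft_comp_assoc, tensorμ_natural_right_assoc,
      tensorHom_comp_tensorHom, h1, h2, tensor_right_unitality]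
  act_comp p q r := by
    have h1 := L.act_comp p.1 q.1 r.1
    have h2 := L'.act_comp p.2 q.2 r.2
    rw [prod_eComp, MonoidalCategory.whiskerLeft_comp_assoc, tensorμ_natural_right_assoc,
      tensorHom_comp_tensorHom, comp_whiskerRight_assoc]
    have h3 := tensorμ_natural_left_assoc (L.act p.1 q.1) (L'.act p.2 q.2) (q.1 ⟶[V] r.1)
      (q.2 ⟶[V] r.2) (L.act q.1 r.1 ⊗ₘ L'.act q.2 r.2)
    refine Eq.trans ?_ (congrArg _ h3.symm)
    rw [tensorHom_comp_tensorHom, ← h1, ← h2, ← tensorHom_comp_tensorHom (α_ _ _ _).hom]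
    exact (tensor_associativity_assoc (C := V) _ _ _ _ _ _ _).symm

end Modules

section Colimits

open Limits

variable {A : Type u₁} [EnrichedCategory V A] {X : Type u₂} [EnrichedCategory V X]

/-- A family `W a ⊗ v ⟶ X(F a, x)` is `V`-natural in `a`. Such families are the generalized elements
at stage `v` of `[Aᵒᵖ, V](W, X(F -, x))`. -/
def IsCocone (W : Psh V A) (F : EnrichedFunctor V A X) (v : V) (x : X)
    (t : ∀ a, W.obj a ⊗ v ⟶ (F.obj a ⟶[V] x)) : Prop :=
  ∀ a b, W.act a b ▷ v ≫ t a = (α_ _ _ _).hom ≫ (F.map a b ⨟ t b)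

/-- The family `ι a : W a ⟶ X(F a, c)` exhibits `c` as the colimit of `F` weighted by `W`: it is
`V`-natural, and the map `X(c, x) ⟶ [Aᵒᵖ, V](W, X(F -, x))` it induces is invertible for every `x`,
that is, bijective on generalized elements at every stage `v`. -/
structure IsColim (W : Psh V A) (F : EnrichedFunctor V A X) (c : X)
    (ι : ∀ a, W.obj a ⟶ (F.obj a ⟶[V] c)) : Prop where
  nat : ∀ a b, W.act a b ≫ ι a = F.map a b ⨟ ι b
  existsUnique : ∀ (v : V) (x : X) (t : ∀ a, W.obj a ⊗ v ⟶ (F.obj a ⟶[V] x)),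
    IsCocone W F v x t → ∃! f : v ⟶ (c ⟶[V] x), ∀ a, ι a ⨟ f = t a

/-- A (chosen) colimit of `F` weighted by `W`. -/
structure Colim (W : Psh V A) (F : EnrichedFunctor V A X) where
  /-- the colimit object -/
  pt : X
  /-- the coprojections -/
  ι : ∀ a, W.obj a ⟶ (F.obj a ⟶[V] pt)
  isColim : IsColim W F pt ι

theorem IsColim.hom_ext {W : Psh V A} {F : EnrichedFunctor V A X} {c : X}
    {ι : ∀ a, W.obj a ⟶ (F.obj a ⟶[V] c)} (h : IsColim W F c ι) {v : V} {x : X}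
    {f g : v ⟶ (c ⟶[V] x)} (e : ∀ a, ι a ⨟ f = ι a ⨟ g) : f = g := by
  have hc : IsCocone W F v x (fun a => ι a ⨟ g) := by
    intro a b
    rw [← comp_ecmp, h.nat, ecmp_assoc]
  obtain ⟨k, _, hk⟩ := h.existsUnique v x _ hc
  rw [hk f e, hk g (fun _ => rfl)]

/-- The map `v ⟶ X(colim(W, F), x)` induced by a `V`-natural family. -/
def Colim.desc {W : Psh V A} {F : EnrichedFunctor V A X} (h : Colim W F) {v : V} {x : X}
    (t : ∀ a, W.obj a ⊗ v ⟶ (F.obj a ⟶[V] x)) (ht : IsCocone W F v x t) : v ⟶ (h.pt ⟶[V] x) :=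
  (h.isColim.existsUnique v x t ht).choose

theorem Colim.ι_desc {W : Psh V A} {F : EnrichedFunctor V A X} (h : Colim W F) {v : V} {x : X}
    (t : ∀ a, W.obj a ⊗ v ⟶ (F.obj a ⟶[V] x)) (ht : IsCocone W F v x t) (a : A) :
    h.ι a ⨟ h.desc t ht = t a :=
  (h.isColim.existsUnique v x t ht).choose_spec.1 a

end Colimits

section Extension

open Limits

variable {C : Type u} [EnrichedCategory V C] {D : Type u} [EnrichedCategory V D]
  {X : Type u₁} [EnrichedCategory V X] {Y : Type u₂} [EnrichedCategory V Y]

theorem isCocone_ract (M : VMod V C D) (F : EnrichedFunctor V D X)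
    (h : ∀ c, Colim (M.psh c) F) (c c' : C) :
    IsCocone (M.psh c) F (c ⟶[V] c') (h c').pt (fun d => M.ract d c c' ≫ (h c').ι d) := by
  intro a b
  rw [ecmp_comp, ← (h c').isColim.nat a b, ← Category.assoc, M.lact_ract]
  simp only [Category.assoc]

/-- The `V`-functor `c ↦ colim_d (M(d, c), F d)`. -/
def lanObj (M : VMod V C D) (F : EnrichedFunctor V D X) (h : ∀ c, Colim (M.psh c) F) :
    EnrichedFunctor V C X where
  obj c := (h c).pt
  map c c' := (h c).desc _ (isCocone_ract M F h c c')
  map_id c := by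
    apply (h c).isColim.hom_ext
    intro d
    have := M.ract_id d c
    rw [ecmp_comp, Colim.ι_desc, ecmp_eId, ← this, Category.assoc]
  map_comp c c' c'' := by
    apply (h c).isColim.hom_ext
    intro d
    have := M.ract_comp d c c' c''
    rw [ecmp_comp, Colim.ι_desc]
    change _ = _ ⨟ ((h c).desc _ _ ⨟ (h c').desc _ _)
    rw [← cancel_epi (α_ _ _ _).hom, ← ecmp_assoc, Colim.ι_desc, comp_ecmp, Colim.ι_desc,
      ← Category.assoc, ← Category.assoc, ← Category.assoc, ← this, Category.assoc,
      Category.assoc, Category.assoc, Category.assoc]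

/-- The coprojection `M(d, c) ⟶ X(F d, colim_d (M(d, c), F d))`. -/
def lanι (M : VMod V C D) (F : EnrichedFunctor V D X) (h : ∀ c, Colim (M.psh c) F) (c : C) (d : D) :
    M.obj d c ⟶ (F.obj d ⟶[V] (lanObj M F h).obj c) := (h c).ι d

theorem lan_hom_ext {M : VMod V C D} {F : EnrichedFunctor V D X} {h : ∀ c, Colim (M.psh c) F}
    {c : C} {v : V} {x : X} {f g : v ⟶ ((lanObj M F h).obj c ⟶[V] x)}
    (e : ∀ d, lanι M F h c d ⨟ f = lanι M F h c d ⨟ g) : f = g := (h c).isColim.hom_ext e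

theorem lanι_nat (M : VMod V C D) (F : EnrichedFunctor V D X) (h : ∀ c, Colim (M.psh c) F) (c : C)
    (d d' : D) : M.lact d d' c ≫ lanι M F h c d = F.map d d' ⨟ lanι M F h c d' :=
  (h c).isColim.nat d d'

theorem lanι_map (M : VMod V C D) (F : EnrichedFunctor V D X) (h : ∀ c, Colim (M.psh c) F)
    (c c' : C) (d : D) :
    lanι M F h c d ⨟ (lanObj M F h).map c c' = M.ract d c c' ≫ lanι M F h c' d :=
  Colim.ι_desc (h c) _ (isCocone_ract M F h c c') d

variable [MonoidalClosed V] [HasProducts.{u} V] [HasEqualizers V]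

/-- The map on colimits induced by the `V`-natural transformations `F → G`, at `c`. -/
def lanHomApp (M : VMod V C D) {F G : EnrichedFunctor V D X} (hF : ∀ c, Colim (M.psh c) F)
    (hG : ∀ c, Colim (M.psh c) G) (c : C) :
    (F ⟶[V] G) ⟶ ((lanObj M F hF).obj c ⟶[V] (lanObj M G hG).obj c) :=
  (hF c).desc (fun d => (β_ _ _).hom ≫ (proj F G d ⨟ lanι M G hG c d)) (by
    intro a b
    have h2 : proj F G a ⨟ G.map a b = (β_ _ _).hom ≫ (F.map a b ⨟ proj F G b) :=
      isVNat_funProj F G a b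
    rw [braiding_naturality_left_assoc, ← ecmp_comp, lanι_nat, ← Iso.inv_hom_id_assoc (α_ _ _ _)
      (proj F G a ⨟ _), ← ecmp_assoc, h2, comp_ecmp, ecmp_assoc, ecmp_comp,
      braiding_tensor_left_hom]
    simp only [Category.assoc, Iso.hom_inv_id_assoc, ← comp_whiskerRight_assoc,
      SymmetricCategory.symmetry]
    simp)

theorem lanι_lanHomApp (M : VMod V C D) {F G : EnrichedFunctor V D X}
    (hF : ∀ c, Colim (M.psh c) F) (hG : ∀ c, Colim (M.psh c) G) (c : C) (d : D) :
    lanι M F hF c d ⨟ lanHomApp M hF hG c = (β_ _ _).hom ≫ (proj F G d ⨟ lanι M G hG c d) :=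
  Colim.ι_desc (hF c) _ _ d

theorem isVNat_lanHomApp (M : VMod V C D) {F G : EnrichedFunctor V D X}
    (hF : ∀ c, Colim (M.psh c) F) (hG : ∀ c, Colim (M.psh c) G) :
    IsVNat (lanObj M F hF) (lanObj M G hG) (F ⟶[V] G) (lanHomApp M hF hG) := by
  intro c c'
  apply lan_hom_ext
  intro d
  rw [ecmp_comp, ← cancel_epi (α_ _ _ _).hom, ← ecmp_assoc, lanι_lanHomApp, comp_ecmp, ecmp_assoc,
    lanι_map, ecmp_comp, ← Iso.inv_hom_id_assoc (α_ _ _ _) (lanι M F hF c d ⨟ _), ← ecmp_assoc,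
    lanι_map, comp_ecmp, lanι_lanHomApp, braiding_naturality_left_assoc, braiding_tensor_left_hom]
  simp only [Category.assoc, Iso.inv_hom_id_assoc]
  rw [← MonoidalCategory.whiskerLeft_comp_assoc, SymmetricCategory.symmetry]
  simp

/-- The action on hom-objects of `F ↦ (c ↦ colim_d (M(d, c), F d))`. -/
def lanHom (M : VMod V C D) {F G : EnrichedFunctor V D X} (hF : ∀ c, Colim (M.psh c) F)
    (hG : ∀ c, Colim (M.psh c) G) : (F ⟶[V] G) ⟶ (lanObj M F hF ⟶[V] lanObj M G hG) :=
  lift (lanHomApp M hF hG) (isVNat_lanHomApp M hF hG)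

theorem lanHom_proj (M : VMod V C D) {F G : EnrichedFunctor V D X} (hF : ∀ c, Colim (M.psh c) F)
    (hG : ∀ c, Colim (M.psh c) G) (c : C) :
    lanHom M hF hG ≫ proj (lanObj M F hF) (lanObj M G hG) c = lanHomApp M hF hG c :=
  lift_proj _ _ _

/-- For a module `M : C → D` and a `V`-functor `Φ : Y → [D, X]`, the `V`-functor `Y → [C, X]` sending
`y` to `c ↦ colim_d (M(d, c), Φ(y) d)`, given that these colimits exist. -/
def lan (M : VMod V C D) (Φ : EnrichedFunctor V Y (EnrichedFunctor V D X))
    (h : ∀ y c, Colim (M.psh c) (Φ.obj y)) : EnrichedFunctor V Y (EnrichedFunctor V C X) where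
  obj y := lanObj M (Φ.obj y) (h y)
  map y y' := Φ.map y y' ≫ lanHom M (h y) (h y')
  map_id y := by
    apply hom_ext
    intro c
    rw [Φ.map_id_assoc, Category.assoc, lanHom_proj, eId_proj]
    apply lan_hom_ext
    intro d
    rw [ecmp_comp, lanι_lanHomApp, ecmp_eId, braiding_naturality_right_assoc, ← comp_ecmp,
      eId_proj, eId_ecmp, ← Category.assoc, braiding_leftUnitor]
  map_comp y y' y'' := by
    apply hom_ext
    intro c
    have key : ∀ (v : V) (F G : EnrichedFunctor V D X) (hF : ∀ c, Colim (M.psh c) F)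
        (hG : ∀ c, Colim (M.psh c) G) (k : v ⟶ (F ⟶[V] G)) (d : D),
        lanι M F hF c d ⨟ (k ≫ lanHomApp M hF hG c) =
          (β_ _ _).hom ≫ ((k ≫ proj F G d) ⨟ lanι M G hG c d) := by
      intro v F G hF hG k d
      rw [ecmp_comp, lanι_lanHomApp, braiding_naturality_right_assoc, comp_ecmp]
    rw [Φ.map_comp_assoc, Category.assoc]
    change (Φ.map y y' ⊗ₘ Φ.map y' y'') ≫ _ =
      ((Φ.map y y' ≫ lanHom M _ _) ⨟ (Φ.map y' y'' ≫ lanHom M _ _)) ≫ _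
    rw [ecmp_proj, Category.assoc, Category.assoc, Category.assoc, lanHom_proj, lanHom_proj,
      lanHom_proj]
    apply lan_hom_ext
    intro d
    rw [← Category.assoc (Φ.map y y' ⊗ₘ Φ.map y' y'')]
    change lanι M (Φ.obj y) (h y) c d ⨟
      ((Φ.map y y' ⨟ Φ.map y' y'') ≫ lanHomApp M (h y) (h y'') c) = _
    rw [key, ecmp_proj, ecmp_assoc, ← cancel_epi (α_ _ _ _).hom,
      ← ecmp_assoc (lanι M (Φ.obj y) (h y) c d), key,
      comp_ecmp (β_ _ _).hom,
      ecmp_assoc, key, ecmp_comp (β_ _ _).hom, braiding_tensor_right_hom]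
    simp only [Category.assoc, Iso.inv_hom_id_assoc, Iso.hom_inv_id_assoc]

end Extension

section Coends

open Limits MonoidalClosed

variable {A : Type u} [EnrichedCategory V A]

/-- The symmetry `q ⊗ (x ⊗ y) ⟶ x ⊗ (q ⊗ y)`. -/
def lcomm (q x y : V) : q ⊗ (x ⊗ y) ⟶ x ⊗ (q ⊗ y) :=
  (α_ q x y).inv ≫ (β_ q x).hom ▷ y ≫ (α_ x q y).hom

variable [HasCoproducts.{u} V] [HasCoequalizers V]

/-- The first map in the coequalizer diagram of the coend `∫^a L a ⊗ N a`. -/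
def tensMapL (L : CoPsh V A) (N : Psh V A) :
    (∐ fun p : A × A => (L.obj p.1 ⊗ (p.1 ⟶[V] p.2)) ⊗ N.obj p.2) ⟶
      ∐ fun a => L.obj a ⊗ N.obj a :=
  Sigma.desc fun p => L.act p.1 p.2 ▷ N.obj p.2 ≫ Sigma.ι (fun a => L.obj a ⊗ N.obj a) p.2

/-- The second map in the coequalizer diagram of the coend `∫^a L a ⊗ N a`. -/
def tensMapR (L : CoPsh V A) (N : Psh V A) :
    (∐ fun p : A × A => (L.obj p.1 ⊗ (p.1 ⟶[V] p.2)) ⊗ N.obj p.2) ⟶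
      ∐ fun a => L.obj a ⊗ N.obj a :=
  Sigma.desc fun p => (α_ _ _ _).hom ≫ L.obj p.1 ◁ N.act p.1 p.2 ≫
    Sigma.ι (fun a => L.obj a ⊗ N.obj a) p.1

/-- The coend `∫^a L a ⊗ N a`, that is, the colimit `colim_a (N a, L a)` in `V`. -/
def tens (L : CoPsh V A) (N : Psh V A) : V := coequalizer (tensMapL L N) (tensMapR L N)

/-- The coprojection `L a ⊗ N a ⟶ ∫^a L a ⊗ N a`. -/
def tensι (L : CoPsh V A) (N : Psh V A) (a : A) : L.obj a ⊗ N.obj a ⟶ tens L N :=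
  Sigma.ι (fun a => L.obj a ⊗ N.obj a) a ≫ coequalizer.π (tensMapL L N) (tensMapR L N)

/-- The quotient map of the coend. -/
def tensπ (L : CoPsh V A) (N : Psh V A) : (∐ fun a => L.obj a ⊗ N.obj a) ⟶ tens L N :=
  coequalizer.π (tensMapL L N) (tensMapR L N)

theorem tensι_eq (L : CoPsh V A) (N : Psh V A) (a : A) :
    tensι L N a = Sigma.ι (fun a => L.obj a ⊗ N.obj a) a ≫ tensπ L N := rfl

/-- A map out of `q ⊗ ∫^a L a ⊗ N a` is the same as a balanced family of maps out of the
`q ⊗ (L a ⊗ N a)`. (The analogous statement with `q` on the right follows by symmetry.) -/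
theorem tens_existsUnique [MonoidalClosed V] (L : CoPsh V A) (N : Psh V A) {q z : V}
    (f : ∀ a, q ⊗ (L.obj a ⊗ N.obj a) ⟶ z)
    (hf : ∀ a b, q ◁ (L.act a b ▷ N.obj b) ≫ f b =
      q ◁ ((α_ _ _ _).hom ≫ L.obj a ◁ N.act a b) ≫ f a) :
    ∃! g : q ⊗ tens L N ⟶ z, ∀ a, q ◁ tensι L N a ≫ g = f a := by
  have h : tensMapL L N ≫ Sigma.desc (fun a => curry (f a)) =
      tensMapR L N ≫ Sigma.desc (fun a => curry (f a)) := by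
    apply Sigma.hom_ext
    rintro ⟨a, b⟩
    rw [tensMapL, tensMapR, Sigma.ι_desc_assoc, Sigma.ι_desc_assoc, Category.assoc, Category.assoc,
      Category.assoc, Sigma.ι_desc, Sigma.ι_desc, ← curry_natural_left, hf, curry_natural_left,
      Category.assoc]
  obtain ⟨d, hd⟩ : ∃ d : tens L N ⟶ (ihom q).obj z,
      tensπ L N ≫ d = Sigma.desc (fun a => curry (f a)) :=
    ⟨coequalizer.desc _ h, coequalizer.π_desc _ _⟩
  have key : ∀ a, tensι L N a ≫ d = curry (f a) := by
    intro a
    rw [tensι_eq, Category.assoc, hd, Sigma.ι_desc]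
  have ext : ∀ d' : tens L N ⟶ (ihom q).obj z, (∀ a, tensι L N a ≫ d' = curry (f a)) → d' = d := by
    intro d' h'
    have : tensπ L N ≫ d' = tensπ L N ≫ d := by
      apply Sigma.hom_ext
      intro a
      have h1 := h' a
      have h2 := key a
      rw [tensι_eq, Category.assoc] at h1 h2
      exact h1.trans h2.symm
    exact coequalizer.hom_ext this
  refine ⟨uncurry d, ?_, ?_⟩
  · intro a
    rw [← uncurry_natural_left, key, uncurry_curry]
  · intro g hg
    rw [← uncurry_curry g]
    congr 1
    apply ext
    intro a
    rw [← curry_natural_left, hg]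

end Coends

section Promonoidal

open Limits

variable {A : Type u} [EnrichedCategory V A] {B : Type u} [EnrichedCategory V B]

/-- The action `A(a, a') ⊗ P(a', b, c) ⟶ P(a, b, c)`. -/
def VMod.act₁ (P : VMod V A (A × A)) (a a' b c : A) :
    (a ⟶[V] a') ⊗ P.obj (a', b) c ⟶ P.obj (a, b) c :=
  ((P.psh c).restrict (secL b)).act a a'

/-- The action `A(b, b') ⊗ P(a, b', c) ⟶ P(a, b, c)`. -/
def VMod.act₂ (P : VMod V A (A × A)) (a b b' c : A) :
    (b ⟶[V] b') ⊗ P.obj (a, b') c ⟶ P.obj (a, b) c :=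
  ((P.psh c).restrict (secR a)).act b b'

variable [HasCoproducts.{u} V] [HasCoequalizers V]

/-- `∫^u P(a₁, a₂, u) ⊗ P(u, a₃, a)` -/
def leftComp (P : VMod V A (A × A)) (a₁ a₂ a₃ a : A) : V :=
  tens (P.copsh (a₁, a₂)) ((P.psh a).restrict (secL a₃))

/-- The coprojections of `leftComp`. -/
def leftι (P : VMod V A (A × A)) (a₁ a₂ a₃ a u : A) :
    P.obj (a₁, a₂) u ⊗ P.obj (u, a₃) a ⟶ leftComp P a₁ a₂ a₃ a :=
  tensι (P.copsh (a₁, a₂)) ((P.psh a).restrict (secL a₃)) u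

/-- `∫^u P(a₂, a₃, u) ⊗ P(a₁, u, a)` -/
def rightComp (P : VMod V A (A × A)) (a₁ a₂ a₃ a : A) : V :=
  tens (P.copsh (a₂, a₃)) ((P.psh a).restrict (secR a₁))

/-- The coprojections of `rightComp`. -/
def rightι (P : VMod V A (A × A)) (a₁ a₂ a₃ a u : A) :
    P.obj (a₂, a₃) u ⊗ P.obj (a₁, u) a ⟶ rightComp P a₁ a₂ a₃ a :=
  tensι (P.copsh (a₂, a₃)) ((P.psh a).restrict (secR a₁)) u

/-- The data of a promonoidal `V`-category: the multiplication module `P : A → A ⊗ A`, the unit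
module `J : A → I`, and the associativity and unit isomorphisms
`∫^u P(a₁, a₂, u) ⊗ P(u, a₃, a) ≅ ∫^u P(a₂, a₃, u) ⊗ P(a₁, u, a)`,
`∫^j J j ⊗ P(j, a₁, a) ≅ A(a₁, a)` and `∫^j J j ⊗ P(a₁, j, a) ≅ A(a₁, a)`. -/
structure PromonoidalData (V : Type v) [Category.{w} V] [MonoidalCategory V] [SymmetricCategory V]
    [HasCoproducts.{u} V] [HasCoequalizers V] (A : Type u) [EnrichedCategory V A] where
  /-- the multiplication `P(a₁, a₂, a)` -/
  P : VMod V A (A × A)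
  /-- the unit `J a` -/
  J : VMod V A PUnit.{u + 1}
  /-- associativity -/
  assoc : ∀ a₁ a₂ a₃ a, leftComp P a₁ a₂ a₃ a ≅ rightComp P a₁ a₂ a₃ a
  /-- left unit -/
  lunit : ∀ a₁ a, tens (J.copsh PUnit.unit) ((P.psh a).restrict (secL a₁)) ≅ (a₁ ⟶[V] a)
  /-- right unit -/
  runit : ∀ a₁ a, tens (J.copsh PUnit.unit) ((P.psh a).restrict (secR a₁)) ≅ (a₁ ⟶[V] a)

namespace PromonoidalData

/-- The value `J a`. -/
abbrev Jo (p : PromonoidalData V A) (a : A) : V := p.J.obj PUnit.unit a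

/-- The associativity constraint restricted along the coprojections. -/
def assocι (p : PromonoidalData V A) (a₁ a₂ a₃ a u : A) :
    p.P.obj (a₁, a₂) u ⊗ p.P.obj (u, a₃) a ⟶ rightComp p.P a₁ a₂ a₃ a :=
  leftι p.P a₁ a₂ a₃ a u ≫ (p.assoc a₁ a₂ a₃ a).hom

/-- The left unit constraint restricted along the coprojections. -/
def lunitι (p : PromonoidalData V A) (a₁ a j : A) :
    p.Jo j ⊗ p.P.obj (j, a₁) a ⟶ (a₁ ⟶[V] a) :=
  tensι (p.J.copsh PUnit.unit) ((p.P.psh a).restrict (secL a₁)) j ≫ (p.lunit a₁ a).hom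

/-- The right unit constraint restricted along the coprojections. -/
def runitι (p : PromonoidalData V A) (a₁ a j : A) :
    p.Jo j ⊗ p.P.obj (a₁, j) a ⟶ (a₁ ⟶[V] a) :=
  tensι (p.J.copsh PUnit.unit) ((p.P.psh a).restrict (secR a₁)) j ≫ (p.runit a₁ a).hom

end PromonoidalData

/-- A promonoidal `V`-category. All axioms are equalities of maps out of coends, and are expressed
through the coprojections: a map out of (an object tensored with) a coend is named by its defining
equations, which have exactly one solution by `tens_existsUnique`. -/
structure Promonoidal (V : Type v) [Category.{w} V] [MonoidalCategory V] [SymmetricCategory V]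
    [HasCoproducts.{u} V] [HasCoequalizers V] (A : Type u) [EnrichedCategory V A]
    extends PromonoidalData V A where
  /-- naturality of `assoc` in `a`; here `r` is the action of `A(a, a')` on the codomain -/
  assoc_nat : ∀ a₁ a₂ a₃ a a', ∃ r : rightComp P a₁ a₂ a₃ a ⊗ (a ⟶[V] a') ⟶
      rightComp P a₁ a₂ a₃ a',
    (∀ u, rightι P a₁ a₂ a₃ a u ▷ _ ≫ r =
      (α_ _ _ _).hom ≫ _ ◁ P.ract (a₁, u) a a' ≫ rightι P a₁ a₂ a₃ a' u) ∧
    ∀ u, toPromonoidalData.assocι a₁ a₂ a₃ a u ▷ _ ≫ r =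
      (α_ _ _ _).hom ≫ _ ◁ P.ract (u, a₃) a a' ≫ toPromonoidalData.assocι a₁ a₂ a₃ a' u
  /-- naturality of `assoc` in `a₁` -/
  assoc_nat₁ : ∀ a₁' a₁ a₂ a₃ a, ∃ r : (a₁' ⟶[V] a₁) ⊗ rightComp P a₁ a₂ a₃ a ⟶
      rightComp P a₁' a₂ a₃ a,
    (∀ u, _ ◁ rightι P a₁ a₂ a₃ a u ≫ r =
      lcomm _ _ _ ≫ _ ◁ P.act₁ a₁' a₁ u a ≫ rightι P a₁' a₂ a₃ a u) ∧
    ∀ u, _ ◁ toPromonoidalData.assocι a₁ a₂ a₃ a u ≫ r =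
      (α_ _ _ _).inv ≫ P.act₁ a₁' a₁ a₂ u ▷ _ ≫ toPromonoidalData.assocι a₁' a₂ a₃ a u
  /-- naturality of `assoc` in `a₂` -/
  assoc_nat₂ : ∀ a₁ a₂' a₂ a₃ a, ∃ r : (a₂' ⟶[V] a₂) ⊗ rightComp P a₁ a₂ a₃ a ⟶
      rightComp P a₁ a₂' a₃ a,
    (∀ u, _ ◁ rightι P a₁ a₂ a₃ a u ≫ r =
      (α_ _ _ _).inv ≫ P.act₁ a₂' a₂ a₃ u ▷ _ ≫ rightι P a₁ a₂' a₃ a u) ∧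
    ∀ u, _ ◁ toPromonoidalData.assocι a₁ a₂ a₃ a u ≫ r =
      (α_ _ _ _).inv ≫ P.act₂ a₁ a₂' a₂ u ▷ _ ≫ toPromonoidalData.assocι a₁ a₂' a₃ a u
  /-- naturality of `assoc` in `a₃` -/
  assoc_nat₃ : ∀ a₁ a₂ a₃' a₃ a, ∃ r : (a₃' ⟶[V] a₃) ⊗ rightComp P a₁ a₂ a₃ a ⟶
      rightComp P a₁ a₂ a₃' a,
    (∀ u, _ ◁ rightι P a₁ a₂ a₃ a u ≫ r =
      (α_ _ _ _).inv ≫ P.act₂ a₂ a₃' a₃ u ▷ _ ≫ rightι P a₁ a₂ a₃' a u) ∧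
    ∀ u, _ ◁ toPromonoidalData.assocι a₁ a₂ a₃ a u ≫ r =
      lcomm _ _ _ ≫ _ ◁ P.act₂ u a₃' a₃ a ≫ toPromonoidalData.assocι a₁ a₂ a₃' a u
  lunit_nat : ∀ a₁ a a' j, toPromonoidalData.lunitι a₁ a j ▷ (a ⟶[V] a') ≫ eComp V a₁ a a' =
    (α_ _ _ _).hom ≫ _ ◁ P.ract (j, a₁) a a' ≫ toPromonoidalData.lunitι a₁ a' j
  lunit_nat₁ : ∀ a₁' a₁ a j, (a₁' ⟶[V] a₁) ◁ toPromonoidalData.lunitι a₁ a j ≫ eComp V a₁' a₁ a =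
    lcomm _ _ _ ≫ _ ◁ P.act₂ j a₁' a₁ a ≫ toPromonoidalData.lunitι a₁' a j
  runit_nat : ∀ a₁ a a' j, toPromonoidalData.runitι a₁ a j ▷ (a ⟶[V] a') ≫ eComp V a₁ a a' =
    (α_ _ _ _).hom ≫ _ ◁ P.ract (a₁, j) a a' ≫ toPromonoidalData.runitι a₁ a' j
  runit_nat₁ : ∀ a₁' a₁ a j, (a₁' ⟶[V] a₁) ◁ toPromonoidalData.runitι a₁ a j ≫ eComp V a₁' a₁ a =
    lcomm _ _ _ ≫ _ ◁ P.act₁ a₁' a₁ j a ≫ toPromonoidalData.runitι a₁' a j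
  /-- The pentagon: the two maps
  `∫^{u,v} P(a₁, a₂, u) P(u, a₃, v) P(v, a₄, a) ⟶ ∫^{u,x} P(a₃, a₄, u) P(a₂, u, x) P(a₁, x, a)`
  agree. It is stated by composing them with a map `g₄` from their codomain to an arbitrary `z`; the
  families `g₃`, `g₂` (three-step side) and `g₅`, `g₁` (two-step side) are the maps out of the
  intermediate coends obtained by precomposition with the associativity constraint. -/
  pentagon : ∀ (a₁ a₂ a₃ a₄ a : A) (z : V)
    (g₄ : ∀ x, rightComp P a₂ a₃ a₄ x ⊗ P.obj (a₁, x) a ⟶ z)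
    (g₃ : ∀ u, P.obj (a₂, a₃) u ⊗ rightComp P a₁ u a₄ a ⟶ z)
    (g₂ : ∀ y, rightComp P a₁ a₂ a₃ y ⊗ P.obj (y, a₄) a ⟶ z)
    (g₅ : ∀ u, P.obj (a₃, a₄) u ⊗ rightComp P a₁ a₂ u a ⟶ z)
    (g₁ : ∀ u, P.obj (a₁, a₂) u ⊗ rightComp P u a₃ a₄ a ⟶ z),
    (∀ u x, _ ◁ rightι P a₁ u a₄ a x ≫ g₃ u =
      (α_ _ _ _).inv ≫ toPromonoidalData.assocι a₂ a₃ a₄ x u ▷ _ ≫ g₄ x) →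
    (∀ u y, rightι P a₁ a₂ a₃ y u ▷ _ ≫ g₂ y =
      (α_ _ _ _).hom ≫ _ ◁ toPromonoidalData.assocι a₁ u a₄ a y ≫ g₃ u) →
    (∀ u x, _ ◁ rightι P a₁ a₂ u a x ≫ g₅ u =
      (α_ _ _ _).inv ≫ rightι P a₂ a₃ a₄ x u ▷ _ ≫ g₄ x) →
    (∀ u x, _ ◁ rightι P u a₃ a₄ a x ≫ g₁ u =
      lcomm _ _ _ ≫ _ ◁ toPromonoidalData.assocι a₁ a₂ x a u ≫ g₅ x) →
    ∀ u y, toPromonoidalData.assocι a₁ a₂ a₃ y u ▷ _ ≫ g₂ y =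
      (α_ _ _ _).hom ≫ _ ◁ toPromonoidalData.assocι u a₃ a₄ a y ≫ g₁ u
  /-- The triangle: the two maps `∫^{j,u} J j ⊗ P(a₁, j, u) ⊗ P(u, a₂, a) ⟶ P(a₁, a₂, a)`
  agree. -/
  triangle : ∀ a₁ a₂ a j, ∃ r : toPromonoidalData.Jo j ⊗ rightComp P a₁ j a₂ a ⟶ P.obj (a₁, a₂) a,
    (∀ u, _ ◁ rightι P a₁ j a₂ a u ≫ r =
      (α_ _ _ _).inv ≫ toPromonoidalData.lunitι a₂ u j ▷ _ ≫ P.act₂ a₁ a₂ u a) ∧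
    ∀ u, _ ◁ toPromonoidalData.assocι a₁ j a₂ a u ≫ r =
      (α_ _ _ _).inv ≫ toPromonoidalData.runitι a₁ u j ▷ _ ≫ P.act₁ a₁ u a₂ a

end Promonoidal

section PromonoidalModule

open Limits

variable {A : Type u} [EnrichedCategory V A] {B : Type u} [EnrichedCategory V B]
  [HasCoproducts.{u} V] [HasCoequalizers V]

/-- `∫^{b₁, b₂} (K(a₁, b₁) ⊗ K(a₂, b₂)) ⊗ P(b₁, b₂, b)` -/
def srcComp (K : VMod V B A) (P : VMod V B (B × B)) (a₁ a₂ : A) (b : B) : V :=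
  tens ((K.copsh a₁).ext (K.copsh a₂)) (P.psh b)

/-- The coprojections of `srcComp`. -/
def srcι (K : VMod V B A) (P : VMod V B (B × B)) (a₁ a₂ : A) (b b₁ b₂ : B) :
    (K.obj a₁ b₁ ⊗ K.obj a₂ b₂) ⊗ P.obj (b₁, b₂) b ⟶ srcComp K P a₁ a₂ b :=
  tensι ((K.copsh a₁).ext (K.copsh a₂)) (P.psh b) (b₁, b₂)

/-- `∫^a P(a₁, a₂, a) ⊗ K(a, b)` -/
def tgtComp (P : VMod V A (A × A)) (K : VMod V B A) (a₁ a₂ : A) (b : B) : V :=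
  tens (P.copsh (a₁, a₂)) (K.psh b)

/-- The coprojections of `tgtComp`. -/
def tgtι (P : VMod V A (A × A)) (K : VMod V B A) (a₁ a₂ : A) (b : B) (a : A) :
    P.obj (a₁, a₂) a ⊗ K.obj a b ⟶ tgtComp P K a₁ a₂ b :=
  tensι (P.copsh (a₁, a₂)) (K.psh b) a

/-- `∫^a J a ⊗ K(a, b)` -/
def unitComp (J : VMod V A PUnit.{u + 1}) (K : VMod V B A) (b : B) : V :=
  tens (J.copsh PUnit.unit) (K.psh b)

/-- The coprojections of `unitComp`. -/
def unitι (J : VMod V A PUnit.{u + 1}) (K : VMod V B A) (b : B) (a : A) :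
    J.obj PUnit.unit a ⊗ K.obj a b ⟶ unitComp J K b :=
  tensι (J.copsh PUnit.unit) (K.psh b) a

/-- The data of a promonoidal module from `B` to `A`: a module `K : B → A` and maps
`φ : ∫^{b₁, b₂} (K(a₁, b₁) ⊗ K(a₂, b₂)) ⊗ P(b₁, b₂, b) ⟶ ∫^a P(a₁, a₂, a) ⊗ K(a, b)` and
`φ₀ : J b ⟶ ∫^a J a ⊗ K(a, b)`. -/
structure PromonoidalModuleData (pA : Promonoidal V A) (pB : Promonoidal V B) where
  /-- the underlying module -/
  K : VMod V B A
  /-- the multiplication constraint -/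
  φ : ∀ a₁ a₂ b, srcComp K pB.P a₁ a₂ b ⟶ tgtComp pA.P K a₁ a₂ b
  /-- the unit constraint -/
  φ₀ : ∀ b, pB.Jo b ⟶ unitComp pA.J K b

variable {pA : Promonoidal V A} {pB : Promonoidal V B}

/-- The multiplication constraint restricted along the coprojections. -/
def PromonoidalModuleData.φι (k : PromonoidalModuleData pA pB) (a₁ a₂ : A) (b b₁ b₂ : B) :
    (k.K.obj a₁ b₁ ⊗ k.K.obj a₂ b₂) ⊗ pB.P.obj (b₁, b₂) b ⟶ tgtComp pA.P k.K a₁ a₂ b :=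
  srcι k.K pB.P a₁ a₂ b b₁ b₂ ≫ k.φ a₁ a₂ b

/-- The symmetry `(p ⊗ k) ⊗ (l ⊗ q) ⟶ p ⊗ ((k ⊗ l) ⊗ q)`. -/
def shuffleL (p k l q : V) : (p ⊗ k) ⊗ (l ⊗ q) ⟶ p ⊗ ((k ⊗ l) ⊗ q) :=
  (α_ p k (l ⊗ q)).hom ≫ p ◁ (α_ k l q).inv

/-- The symmetry `(p ⊗ k) ⊗ (l ⊗ q) ⟶ p ⊗ ((l ⊗ k) ⊗ q)`. -/
def shuffleR (p k l q : V) : (p ⊗ k) ⊗ (l ⊗ q) ⟶ p ⊗ ((l ⊗ k) ⊗ q) :=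
  shuffleL p k l q ≫ p ◁ ((β_ k l).hom ▷ q)

/-- A promonoidal module from `B` to `A`, that is, a lax morphism of pseudomonoids in `V`-`Modᵒᵖ`.
As for `Promonoidal`, maps out of coends are named by their defining equations. -/
structure PromonoidalModule (pA : Promonoidal V A) (pB : Promonoidal V B)
    extends PromonoidalModuleData pA pB where
  /-- naturality of `φ` in `b`; here `r` is the action of `B(b, b')` on the codomain -/
  φ_nat : ∀ a₁ a₂ b b', ∃ r : tgtComp pA.P K a₁ a₂ b ⊗ (b ⟶[V] b') ⟶ tgtComp pA.P K a₁ a₂ b',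
    (∀ a, tgtι pA.P K a₁ a₂ b a ▷ _ ≫ r =
      (α_ _ _ _).hom ≫ _ ◁ K.ract a b b' ≫ tgtι pA.P K a₁ a₂ b' a) ∧
    ∀ b₁ b₂, toPromonoidalModuleData.φι a₁ a₂ b b₁ b₂ ▷ _ ≫ r =
      (α_ _ _ _).hom ≫ _ ◁ pB.P.ract (b₁, b₂) b b' ≫ toPromonoidalModuleData.φι a₁ a₂ b' b₁ b₂
  /-- naturality of `φ` in `a₁` -/
  φ_nat₁ : ∀ a₁' a₁ a₂ b, ∃ r : (a₁' ⟶[V] a₁) ⊗ tgtComp pA.P K a₁ a₂ b ⟶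
      tgtComp pA.P K a₁' a₂ b,
    (∀ a, _ ◁ tgtι pA.P K a₁ a₂ b a ≫ r =
      (α_ _ _ _).inv ≫ pA.P.act₁ a₁' a₁ a₂ a ▷ _ ≫ tgtι pA.P K a₁' a₂ b a) ∧
    ∀ b₁ b₂, _ ◁ toPromonoidalModuleData.φι a₁ a₂ b b₁ b₂ ≫ r =
      (α_ _ _ _).inv ≫ ((α_ _ _ _).inv ≫ K.lact a₁' a₁ b₁ ▷ _) ▷ _ ≫
        toPromonoidalModuleData.φι a₁' a₂ b b₁ b₂
  /-- naturality of `φ` in `a₂` -/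
  φ_nat₂ : ∀ a₁ a₂' a₂ b, ∃ r : (a₂' ⟶[V] a₂) ⊗ tgtComp pA.P K a₁ a₂ b ⟶
      tgtComp pA.P K a₁ a₂' b,
    (∀ a, _ ◁ tgtι pA.P K a₁ a₂ b a ≫ r =
      (α_ _ _ _).inv ≫ pA.P.act₂ a₁ a₂' a₂ a ▷ _ ≫ tgtι pA.P K a₁ a₂' b a) ∧
    ∀ b₁ b₂, _ ◁ toPromonoidalModuleData.φι a₁ a₂ b b₁ b₂ ≫ r =
      (α_ _ _ _).inv ≫ (lcomm _ _ _ ≫ _ ◁ K.lact a₂' a₂ b₂) ▷ _ ≫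
        toPromonoidalModuleData.φι a₁ a₂' b b₁ b₂
  /-- naturality of `φ₀` -/
  φ₀_nat : ∀ b b', ∃ r : unitComp pA.J K b ⊗ (b ⟶[V] b') ⟶ unitComp pA.J K b',
    (∀ a, unitι pA.J K b a ▷ _ ≫ r =
      (α_ _ _ _).hom ≫ _ ◁ K.ract a b b' ≫ unitι pA.J K b' a) ∧
    φ₀ b ▷ _ ≫ r = pB.J.ract PUnit.unit b b' ≫ φ₀ b'
  /-- Compatibility with associativity: the two maps from
  `∫ K(a₁, b₁) K(a₂, b₂) K(a₃, b₃) P(b₁, b₂, c) P(c, b₃, b)` to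
  `∫ P(a₂, a₃, w) P(a₁, w, a) K(a, b)` agree. It is stated by composing them with a map `g₄` from
  their codomain to an arbitrary `z`; the families `g₃`, `g₂` belong to the composite that applies
  `φ` twice and then the associativity of `A`, the families `g₅`, `g₆`, `g₇` to the one that
  applies the associativity of `B` and then `φ` twice. -/
  φ_assoc : ∀ (a₁ a₂ a₃ : A) (b : B) (z : V)
    (g₄ : ∀ a, rightComp pA.P a₁ a₂ a₃ a ⊗ K.obj a b ⟶ z)
    (g₃ : ∀ u, pA.P.obj (a₁, a₂) u ⊗ tgtComp pA.P K u a₃ b ⟶ z)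
    (g₂ : ∀ c b₃, tgtComp pA.P K a₁ a₂ c ⊗ (K.obj a₃ b₃ ⊗ pB.P.obj (c, b₃) b) ⟶ z)
    (g₅ : ∀ w, pA.P.obj (a₂, a₃) w ⊗ tgtComp pA.P K a₁ w b ⟶ z)
    (g₆ : ∀ b₁ d, tgtComp pA.P K a₂ a₃ d ⊗ (K.obj a₁ b₁ ⊗ pB.P.obj (b₁, d) b) ⟶ z)
    (g₇ : ∀ b₁ b₂ b₃, (K.obj a₁ b₁ ⊗ (K.obj a₂ b₂ ⊗ K.obj a₃ b₃)) ⊗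
      rightComp pB.P b₁ b₂ b₃ b ⟶ z),
    (∀ u a, _ ◁ tgtι pA.P K u a₃ b a ≫ g₃ u =
      (α_ _ _ _).inv ≫ pA.assocι a₁ a₂ a₃ a u ▷ _ ≫ g₄ a) →
    (∀ u c b₃, tgtι pA.P K a₁ a₂ c u ▷ _ ≫ g₂ c b₃ =
      shuffleL _ _ _ _ ≫ _ ◁ toPromonoidalModuleData.φι u a₃ b c b₃ ≫ g₃ u) →
    (∀ w a, _ ◁ tgtι pA.P K a₁ w b a ≫ g₅ w =
      (α_ _ _ _).inv ≫ rightι pA.P a₁ a₂ a₃ a w ▷ _ ≫ g₄ a) →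
    (∀ w b₁ d, tgtι pA.P K a₂ a₃ d w ▷ _ ≫ g₆ b₁ d =
      shuffleR _ _ _ _ ≫ _ ◁ toPromonoidalModuleData.φι a₁ w b b₁ d ≫ g₅ w) →
    (∀ b₁ b₂ b₃ d, _ ◁ rightι pB.P b₁ b₂ b₃ b d ≫ g₇ b₁ b₂ b₃ =
      (β_ _ _).hom ▷ _ ≫ tensorμ _ _ _ _ ≫
        toPromonoidalModuleData.φι a₂ a₃ d b₂ b₃ ▷ _ ≫ g₆ b₁ d) →
    ∀ b₁ b₂ b₃ c, toPromonoidalModuleData.φι a₁ a₂ c b₁ b₂ ▷ _ ≫ g₂ c b₃ =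
      tensorμ _ _ _ _ ≫ (α_ _ _ _).hom ▷ _ ≫ _ ◁ pB.assocι b₁ b₂ b₃ b c ≫ g₇ b₁ b₂ b₃
  /-- Compatibility with the left unit constraints: the two maps
  `∫ J j ⊗ K(a₂, b₂) ⊗ P(j, b₂, b) ⟶ K(a₂, b)` agree. -/
  φ_lunit : ∀ (a₂ : A) (b : B),
    ∃ (g₁ : ∀ u, pA.Jo u ⊗ tgtComp pA.P K u a₂ b ⟶ K.obj a₂ b)
      (g₂ : ∀ j b₂, unitComp pA.J K j ⊗ (K.obj a₂ b₂ ⊗ pB.P.obj (j, b₂) b) ⟶ K.obj a₂ b),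
    (∀ u a, _ ◁ tgtι pA.P K u a₂ b a ≫ g₁ u =
      (α_ _ _ _).inv ≫ pA.lunitι a₂ a u ▷ _ ≫ K.lact a₂ a b) ∧
    (∀ u j b₂, unitι pA.J K j u ▷ _ ≫ g₂ j b₂ =
      shuffleL _ _ _ _ ≫ _ ◁ toPromonoidalModuleData.φι u a₂ b j b₂ ≫ g₁ u) ∧
    ∀ j b₂, φ₀ j ▷ _ ≫ g₂ j b₂ = lcomm _ _ _ ≫ _ ◁ pB.lunitι b₂ b j ≫ K.ract a₂ b₂ b
  /-- Compatibility with the right unit constraints: the two maps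
  `∫ J j ⊗ K(a₁, b₁) ⊗ P(b₁, j, b) ⟶ K(a₁, b)` agree. -/
  φ_runit : ∀ (a₁ : A) (b : B),
    ∃ (g₁ : ∀ u, pA.Jo u ⊗ tgtComp pA.P K a₁ u b ⟶ K.obj a₁ b)
      (g₂ : ∀ j b₁, unitComp pA.J K j ⊗ (K.obj a₁ b₁ ⊗ pB.P.obj (b₁, j) b) ⟶ K.obj a₁ b),
    (∀ u a, _ ◁ tgtι pA.P K a₁ u b a ≫ g₁ u =
      (α_ _ _ _).inv ≫ pA.runitι a₁ a u ▷ _ ≫ K.lact a₁ a b) ∧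
    (∀ u j b₁, unitι pA.J K j u ▷ _ ≫ g₂ j b₁ =
      shuffleR _ _ _ _ ≫ _ ◁ toPromonoidalModuleData.φι a₁ u b b₁ j ≫ g₁ u) ∧
    ∀ j b₁, φ₀ j ▷ _ ≫ g₂ j b₁ = lcomm _ _ _ ≫ _ ◁ pB.runitι b₁ b j ≫ K.ract a₁ b₁ b

/-- A promonoidal module is strong when `φ` and `φ₀` are invertible. -/
def PromonoidalModule.IsStrong (k : PromonoidalModule pA pB) : Prop :=
  (∀ a₁ a₂ b, IsIso (k.φ a₁ a₂ b)) ∧ ∀ b, IsIso (k.φ₀ b)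

end PromonoidalModule

section Monoidal

variable {X : Type u₁} [EnrichedCategory V X] {Y : Type u₂} [EnrichedCategory V Y]
  {Z : Type u₃} [EnrichedCategory V Z]

/-- The composite of `h : p ⟶ X(x, y)` with a morphism `f : y → z`. -/
def post {x y z : X} {p : V} (h : p ⟶ (x ⟶[V] y)) (f : 𝟙_ V ⟶ (y ⟶[V] z)) : p ⟶ (x ⟶[V] z) :=
  (ρ_ p).inv ≫ (h ⨟ f)

/-- The composite of a morphism `f : x → y` with `h : p ⟶ X(y, z)`. -/
def pre {x y z : X} {p : V} (f : 𝟙_ V ⟶ (x ⟶[V] y)) (h : p ⟶ (y ⟶[V] z)) : p ⟶ (x ⟶[V] z) :=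
  (λ_ p).inv ≫ (f ⨟ h)

/-- The morphism `f : x → y` is invertible. -/
def IsInvertible {x y : X} (f : 𝟙_ V ⟶ (x ⟶[V] y)) : Prop :=
  ∃ g : 𝟙_ V ⟶ (y ⟶[V] x), pre f g = eId V x ∧ pre g f = eId V y

/-- The action of `T(-, z)` on a generalized element. -/
def whR (T : EnrichedFunctor V (X × Y) Z) {x x' : X} {p : V} (f : p ⟶ (x ⟶[V] x')) (y : Y) :
    p ⟶ (T.obj (x, y) ⟶[V] T.obj (x', y)) :=
  (ρ_ p).inv ≫ mapPair T f (eId V y)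

/-- The action of `T(x, -)` on a generalized element. -/
def whL (T : EnrichedFunctor V (X × Y) Z) (x : X) {y y' : Y} {p : V} (f : p ⟶ (y ⟶[V] y')) :
    p ⟶ (T.obj (x, y) ⟶[V] T.obj (x, y')) :=
  (λ_ p).inv ≫ mapPair T (eId V x) f

/-- Associativity and unit constraints making the `V`-category `X`, with tensor product
`T : X ⊗ X → X` and unit `e`, into a monoidal `V`-category. -/
structure MonoidalConstraints (T : EnrichedFunctor V (X × X) X) (e : X) where
  /-- associativity constraint -/
  assoc : ∀ x y z, 𝟙_ V ⟶ (T.obj (T.obj (x, y), z) ⟶[V] T.obj (x, T.obj (y, z)))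
  /-- left unit constraint -/
  lunit : ∀ x, 𝟙_ V ⟶ (T.obj (e, x) ⟶[V] x)
  /-- right unit constraint -/
  runit : ∀ x, 𝟙_ V ⟶ (T.obj (x, e) ⟶[V] x)
  assoc_inv : ∀ x y z, IsInvertible (assoc x y z)
  lunit_inv : ∀ x, IsInvertible (lunit x)
  runit_inv : ∀ x, IsInvertible (runit x)
  assoc_nat : ∀ x x' y y' z z',
    post (mapPair T (mapPair T (𝟙 (x ⟶[V] x')) (𝟙 (y ⟶[V] y'))) (𝟙 (z ⟶[V] z'))) (assoc x' y' z') =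
      (α_ _ _ _).hom ≫ pre (assoc x y z)
        (mapPair T (𝟙 (x ⟶[V] x')) (mapPair T (𝟙 (y ⟶[V] y')) (𝟙 (z ⟶[V] z'))))
  lunit_nat : ∀ x x', post (whL T e (𝟙 (x ⟶[V] x'))) (lunit x') = pre (lunit x) (𝟙 (x ⟶[V] x'))
  runit_nat : ∀ x x', post (whR T (𝟙 (x ⟶[V] x')) e) (runit x') = pre (runit x) (𝟙 (x ⟶[V] x'))
  pentagon : ∀ w x y z,
    pre (whR T (assoc w x y) z) (pre (assoc w (T.obj (x, y)) z) (whL T w (assoc x y z))) =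
      pre (assoc (T.obj (w, x)) y z) (assoc w x (T.obj (y, z)))
  triangle : ∀ x y, pre (assoc x e y) (whL T x (lunit y)) = whR T (runit x) y

/-- The structure of a monoidal (that is, lax monoidal) `V`-functor on `E : X → Y`. -/
structure LaxMonoidal {T : EnrichedFunctor V (X × X) X} {e : X} (mX : MonoidalConstraints T e)
    {S : EnrichedFunctor V (Y × Y) Y} {i : Y} (mY : MonoidalConstraints S i)
    (E : EnrichedFunctor V X Y) where
  /-- the multiplication constraint `E x ⊗ E y → E (x ⊗ y)` -/
  μ : ∀ x y, 𝟙_ V ⟶ (S.obj (E.obj x, E.obj y) ⟶[V] E.obj (T.obj (x, y)))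
  /-- the unit constraint `i → E e` -/
  ε : 𝟙_ V ⟶ (i ⟶[V] E.obj e)
  μ_nat : ∀ x x' y y', post (mapPair S (E.map x x') (E.map y y')) (μ x' y') =
    pre (μ x y) (mapPair T (𝟙 (x ⟶[V] x')) (𝟙 (y ⟶[V] y')) ≫ E.map _ _)
  μ_assoc : ∀ x y z,
    pre (whR S (μ x y) (E.obj z)) (pre (μ (T.obj (x, y)) z) (mX.assoc x y z ≫ E.map _ _)) =
      pre (mY.assoc (E.obj x) (E.obj y) (E.obj z))
        (pre (whL S (E.obj x) (μ y z)) (μ x (T.obj (y, z))))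
  μ_lunit : ∀ x, pre (whR S ε (E.obj x)) (pre (μ e x) (mX.lunit x ≫ E.map _ _)) =
    mY.lunit (E.obj x)
  μ_runit : ∀ x, pre (whL S (E.obj x) ε) (pre (μ x e) (mX.runit x ≫ E.map _ _)) =
    mY.runit (E.obj x)

/-- A monoidal `V`-functor is strong when its constraints are invertible. -/
def LaxMonoidal.IsStrong {T : EnrichedFunctor V (X × X) X} {e : X} {mX : MonoidalConstraints T e}
    {S : EnrichedFunctor V (Y × Y) Y} {i : Y} {mY : MonoidalConstraints S i}
    {E : EnrichedFunctor V X Y} (M : LaxMonoidal mX mY E) : Prop :=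
  (∀ x y, IsInvertible (M.μ x y)) ∧ IsInvertible M.ε

/-- The `V`-functor `S` preserves all existing small weighted colimits. -/
def PreservesColims (S : EnrichedFunctor V X Y) : Prop :=
  ∀ (C : Type u) [EnrichedCategory V C] (W : Psh V C) (F : EnrichedFunctor V C X) (c : X)
    (ι : ∀ a, W.obj a ⟶ (F.obj a ⟶[V] c)), IsColim W F c ι →
      IsColim W (F.comp V S) (S.obj c) (fun a => ι a ≫ S.map (F.obj a) c)

end Monoidal

section Day

open Limits

variable {A : Type u} [EnrichedCategory V A] {B : Type u} [EnrichedCategory V B]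
  {X : Type u₁} [EnrichedCategory V X]

/-- The `V`-functor from the unit `V`-category that picks the object `e`. -/
@[simps]
def pointFunctor (e : X) : EnrichedFunctor V PUnit.{u + 1} X where
  obj _ := e
  map _ _ := eId V e
  map_id _ := Category.id_comp _
  map_comp _ _ _ := (eId_tensor_eId e).symm

variable [MonoidalClosed V] [HasProducts.{u} V] [HasEqualizers V] [HasCoproducts.{u} V]
  [HasCoequalizers V]

/-- (A choice of) the colimits in `X` by which the Day convolution structure on `[A, X]` is
defined. -/
structure DayColimits (p : Promonoidal V A) (T : EnrichedFunctor V (X × X) X) (e : X) where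
  /-- `colim_{a₁, a₂} (P(a₁, a₂, a), F a₁ ⊗ G a₂)` -/
  tensor : ∀ (F : EnrichedFunctor V A X × EnrichedFunctor V A X) (a : A),
    Colim (p.P.psh a) ((extTensor A A T).obj F)
  /-- `colim (J a, e)` -/
  unit : ∀ a, Colim (p.J.psh a) (pointFunctor e)

variable {p : Promonoidal V A} {T : EnrichedFunctor V (X × X) X} {e : X}

/-- The Day convolution `(F ∗ G) a = colim_{a₁, a₂} (P(a₁, a₂, a), F a₁ ⊗ G a₂)`. -/
def dayTensor (d : DayColimits p T e) :
    EnrichedFunctor V (EnrichedFunctor V A X × EnrichedFunctor V A X) (EnrichedFunctor V A X) :=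
  lan p.P (extTensor A A T) d.tensor

/-- The unit `a ↦ colim (J a, e)` of Day convolution. -/
def dayUnit (d : DayColimits p T e) : EnrichedFunctor V A X :=
  lanObj p.J (pointFunctor e) d.unit

/-- The coprojection `P(a₁, a₂, a) ⟶ X(F a₁ ⊗ G a₂, (F ∗ G) a)`. -/
def dayη (d : DayColimits p T e) (F G : EnrichedFunctor V A X) (a₁ a₂ a : A) :
    p.P.obj (a₁, a₂) a ⟶ (T.obj (F.obj a₁, G.obj a₂) ⟶[V] ((dayTensor d).obj (F, G)).obj a) :=
  lanι p.P ((extTensor A A T).obj (F, G)) (d.tensor (F, G)) a (a₁, a₂)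

/-- The coprojection `J a ⟶ X(e, N a)` of the unit `N`. -/
def dayν (d : DayColimits p T e) (a : A) : p.Jo a ⟶ (e ⟶[V] (dayUnit d).obj a) :=
  lanι p.J (pointFunctor e) d.unit a PUnit.unit

/-- The Day convolution monoidal structure on `[A, X]`: the constraints of a monoidal `V`-category
with tensor product `dayTensor d` and unit `dayUnit d` that are induced by the constraints of the
promonoidal `A` and of the monoidal `X`. The last three fields express this on coprojections, and
determine the constraints uniquely. -/
structure DayConvolution (mX : MonoidalConstraints T e) (d : DayColimits p T e)
    extends MonoidalConstraints (dayTensor d) (dayUnit d) where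
  assoc_eq : ∀ (F G H : EnrichedFunctor V A X) (a₁ a₂ a₃ a : A),
    ∃ θ : rightComp p.P a₁ a₂ a₃ a ⟶ (T.obj (F.obj a₁, T.obj (G.obj a₂, H.obj a₃)) ⟶[V]
        ((dayTensor d).obj (F, (dayTensor d).obj (G, H))).obj a),
      (∀ w, rightι p.P a₁ a₂ a₃ a w ≫ θ =
        whL T (F.obj a₁) (dayη d G H a₂ a₃ w) ⨟ dayη d F ((dayTensor d).obj (G, H)) a₁ w a) ∧
      ∀ u, post (whR T (dayη d F G a₁ a₂ u) (H.obj a₃) ⨟ dayη d ((dayTensor d).obj (F, G)) H u a₃ a)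
          (assoc F G H ≫ proj _ _ a) =
        p.assocι a₁ a₂ a₃ a u ≫ pre (mX.assoc (F.obj a₁) (G.obj a₂) (H.obj a₃)) θ
  lunit_eq : ∀ (F : EnrichedFunctor V A X) (a₁ a j : A),
    post (whR T (dayν d j) (F.obj a₁) ⨟ dayη d (dayUnit d) F j a₁ a) (lunit F ≫ proj _ _ a) =
      p.lunitι a₁ a j ≫ pre (mX.lunit (F.obj a₁)) (F.map a₁ a)
  runit_eq : ∀ (F : EnrichedFunctor V A X) (a₁ a j : A),
    post (whL T (F.obj a₁) (dayν d j) ⨟ dayη d F (dayUnit d) a₁ j a) (runit F ≫ proj _ _ a) =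
      p.runitι a₁ a j ≫ pre (mX.runit (F.obj a₁)) (F.map a₁ a)

/-- The `V`-functor `∃_K : [A, X] → [B, X]`, `(∃_K F) b = colim_a (K(a, b), F a)`, given that these
colimits exist. -/
def existsK (K : VMod V B A) (hK : ∀ (F : EnrichedFunctor V A X) (b : B), Colim (K.psh b) F) :
    EnrichedFunctor V (EnrichedFunctor V A X) (EnrichedFunctor V B X) :=
  lan K (EnrichedFunctor.id V (EnrichedFunctor V A X)) hK

/-- The coprojection `K(a, b) ⟶ X(F a, (∃_K F) b)`. -/
def existsι (K : VMod V B A) (hK : ∀ (F : EnrichedFunctor V A X) (b : B), Colim (K.psh b) F)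
    (F : EnrichedFunctor V A X) (a : A) (b : B) :
    K.obj a b ⟶ (F.obj a ⟶[V] ((existsK K hK).obj F).obj b) :=
  lanι K F (hK F) b a

/-- The monoidal structure `M` on `∃_K` is the one induced by the constraints `φ` and `φ₀` of the
promonoidal module `K`. -/
structure IsInduced {pA : Promonoidal V A} {pB : Promonoidal V B} {mX : MonoidalConstraints T e}
    {dA : DayColimits pA T e} {dB : DayColimits pB T e} {mA : DayConvolution mX dA}
    {mB : DayConvolution mX dB} (k : PromonoidalModule pA pB)
    (hK : ∀ (F : EnrichedFunctor V A X) (b : B), Colim (k.K.psh b) F)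
    (M : LaxMonoidal mA.toMonoidalConstraints mB.toMonoidalConstraints (existsK k.K hK)) :
    Prop where
  μ_eq : ∀ (F G : EnrichedFunctor V A X) (a₁ a₂ : A) (b b₁ b₂ : B),
    ∃ θ : tgtComp pA.P k.K a₁ a₂ b ⟶ (T.obj (F.obj a₁, G.obj a₂) ⟶[V]
        ((existsK k.K hK).obj ((dayTensor dA).obj (F, G))).obj b),
      (∀ a, tgtι pA.P k.K a₁ a₂ b a ≫ θ =
        dayη dA F G a₁ a₂ a ⨟ existsι k.K hK ((dayTensor dA).obj (F, G)) a b) ∧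
      post (mapPair T (existsι k.K hK F a₁ b₁) (existsι k.K hK G a₂ b₂) ⨟
          dayη dB ((existsK k.K hK).obj F) ((existsK k.K hK).obj G) b₁ b₂ b)
          (M.μ F G ≫ proj _ _ b) =
        k.φι a₁ a₂ b b₁ b₂ ≫ θ
  ε_eq : ∀ b : B,
    ∃ θ : unitComp pA.J k.K b ⟶ (e ⟶[V] ((existsK k.K hK).obj (dayUnit dA)).obj b),
      (∀ a, unitι pA.J k.K b a ≫ θ = dayν dA a ⨟ existsι k.K hK (dayUnit dA) a b) ∧
      post (dayν dB b) (M.ε ≫ proj _ _ b) = k.φ₀ b ≫ θ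

end Day

end Enr

end

/-! The whole proof is one universal-property argument. A weighted colimit is controlled by its
coprojections, so morphisms out of it are built, and equations between them tested, on generalized
elements of hom-objects at arbitrary stages in V. The main tool is that an iterated weighted colimit
is a colimit weighted by a coend (`Presents.coend`): if Φ u = colim_i (L i u, Y i) and M d = colim_u
(N u d, Φ u), then M d = colim_i (∫^u L i u ⊗ N u d, Y i).

Since the tensor product of X preserves colimits in each variable, (F ∗ G) ∗ H and F ∗ (G ∗ H) are
colimits of (F a₁ ⊗ G a₂) ⊗ H a₃ and F a₁ ⊗ (G a₂ ⊗ H a₃), weighted by the two sides of the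
promonoidal associativity (`presents_dayLeft`, `presents_dayRight`). An isomorphism of weights
together with an isomorphism of diagrams induces an isomorphism of colimits
(`Presents.isInvertible`), and this is the associativity constraint. For the units, N ∗ F is the
colimit of e ⊗ F a₁ weighted by ∫^j J j ⊗ P(j, a₁, a) ≅ A(a₁, a), while F is the colimit of the F a₁
weighted by A(a₁, a) (`presents_coYoneda`). Naturality, pentagon and triangle are tested on the
jointly epimorphic coprojections, where they follow from the corresponding laws of X and of the
promonoidal A.

The same argument treats ∃_K. The objects (∃_K F ∗ ∃_K G) b and (∃_K (F ∗ G)) b are colimits of one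
and the same diagram F a₁ ⊗ G a₂, weighted by the source and by the target of φ; so φ induces μ,
which is invertible when φ is (`exists_μ`). In the same way φ₀ induces ε (`exists_ε`). On
coprojections the axioms of a monoidal functor become the axioms of a promonoidal module
(`IsInducedMul.assoc`, `IsInducedMul.lunit`, `IsInducedMul.runit`).

Two devices keep this manageable. Colimits are indexed by graphs with edges labelled in V, and
naturality is required only along edges; on a product of graphs this is naturality in each variable
separately, so the coend weights never have to be shown functorial in several variables jointly.
Commuting squares of generalized elements (`Sq`) carry the symmetry that exchanges their stages, and
pasting such squares replaces most computations with braidings. -/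

set_option linter.unusedSectionVars false

noncomputable section

namespace Enr

variable {V : Type v} [Category.{w} V] [MonoidalCategory V] [SymmetricCategory V]

/-! ### Calculus of generalized elements and of commuting squares. -/

section Underlying

variable {X : Type u₁} [EnrichedCategory V X] {Y : Type u₂} [EnrichedCategory V Y]

theorem ecmp_assoc' {x y z t : X} {p q r : V} (f : p ⟶ (x ⟶[V] y)) (g : q ⟶ (y ⟶[V] z))
    (h : r ⟶ (z ⟶[V] t)) : f ⨟ (g ⨟ h) = (α_ p q r).inv ≫ ((f ⨟ g) ⨟ h) := by
  rw [ecmp_assoc, Iso.inv_hom_id_assoc]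

theorem comp_ecmp_comp {x y z : X} {p p' q' q : V} (k : p' ⟶ p) (l : q' ⟶ q)
    (f : p ⟶ (x ⟶[V] y)) (g : q ⟶ (y ⟶[V] z)) : (k ≫ f) ⨟ (l ≫ g) = (k ⊗ₘ l) ≫ (f ⨟ g) := by
  rw [comp_ecmp, ecmp_comp, MonoidalCategory.tensorHom_def, Category.assoc]

theorem comp_pre {x y z : X} {p q : V} (k : q ⟶ p) (f : 𝟙_ V ⟶ (x ⟶[V] y))
    (h : p ⟶ (y ⟶[V] z)) : pre f (k ≫ h) = k ≫ pre f h := by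
  rw [pre, pre, ecmp_comp, leftUnitor_inv_naturality_assoc]

theorem comp_post {x y z : X} {p q : V} (k : q ⟶ p) (h : p ⟶ (x ⟶[V] y))
    (f : 𝟙_ V ⟶ (y ⟶[V] z)) : post (k ≫ h) f = k ≫ post h f := by
  rw [post, post, comp_ecmp, rightUnitor_inv_naturality_assoc]

theorem ecmp_eq_pre {x y z : X} {p : V} (f : 𝟙_ V ⟶ (x ⟶[V] y)) (h : p ⟶ (y ⟶[V] z)) :
    f ⨟ h = (λ_ p).hom ≫ pre f h := by rw [pre, Iso.hom_inv_id_assoc]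

theorem ecmp_eq_post {x y z : X} {p : V} (h : p ⟶ (x ⟶[V] y)) (f : 𝟙_ V ⟶ (y ⟶[V] z)) :
    h ⨟ f = (ρ_ p).hom ≫ post h f := by rw [post, Iso.hom_inv_id_assoc]

theorem pre_ecmp {x y z t : X} {p q : V} (f : 𝟙_ V ⟶ (x ⟶[V] y)) (h : p ⟶ (y ⟶[V] z))
    (k : q ⟶ (z ⟶[V] t)) : pre f h ⨟ k = pre f (h ⨟ k) := by
  rw [pre, pre, comp_ecmp, ecmp_assoc]; simp

theorem ecmp_post {x y z t : X} {p q : V} (h : p ⟶ (x ⟶[V] y)) (k : q ⟶ (y ⟶[V] z))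
    (f : 𝟙_ V ⟶ (z ⟶[V] t)) : h ⨟ post k f = post (h ⨟ k) f := by
  rw [post, post, ecmp_comp, ecmp_assoc']; simp

/-- A morphism standing between two generalized elements may be absorbed on either side. Naturality
of a constraint is transported across a composite in this way. -/
theorem post_ecmp {x y z t : X} {p q : V} (h : p ⟶ (x ⟶[V] y)) (f : 𝟙_ V ⟶ (y ⟶[V] z))
    (k : q ⟶ (z ⟶[V] t)) : post h f ⨟ k = h ⨟ pre f k := by
  rw [pre, post, comp_ecmp, ecmp_comp, ecmp_assoc]; simp

theorem pre_eq_post {x y z : X} (f : 𝟙_ V ⟶ (x ⟶[V] y)) (g : 𝟙_ V ⟶ (y ⟶[V] z)) :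
    pre f g = post f g := by rw [pre, post, unitors_inv_equal]

theorem pre_post {x y z t : X} {p : V} (f : 𝟙_ V ⟶ (x ⟶[V] y)) (h : p ⟶ (y ⟶[V] z))
    (g : 𝟙_ V ⟶ (z ⟶[V] t)) : pre f (post h g) = post (pre f h) g := by
  rw [pre, ecmp_post, ← comp_post]; rfl

theorem pre_pre {x y z t : X} {p : V} (f : 𝟙_ V ⟶ (x ⟶[V] y)) (g : 𝟙_ V ⟶ (y ⟶[V] z))
    (h : p ⟶ (z ⟶[V] t)) : pre f (pre g h) = pre (pre f g) h := by
  rw [pre_eq_post f g, pre, ← post_ecmp]; rfl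

theorem post_post {x y z t : X} {p : V} (h : p ⟶ (x ⟶[V] y)) (f : 𝟙_ V ⟶ (y ⟶[V] z))
    (g : 𝟙_ V ⟶ (z ⟶[V] t)) : post (post h f) g = post h (pre f g) := by
  rw [post, post_ecmp]; rfl

theorem pre_eId {x y : X} {p : V} (h : p ⟶ (x ⟶[V] y)) : pre (eId V x) h = h := by
  rw [pre, eId_ecmp, Iso.inv_hom_id_assoc]

theorem post_eId {x y : X} {p : V} (h : p ⟶ (x ⟶[V] y)) : post h (eId V y) = h := by
  rw [post, ecmp_eId, Iso.inv_hom_id_assoc]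

theorem pre_map (F : EnrichedFunctor V X Y) {x y z : X} {p : V} (f : 𝟙_ V ⟶ (x ⟶[V] y))
    (h : p ⟶ (y ⟶[V] z)) : pre f h ≫ F.map x z = pre (f ≫ F.map x y) (h ≫ F.map y z) := by
  rw [pre, pre, Category.assoc, ecmp_map]

theorem post_map (F : EnrichedFunctor V X Y) {x y z : X} {p : V} (h : p ⟶ (x ⟶[V] y))
    (f : 𝟙_ V ⟶ (y ⟶[V] z)) : post h f ≫ F.map x z = post (h ≫ F.map x y) (f ≫ F.map y z) := by
  rw [post, post, Category.assoc, ecmp_map]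

theorem pre_inj {x y z : X} {f : 𝟙_ V ⟶ (x ⟶[V] y)} (hf : IsInvertible f) {p : V}
    {h k : p ⟶ (y ⟶[V] z)} (e : pre f h = pre f k) : h = k := by
  obtain ⟨g, _, hg⟩ := hf
  rw [← pre_eId h, ← hg, ← pre_pre, e, pre_pre, hg, pre_eId]

theorem isInvertible_eId (x : X) : IsInvertible (eId V x) :=
  ⟨eId V x, pre_eId _, pre_eId _⟩

/-- A square of generalized elements commutes. -/
def Sq {x y x' y' : X} {p q : V} (h : p ⟶ (x ⟶[V] y)) (f : q ⟶ (y ⟶[V] y'))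
    (g : q ⟶ (x ⟶[V] x')) (h' : p ⟶ (x' ⟶[V] y')) : Prop :=
  h ⨟ f = (β_ p q).hom ≫ (g ⨟ h')

theorem Sq.symm {x y x' y' : X} {p q : V} {h : p ⟶ (x ⟶[V] y)} {f : q ⟶ (y ⟶[V] y')}
    {g : q ⟶ (x ⟶[V] x')} {h' : p ⟶ (x' ⟶[V] y')} (s : Sq h f g h') : Sq g h' h f := by
  rw [Sq, show h ⨟ f = _ from s, SymmetricCategory.symmetry_assoc]

/-- Squares paste along a common side of stage `q` because the braiding of `p ⊗ r` past `q` is, by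
the hexagon, the composite of the two separate braidings. -/
theorem Sq.vcomp {x y z x' y' z' : X} {p q r : V} {h : p ⟶ (x ⟶[V] y)} {f : q ⟶ (y ⟶[V] y')}
    {g : q ⟶ (x ⟶[V] x')} {h' : p ⟶ (x' ⟶[V] y')} {k : r ⟶ (y ⟶[V] z)} {l : q ⟶ (z ⟶[V] z')}
    {k' : r ⟶ (y' ⟶[V] z')} (s : Sq h f g h') (s' : Sq k l f k') : Sq (h ⨟ k) l g (h' ⨟ k') := by
  rw [Sq, ecmp_assoc, show k ⨟ l = _ from s', ecmp_comp, ecmp_assoc', show h ⨟ f = _ from s,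
    comp_ecmp, ecmp_assoc, braiding_tensor_left_hom]
  simp only [Category.assoc]

/-- Transposition of squares, available because the braiding is a symmetry, turns this pasting into
the vertical one. -/
theorem Sq.hcomp {x y x' y' x'' y'' : X} {p q r : V} {h : p ⟶ (x ⟶[V] y)} {f : q ⟶ (y ⟶[V] y')}
    {g : q ⟶ (x ⟶[V] x')} {h' : p ⟶ (x' ⟶[V] y')} {f' : r ⟶ (y' ⟶[V] y'')}
    {g' : r ⟶ (x' ⟶[V] x'')} {h'' : p ⟶ (x'' ⟶[V] y'')} (s : Sq h f g h') (s' : Sq h' f' g' h'') :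
    Sq h (f ⨟ f') (g ⨟ g') h'' :=
  (s.symm.vcomp s'.symm).symm

theorem Sq.comp_left {x y x' y' : X} {p p' q : V} {h : p ⟶ (x ⟶[V] y)} {f : q ⟶ (y ⟶[V] y')}
    {g : q ⟶ (x ⟶[V] x')} {h' : p ⟶ (x' ⟶[V] y')} (k : p' ⟶ p) (s : Sq h f g h') :
    Sq (k ≫ h) f g (k ≫ h') := by
  rw [Sq, comp_ecmp, ecmp_comp, show h ⨟ f = _ from s, braiding_naturality_left_assoc]

theorem Sq.comp_right {x y x' y' : X} {p q' q : V} {h : p ⟶ (x ⟶[V] y)} {f : q ⟶ (y ⟶[V] y')}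
    {g : q ⟶ (x ⟶[V] x')} {h' : p ⟶ (x' ⟶[V] y')} (k : q' ⟶ q) (s : Sq h f g h') :
    Sq h (k ≫ f) (k ≫ g) h' := (s.symm.comp_left k).symm

theorem Sq.map {x y x' y' : X} {p q : V} {h : p ⟶ (x ⟶[V] y)} {f : q ⟶ (y ⟶[V] y')}
    {g : q ⟶ (x ⟶[V] x')} {h' : p ⟶ (x' ⟶[V] y')} (s : Sq h f g h') (F : EnrichedFunctor V X Y) :
    Sq (h ≫ F.map _ _) (f ≫ F.map _ _) (g ≫ F.map _ _) (h' ≫ F.map _ _) := by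
  rw [Sq, ← ecmp_map, ← ecmp_map, show h ⨟ f = _ from s, Category.assoc]

/-- Braiding with the unit object is a composite of unitors, so with two opposite sides of stage `I`
a square is an ordinary naturality equation. -/
theorem sq_unit_iff {x y x' y' : X} {p : V} {h : p ⟶ (x ⟶[V] y)} {f : 𝟙_ V ⟶ (y ⟶[V] y')}
    {g : 𝟙_ V ⟶ (x ⟶[V] x')} {h' : p ⟶ (x' ⟶[V] y')} : Sq h f g h' ↔ post h f = pre g h' := by
  rw [Sq, ecmp_eq_post, ecmp_eq_pre, ← braiding_leftUnitor, Category.assoc, cancel_epi, cancel_epi]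

theorem sq_unit_left_iff {x y x' y' : X} {q : V} {h : 𝟙_ V ⟶ (x ⟶[V] y)} {f : q ⟶ (y ⟶[V] y')}
    {g : q ⟶ (x ⟶[V] x')} {h' : 𝟙_ V ⟶ (x' ⟶[V] y')} : Sq h f g h' ↔ post g h' = pre h f :=
  ⟨fun s => sq_unit_iff.1 s.symm, fun e => (sq_unit_iff.2 e).symm⟩

end Underlying

/-! ### Partial actions of a functor of two variables. -/

section TwoVariables

variable {X : Type u₁} [EnrichedCategory V X] {Y : Type u₂} [EnrichedCategory V Y]
  {Z : Type u₃} [EnrichedCategory V Z] (T : EnrichedFunctor V (X × Y) Z)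

/-- Whiskering is the action of the partial functor `T(-, y)`; its compatibility with composition,
`pre` and `post` is then just functoriality. -/
theorem whR_eq_map {x x' : X} {p : V} (f : p ⟶ (x ⟶[V] x')) (y : Y) :
    whR T f y = f ≫ ((secL y).comp V T).map x x' := by
  have h : mapPair T f (eId V y) = (f ▷ _ ≫ _ ◁ eId V y) ≫ T.map (x, y) (x', y) := by
    rw [mapPair, MonoidalCategory.tensorHom_def]
  rw [whR, h]
  simp only [EnrichedFunctor.comp_map, secL_map, Category.assoc]
  rw [← rightUnitor_inv_naturality_assoc]
  exact congrArg (f ≫ ·) (Category.assoc _ _ _).symm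

theorem whL_eq_map (x : X) {y y' : Y} {p : V} (f : p ⟶ (y ⟶[V] y')) :
    whL T x f = f ≫ ((secR x).comp V T).map y y' := by
  have h : mapPair T (eId V x) f = (_ ◁ f ≫ eId V x ▷ _) ≫ T.map (x, y) (x, y') := by
    rw [mapPair, tensorHom_def']
  rw [whL, h]
  simp only [EnrichedFunctor.comp_map, secR_map, Category.assoc]
  rw [← leftUnitor_inv_naturality_assoc]
  exact congrArg (f ≫ ·) (Category.assoc _ _ _).symm

variable {T}

theorem whR_ecmp {x x' x'' : X} {p q : V} (f : p ⟶ (x ⟶[V] x')) (g : q ⟶ (x' ⟶[V] x''))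
    (y : Y) : whR T (f ⨟ g) y = whR T f y ⨟ whR T g y := by
  simp only [whR_eq_map]; exact ecmp_map _ f g

theorem whL_ecmp (x : X) {y y' y'' : Y} {p q : V} (f : p ⟶ (y ⟶[V] y')) (g : q ⟶ (y' ⟶[V] y'')) :
    whL T x (f ⨟ g) = whL T x f ⨟ whL T x g := by
  simp only [whL_eq_map]; exact ecmp_map _ f g

theorem comp_whR {x x' : X} {p q : V} (k : q ⟶ p) (f : p ⟶ (x ⟶[V] x')) (y : Y) :
    whR T (k ≫ f) y = k ≫ whR T f y := by
  simp only [whR_eq_map]; exact Category.assoc _ _ _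

theorem comp_whL (x : X) {y y' : Y} {p q : V} (k : q ⟶ p) (f : p ⟶ (y ⟶[V] y')) :
    whL T x (k ≫ f) = k ≫ whL T x f := by
  simp only [whL_eq_map]; exact Category.assoc _ _ _

theorem whR_eId (x : X) (y : Y) : whR T (eId V x) y = eId V (T.obj (x, y)) := by
  rw [whR_eq_map, EnrichedFunctor.map_id]; rfl

theorem whL_eId (x : X) (y : Y) : whL T x (eId V y) = eId V (T.obj (x, y)) := by
  rw [whL_eq_map, EnrichedFunctor.map_id]; rfl

theorem whR_pre {x x' x'' : X} {p : V} (f : 𝟙_ V ⟶ (x ⟶[V] x')) (h : p ⟶ (x' ⟶[V] x''))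
    (y : Y) : whR T (pre f h) y = pre (whR T f y) (whR T h y) := by
  simp only [whR_eq_map]; exact pre_map _ f h

theorem whR_post {x x' x'' : X} {p : V} (h : p ⟶ (x ⟶[V] x')) (f : 𝟙_ V ⟶ (x' ⟶[V] x''))
    (y : Y) : whR T (post h f) y = post (whR T h y) (whR T f y) := by
  simp only [whR_eq_map]; exact post_map _ h f

theorem whL_pre (x : X) {y y' y'' : Y} {p : V} (f : 𝟙_ V ⟶ (y ⟶[V] y')) (h : p ⟶ (y' ⟶[V] y'')) :
    whL T x (pre f h) = pre (whL T x f) (whL T x h) := by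
  simp only [whL_eq_map]; exact pre_map _ f h

theorem whL_post (x : X) {y y' y'' : Y} {p : V} (h : p ⟶ (y ⟶[V] y')) (f : 𝟙_ V ⟶ (y' ⟶[V] y'')) :
    whL T x (post h f) = post (whL T x h) (whL T x f) := by
  simp only [whL_eq_map]; exact post_map _ h f

theorem Sq.whR {x y x' y' : X} {p q : V} {h : p ⟶ (x ⟶[V] y)} {f : q ⟶ (y ⟶[V] y')}
    {g : q ⟶ (x ⟶[V] x')} {h' : p ⟶ (x' ⟶[V] y')} (s : Sq h f g h') (t : Y) :
    Sq (Enr.whR T h t) (Enr.whR T f t) (Enr.whR T g t) (Enr.whR T h' t) := by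
  simp only [whR_eq_map]; exact s.map _

theorem Sq.whL {x y x' y' : Y} {p q : V} {h : p ⟶ (x ⟶[V] y)} {f : q ⟶ (y ⟶[V] y')}
    {g : q ⟶ (x ⟶[V] x')} {h' : p ⟶ (x' ⟶[V] y')} (s : Sq h f g h') (t : X) :
    Sq (Enr.whL T t h) (Enr.whL T t f) (Enr.whL T t g) (Enr.whL T t h') := by
  simp only [whL_eq_map]; exact s.map _

/-- Composition in a product uses the middle interchange `tensorμ`. Here the two inner stages are
units, so the interchange is trivial. -/
theorem whR_ecmp_whL {x x' : X} {y y' : Y} {p q : V} (f : p ⟶ (x ⟶[V] x'))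
    (g : q ⟶ (y ⟶[V] y')) : whR T f y ⨟ whL T x' g = mapPair T f g := by
  have h : ((ρ_ p).inv ⊗ₘ (λ_ q).inv) ≫ tensorμ p (𝟙_ V) (𝟙_ V) q ≫
      ((ρ_ p).hom ⊗ₘ (λ_ q).hom) = 𝟙 _ := by
    rw [tensorμ, braiding_tensorUnit_left]
    monoidal
  rw [whR, whL, comp_ecmp_comp, mapPair_ecmp, ecmp_eId, eId_ecmp, mapPair_comp, reassoc_of% h]

/-- In this order the interchange really exchanges the stages `q` and `p`, and the braiding remains.
-/
theorem whL_ecmp_whR {x x' : X} {y y' : Y} {p q : V} (f : p ⟶ (x ⟶[V] x'))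
    (g : q ⟶ (y ⟶[V] y')) : whL T x g ⨟ whR T f y' = (β_ q p).hom ≫ mapPair T f g := by
  have h : ((λ_ q).inv ⊗ₘ (ρ_ p).inv) ≫ tensorμ (𝟙_ V) q p (𝟙_ V) ≫
      ((λ_ p).hom ⊗ₘ (ρ_ q).hom) = (β_ q p).hom := by
    simp [tensorμ, MonoidalCategory.tensorHom_def]
    monoidal
  rw [whR, whL, comp_ecmp_comp, mapPair_ecmp, ecmp_eId, eId_ecmp, mapPair_comp, reassoc_of% h]

theorem sq_whR_whL {x x' : X} {y y' : Y} {p q : V} (f : p ⟶ (x ⟶[V] x')) (g : q ⟶ (y ⟶[V] y')) :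
    Sq (whR T f y) (whL T x' g) (whL T x g) (whR T f y') := by
  rw [Sq, whR_ecmp_whL, whL_ecmp_whR, SymmetricCategory.symmetry_assoc]

end TwoVariables

/-! ### Naturality of the constraints of a monoidal V-category at generalized elements. -/

section Constraints

variable {X : Type u₁} [EnrichedCategory V X] {T : EnrichedFunctor V (X × X) X} {e : X}
  (m : MonoidalConstraints T e)

theorem mapPair_comp_left {x x' y y' : X} {p p' q : V} (k : p' ⟶ p) (f : p ⟶ (x ⟶[V] x'))
    (g : q ⟶ (y ⟶[V] y')) : mapPair T (k ≫ f) g = k ▷ q ≫ mapPair T f g := by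
  rw [← tensorHom_id, ← mapPair_comp, Category.id_comp]

theorem mapPair_comp_right {x x' y y' : X} {p q' q : V} (k : q' ⟶ q) (f : p ⟶ (x ⟶[V] x'))
    (g : q ⟶ (y ⟶[V] y')) : mapPair T f (k ≫ g) = p ◁ k ≫ mapPair T f g := by
  rw [← id_tensorHom, ← mapPair_comp, Category.id_comp]

theorem mapPair_eId_right {x x' : X} {p : V} (f : p ⟶ (x ⟶[V] x')) (y : X) :
    mapPair T f (eId V y) = (ρ_ p).hom ≫ whR T f y := by rw [whR, Iso.hom_inv_id_assoc]

theorem mapPair_eId_left {y y' : X} {p : V} (x : X) (f : p ⟶ (y ⟶[V] y')) :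
    mapPair T (eId V x) f = (λ_ p).hom ≫ whL T x f := by rw [whL, Iso.hom_inv_id_assoc]

/-- The axiom at the identities of the hom-objects is the universal case; precomposing with `(f ⊗ g)
⊗ h` gives all others. -/
theorem MonoidalConstraints.assoc_nat' {x x' y y' z z' : X} {p q r : V} (f : p ⟶ (x ⟶[V] x'))
    (g : q ⟶ (y ⟶[V] y')) (h : r ⟶ (z ⟶[V] z')) :
    post (mapPair T (mapPair T f g) h) (m.assoc x' y' z') =
      (α_ _ _ _).hom ≫ pre (m.assoc x y z) (mapPair T f (mapPair T g h)) := by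
  have := congrArg (fun k => ((f ⊗ₘ g) ⊗ₘ h) ≫ k) (m.assoc_nat x x' y y' z z')
  simp only [← comp_post, associator_naturality_assoc] at this
  simpa only [← comp_pre, ← mapPair_comp, Category.comp_id] using this

/-- Identities are put in two of the three variables and the resulting unitors cancelled. The
variants in the middle and right variables arise likewise. -/
theorem MonoidalConstraints.assoc_nat_left {x x' : X} {p : V} (f : p ⟶ (x ⟶[V] x')) (y z : X) :
    post (whR T (whR T f y) z) (m.assoc x' y z) =
      pre (m.assoc x y z) (whR T f (T.obj (y, z))) := by
  have := m.assoc_nat' f (eId V y) (eId V z)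
  simp only [mapPair_eId_right, whR_eId, mapPair_comp_right, comp_whR, comp_post,
    comp_pre] at this
  have h : (α_ p (𝟙_ V) (𝟙_ V)).hom ≫ p ◁ (ρ_ (𝟙_ V)).hom ≫ (ρ_ p).hom =
      (ρ_ (p ⊗ 𝟙_ V)).hom ≫ (ρ_ p).hom := by monoidal
  rwa [reassoc_of% h, cancel_epi, cancel_epi] at this

theorem MonoidalConstraints.assoc_nat_middle {y y' : X} {p : V} (x : X) (f : p ⟶ (y ⟶[V] y'))
    (z : X) :
    post (whR T (whL T x f) z) (m.assoc x y' z) =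
      pre (m.assoc x y z) (whL T x (whR T f z)) := by
  have := m.assoc_nat' (eId V x) f (eId V z)
  simp only [mapPair_eId_right, mapPair_eId_left, comp_whR, comp_whL, comp_post,
    comp_pre] at this
  have h : (α_ (𝟙_ V) p (𝟙_ V)).hom ≫ (λ_ (p ⊗ 𝟙_ V)).hom ≫ (ρ_ p).hom =
      (ρ_ (𝟙_ V ⊗ p)).hom ≫ (λ_ p).hom := by monoidal
  rwa [reassoc_of% h, cancel_epi, cancel_epi] at this

theorem MonoidalConstraints.assoc_nat_right {z z' : X} {p : V} (x y : X) (f : p ⟶ (z ⟶[V] z')) :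
    post (whL T (T.obj (x, y)) f) (m.assoc x y z') =
      pre (m.assoc x y z) (whL T x (whL T y f)) := by
  have := m.assoc_nat' (eId V x) (eId V y) f
  simp only [mapPair_eId_left, whL_eId, mapPair_comp_left, comp_whL, comp_post,
    comp_pre] at this
  have h : (α_ (𝟙_ V) (𝟙_ V) p).hom ≫ (λ_ (𝟙_ V ⊗ p)).hom ≫ (λ_ p).hom =
      (λ_ (𝟙_ V)).hom ▷ p ≫ (λ_ p).hom := by monoidal
  rwa [reassoc_of% h, cancel_epi, cancel_epi] at this

theorem MonoidalConstraints.lunit_nat' {x x' : X} {p : V} (f : p ⟶ (x ⟶[V] x')) :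
    post (whL T e f) (m.lunit x') = pre (m.lunit x) f := by
  rw [← Category.comp_id f, comp_whL, comp_post, comp_pre, m.lunit_nat]

theorem MonoidalConstraints.runit_nat' {x x' : X} {p : V} (f : p ⟶ (x ⟶[V] x')) :
    post (whR T f e) (m.runit x') = pre (m.runit x) f := by
  rw [← Category.comp_id f, comp_whR, comp_post, comp_pre, m.runit_nat]

end Constraints

/-! ### Weighted colimits of diagrams on labelled graphs. -/

section Presentations

/-- A graph whose edges are labelled by objects of `V`. -/
structure Shape (V : Type v) where
  /-- the vertices -/
  I : Type u
  /-- the edges -/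
  E : Type u
  /-- the source of an edge -/
  s : E → I
  /-- the target of an edge -/
  t : E → I
  /-- the label of an edge -/
  h : E → V

/-- The graph underlying a `V`-category. -/
@[reducible]
def Shape.ofCat (V : Type v) [Category.{w} V] [MonoidalCategory V] (A : Type u)
    [EnrichedCategory V A] : Shape.{u} V where
  I := A
  E := A × A
  s p := p.1
  t p := p.2
  h p := p.1 ⟶[V] p.2

/-- The graph with one vertex and no edges. -/
@[reducible]
def Shape.point (V : Type v) : Shape.{u} V where
  I := PUnit
  E := PEmpty
  s := PEmpty.elim
  t := PEmpty.elim
  h := PEmpty.elim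

/-- The cartesian product of graphs. -/
@[reducible]
def Shape.prod (S S' : Shape.{u} V) : Shape.{u} V where
  I := S.I × S'.I
  E := (S.E × S'.I) ⊕ (S.I × S'.E)
  s := Sum.elim (fun p => (S.s p.1, p.2)) (fun p => (p.1, S'.s p.2))
  t := Sum.elim (fun p => (S.t p.1, p.2)) (fun p => (p.1, S'.t p.2))
  h := Sum.elim (fun p => S.h p.1) (fun p => S'.h p.2)

/-- A family of weights on a graph, contravariant along the edges and covariant in a parameter
`c : C`. No functoriality is required. -/
structure WtFam (S : Shape.{u} V) (C : Type u₂) [EnrichedCategory V C] where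
  /-- the values -/
  obj : S.I → C → V
  /-- the action of the edges -/
  act : ∀ e c, S.h e ⊗ obj (S.t e) c ⟶ obj (S.s e) c
  /-- the action of the parameter category -/
  ract : ∀ i c c', obj i c ⊗ (c ⟶[V] c') ⟶ obj i c'

/-- A diagram in `X` on a graph. -/
structure Diag (S : Shape.{u} V) (X : Type u₁) [EnrichedCategory V X] where
  /-- the values -/
  obj : S.I → X
  /-- the action of the edges -/
  map : ∀ e, S.h e ⟶ (obj (S.s e) ⟶[V] obj (S.t e))

variable {S S' S'' : Shape.{u} V} {C : Type u₂} [EnrichedCategory V C] {X : Type u₁}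
  [EnrichedCategory V X]

/-- The coprojections `q i c : W i c ⟶ X(Y i, L c)` exhibit each `L c` as the colimit of the diagram
`Y` weighted by `W - c`, functorially in `c`. -/
structure Presents (W : WtFam S C) (Y : Diag S X) (L : EnrichedFunctor V C X)
    (q : ∀ i c, W.obj i c ⟶ (Y.obj i ⟶[V] L.obj c)) : Prop where
  nat : ∀ e c, W.act e c ≫ q (S.s e) c = Y.map e ⨟ q (S.t e) c
  existsUnique : ∀ (c : C) (v : V) (x : X) (t : ∀ i, W.obj i c ⊗ v ⟶ (Y.obj i ⟶[V] x)),
    (∀ e, W.act e c ▷ v ≫ t (S.s e) = (α_ _ _ _).hom ≫ (Y.map e ⨟ t (S.t e))) →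
      ∃! f : v ⟶ (L.obj c ⟶[V] x), ∀ i, q i c ⨟ f = t i
  ract : ∀ i c c', q i c ⨟ L.map c c' = W.ract i c c' ≫ q i c'

variable {W W' : WtFam S C} {Y Y' : Diag S X} {L L' : EnrichedFunctor V C X}
  {q : ∀ i c, W.obj i c ⟶ (Y.obj i ⟶[V] L.obj c)}
  {q' : ∀ i c, W'.obj i c ⟶ (Y'.obj i ⟶[V] L'.obj c)}

/-- The composites of the coprojections with `g` form a cocone, and `f` and `g` both solve its
factorization problem. -/
theorem Presents.ext (H : Presents W Y L q) {c : C} {v : V} {x : X} {f g : v ⟶ (L.obj c ⟶[V] x)}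
    (e : ∀ i, q i c ⨟ f = q i c ⨟ g) : f = g := by
  obtain ⟨k, _, hk⟩ := H.existsUnique c v x (fun i => q i c ⨟ g) (by
    intro e
    rw [← comp_ecmp, H.nat, ecmp_assoc])
  rw [hk f e, hk g (fun _ => rfl)]

theorem Presents.ext_unit (H : Presents W Y L q) {c : C} {x : X} {f g : 𝟙_ V ⟶ (L.obj c ⟶[V] x)}
    (e : ∀ i, post (q i c) f = post (q i c) g) : f = g :=
  H.ext fun i => by rw [ecmp_eq_post, ecmp_eq_post, e]

theorem Presents.exists_unit (H : Presents W Y L q) {c : C} {x : X}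
    (t : ∀ i, W.obj i c ⟶ (Y.obj i ⟶[V] x))
    (ht : ∀ e, W.act e c ≫ t (S.s e) = Y.map e ⨟ t (S.t e)) :
    ∃ f : 𝟙_ V ⟶ (L.obj c ⟶[V] x), ∀ i, post (q i c) f = t i := by
  obtain ⟨f, hf, _⟩ := H.existsUnique c (𝟙_ V) x (fun i => (ρ_ _).hom ≫ t i) (by
    intro e
    rw [ecmp_comp, ← ht e, rightUnitor_naturality_assoc, rightUnitor_tensor_hom_assoc])
  refine ⟨f, fun i => ?_⟩
  rw [post, hf, Iso.inv_hom_id_assoc]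

/-! ### Natural transformations induced by morphisms of weights and diagrams. -/

section Induced

variable {A : Type u} [EnrichedCategory V A] {L L' L'' : EnrichedFunctor V A X}
  {W W' : WtFam S A}
  {q : ∀ i c, W.obj i c ⟶ (Y.obj i ⟶[V] L.obj c)}
  {q' : ∀ i c, W'.obj i c ⟶ (Y'.obj i ⟶[V] L'.obj c)}
  [MonoidalClosed V] [Limits.HasProducts.{u} V] [Limits.HasEqualizers V]

theorem pre_proj {p : V} (f : 𝟙_ V ⟶ (L ⟶[V] L')) (g : p ⟶ (L' ⟶[V] L'')) (c : A) :
    pre f g ≫ proj L L'' c = pre (f ≫ proj L L' c) (g ≫ proj L' L'' c) := by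
  rw [pre, pre, Category.assoc, ecmp_proj]

theorem post_proj {p : V} (f : p ⟶ (L ⟶[V] L')) (g : 𝟙_ V ⟶ (L' ⟶[V] L'')) (c : A) :
    post f g ≫ proj L L'' c = post (f ≫ proj L L' c) (g ≫ proj L' L'' c) := by
  rw [post, post, Category.assoc, ecmp_proj]

theorem sq_proj {p : V} (f : p ⟶ (L ⟶[V] L')) (c c' : A) :
    Sq (f ≫ proj L L' c) (L'.map c c') (L.map c c') (f ≫ proj L L' c') :=
  isVNat_proj f c c'

/-- At each `c` the cocone `t` induces a morphism. The compatibility `hr` with the parameter actions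
is what makes these morphisms natural in `c`, as one sees on coprojections. -/
theorem Presents.exists_hom (H : Presents W Y L q)
    (t : ∀ i c, W.obj i c ⟶ (Y.obj i ⟶[V] L'.obj c))
    (ht : ∀ e c, W.act e c ≫ t (S.s e) c = Y.map e ⨟ t (S.t e) c)
    (hr : ∀ i c c', t i c ⨟ L'.map c c' = W.ract i c c' ≫ t i c') :
    ∃ f : 𝟙_ V ⟶ (L ⟶[V] L'), ∀ i c, post (q i c) (f ≫ proj L L' c) = t i c := by
  choose f hf using fun c => H.exists_unit (c := c) (fun i => t i c) (fun e => ht e c)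
  have hn : IsVNat L L' (𝟙_ V) f := by
    intro c c'
    refine (sq_unit_left_iff (h := f c) (f := L'.map c c') (g := L.map c c') (h' := f c')).2 ?_
    apply H.ext
    intro i
    rw [ecmp_post, H.ract, comp_post, hf, ← post_ecmp, hf, hr]
  refine ⟨lift f hn, fun i c => ?_⟩
  rw [lift_proj, hf]

theorem Presents.hom_ext (H : Presents W Y L q) {f g : 𝟙_ V ⟶ (L ⟶[V] L')}
    (e : ∀ i c, post (q i c) (f ≫ proj L L' c) = post (q i c) (g ≫ proj L L' c)) : f = g :=
  Enr.hom_ext fun c => H.ext_unit fun i => e i c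

theorem Presents.isInvertible (H : Presents W Y L q) (H' : Presents W' Y' L' q')
    (φ : ∀ i c, W.obj i c ⟶ W'.obj i c) [∀ i c, IsIso (φ i c)]
    (y : ∀ i, 𝟙_ V ⟶ (Y.obj i ⟶[V] Y'.obj i)) (hy : ∀ i, IsInvertible (y i))
    (hact : ∀ e c, W.act e c ≫ φ (S.s e) c = S.h e ◁ φ (S.t e) c ≫ W'.act e c)
    (hract : ∀ i c c', W.ract i c c' ≫ φ i c' = φ i c ▷ _ ≫ W'.ract i c c')
    (hmap : ∀ e, post (Y.map e) (y (S.t e)) = pre (y (S.s e)) (Y'.map e))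
    {f : 𝟙_ V ⟶ (L ⟶[V] L')}
    (hf : ∀ i c, post (q i c) (f ≫ proj L L' c) = φ i c ≫ pre (y i) (q' i c)) :
    IsInvertible f := by
  choose z hz hz' using hy
  -- The inverses `z` are natural along edges, because precomposition with an invertible morphism
  -- can be cancelled.
  have hmap' : ∀ e, post (Y'.map e) (z (S.t e)) = pre (z (S.s e)) (Y.map e) := by
    intro e
    apply pre_inj ⟨z (S.s e), hz _, hz' _⟩
    rw [pre_post, ← hmap, post_post, hz, post_eId, pre_pre, hz, pre_eId]
  have hact' : ∀ e c, W'.act e c ≫ inv (φ (S.s e) c) = S.h e ◁ inv (φ (S.t e) c) ≫ W.act e c := by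
    intro e c
    rw [IsIso.comp_inv_eq, Category.assoc, hact, ← MonoidalCategory.whiskerLeft_comp_assoc,
      IsIso.inv_hom_id, whiskerLeft_id, Category.id_comp]
  have hract' : ∀ i c c', W'.ract i c c' ≫ inv (φ i c') = inv (φ i c) ▷ _ ≫ W.ract i c c' := by
    intro i c c'
    rw [IsIso.comp_inv_eq, Category.assoc, hract, ← comp_whiskerRight_assoc,
      IsIso.inv_hom_id, id_whiskerRight, Category.id_comp]
  obtain ⟨g, hg⟩ := H'.exists_hom (L' := L) (fun i c => inv (φ i c) ≫ pre (z i) (q i c)) (by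
    intro e c
    rw [reassoc_of% hact', ← comp_pre, H.nat, ecmp_comp, ← pre_ecmp, ← hmap', post_ecmp]) (by
    intro i c c'
    rw [comp_ecmp, pre_ecmp, H.ract, comp_pre, reassoc_of% hract'])
  refine ⟨g, H.hom_ext fun i c => ?_, H'.hom_ext fun i c => ?_⟩
  · rw [eId_proj, post_eId, pre_proj, ← post_post, hf, comp_post, ← pre_post, hg, comp_pre,
      pre_pre, hz, pre_eId, IsIso.hom_inv_id_assoc]
  · rw [eId_proj, post_eId, pre_proj, ← post_post, hg, comp_post, ← pre_post, hf, comp_pre,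
      pre_pre, hz', pre_eId, IsIso.inv_hom_id_assoc]

end Induced

/-! ### Reordering the factors of a product graph. -/

section Reindexing

/-- Exchange of the factors of a product graph. -/
@[reducible]
def WtFam.swap (W : WtFam (S.prod S') C) : WtFam (S'.prod S) C where
  obj p := W.obj (p.2, p.1)
  act
    | .inl e, c => W.act (.inr (e.2, e.1)) c
    | .inr e, c => W.act (.inl (e.2, e.1)) c
  ract p := W.ract (p.2, p.1)

/-- Exchange of the factors of a product graph. -/
@[reducible]
def Diag.swap (Y : Diag (S.prod S') X) : Diag (S'.prod S) X where
  obj p := Y.obj (p.2, p.1)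
  map
    | .inl e => Y.map (.inr (e.2, e.1))
    | .inr e => Y.map (.inl (e.2, e.1))

theorem Presents.swap {W : WtFam (S.prod S') C} {Y : Diag (S.prod S') X}
    {L : EnrichedFunctor V C X} {q : ∀ i c, W.obj i c ⟶ (Y.obj i ⟶[V] L.obj c)}
    (H : Presents W Y L q) : Presents W.swap Y.swap L (fun p => q (p.2, p.1)) where
  nat := by
    rintro (e | e) c
    · exact H.nat (.inr (e.2, e.1)) c
    · exact H.nat (.inl (e.2, e.1)) c
  existsUnique c v x t ht := by
    obtain ⟨f, hf, hu⟩ := H.existsUnique c v x (fun p => t (p.2, p.1)) (by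
      rintro (e | e)
      · exact ht (.inr (e.2, e.1))
      · exact ht (.inl (e.2, e.1)))
    exact ⟨f, fun p => hf (p.2, p.1), fun g hg => hu g fun p => hg (p.2, p.1)⟩
  ract p := H.ract (p.2, p.1)

/-- Reassociation of the factors of a product graph. -/
@[reducible]
def WtFam.assoc (W : WtFam (S.prod (S'.prod S'')) C) : WtFam ((S.prod S').prod S'') C where
  obj p := W.obj (p.1.1, (p.1.2, p.2))
  act
    | .inl (.inl e, i), c => W.act (.inl (e.1, (e.2, i))) c
    | .inl (.inr e, i), c => W.act (.inr (e.1, .inl (e.2, i))) c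
    | .inr (i, e), c => W.act (.inr (i.1, .inr (i.2, e))) c
  ract p := W.ract (p.1.1, (p.1.2, p.2))

/-- Reassociation of the factors of a product graph. -/
@[reducible]
def Diag.assoc (Y : Diag (S.prod (S'.prod S'')) X) : Diag ((S.prod S').prod S'') X where
  obj p := Y.obj (p.1.1, (p.1.2, p.2))
  map
    | .inl (.inl e, i) => Y.map (.inl (e.1, (e.2, i)))
    | .inl (.inr e, i) => Y.map (.inr (e.1, .inl (e.2, i)))
    | .inr (i, e) => Y.map (.inr (i.1, .inr (i.2, e)))

theorem Presents.assoc {W : WtFam (S.prod (S'.prod S'')) C} {Y : Diag (S.prod (S'.prod S'')) X}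
    {L : EnrichedFunctor V C X} {q : ∀ i c, W.obj i c ⟶ (Y.obj i ⟶[V] L.obj c)}
    (H : Presents W Y L q) : Presents W.assoc Y.assoc L (fun p => q (p.1.1, (p.1.2, p.2))) where
  nat := by
    rintro (⟨e | e, i⟩ | ⟨i, e⟩) c
    · exact H.nat (.inl (e.1, (e.2, i))) c
    · exact H.nat (.inr (e.1, .inl (e.2, i))) c
    · exact H.nat (.inr (i.1, .inr (i.2, e))) c
  existsUnique c v x t ht := by
    obtain ⟨f, hf, hu⟩ := H.existsUnique c v x (fun p => t ((p.1, p.2.1), p.2.2)) (by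
      rintro (⟨e, i, j⟩ | ⟨i, ⟨e, j⟩ | ⟨j, e⟩⟩)
      · exact ht (.inl (.inl (e, i), j))
      · exact ht (.inl (.inr (i, e), j))
      · exact ht (.inr ((i, j), e)))
    exact ⟨f, fun p => hf (p.1.1, (p.1.2, p.2)), fun g hg => hu g fun p => hg ((p.1, p.2.1), p.2.2)⟩
  ract p := H.ract (p.1.1, (p.1.2, p.2))

end Reindexing

end Presentations

/-- A commuting square moves an element of stage `q` to the front of one of stage `p`; `lcomm` is
the permutation of stages that this causes. -/
theorem Sq.lcomm_ecmp {X : Type u₁} [EnrichedCategory V X] {x y x' y' z : X} {p q r : V}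
    {h : p ⟶ (x ⟶[V] y)} {f : q ⟶ (y ⟶[V] y')} {g : q ⟶ (x ⟶[V] x')} {h' : p ⟶ (x' ⟶[V] y')}
    (s : Sq h f g h') (k : r ⟶ (y' ⟶[V] z)) : lcomm q p r ≫ (h ⨟ (f ⨟ k)) = g ⨟ (h' ⨟ k) := by
  rw [lcomm, ecmp_assoc', show h ⨟ f = _ from s, comp_ecmp, ecmp_assoc]
  simp [← comp_whiskerRight_assoc]

theorem lcomm_lcomm (p q r : V) : lcomm p q r ≫ lcomm q p r = 𝟙 _ := by
  simp [lcomm, ← comp_whiskerRight_assoc]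

instance (p q r : V) : IsIso (lcomm p q r) := ⟨lcomm q p r, lcomm_lcomm _ _ _, lcomm_lcomm _ _ _⟩

/-- The braiding of `h` with `l` occurs once in each direction and cancels, leaving associators.
This coherence is needed wherever a contravariant action on the second factor of a tensor product of
weights meets a cocone. -/
theorem lcomm_tensor_right (h l n v : V) :
    l ◁ (α_ h n v).hom ≫ lcomm l h (n ⊗ v) ≫ h ◁ (α_ l n v).inv ≫ (α_ h (l ⊗ n) v).inv ≫
      lcomm h l n ▷ v = (α_ l (h ⊗ n) v).inv := by
  have e : (α_ (h ⊗ l) n v).hom ≫ (α_ h l (n ⊗ v)).hom ≫ h ◁ (α_ l n v).inv ≫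
      (α_ h (l ⊗ n) v).inv ≫ (α_ h l n).inv ▷ v = 𝟙 _ := by monoidal
  simp only [lcomm, comp_whiskerRight, whiskerRight_tensor, Category.assoc]
  have e' : (β_ l h).hom ▷ n ▷ v ≫ (β_ h l).hom ▷ n ▷ v = 𝟙 _ := by
    rw [← comp_whiskerRight, ← comp_whiskerRight, SymmetricCategory.symmetry, id_whiskerRight,
      id_whiskerRight]
  rw [reassoc_of% e, reassoc_of% e']
  monoidal

/-! ### Maps out of a coend tensored with an object. -/

section TensLemmas

open Limits

variable [MonoidalClosed V] [HasCoproducts.{u} V] [HasCoequalizers V]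
variable {C : Type u} [EnrichedCategory V C] (L : CoPsh V C) (N : Psh V C)

theorem tens_condition (u u' : C) : L.act u u' ▷ N.obj u' ≫ tensι L N u' =
    (α_ _ _ _).hom ≫ L.obj u ◁ N.act u u' ≫ tensι L N u := by
  have := congrArg (fun k => Sigma.ι (fun p : C × C => (L.obj p.1 ⊗ (p.1 ⟶[V] p.2)) ⊗ N.obj p.2)
    (u, u') ≫ k) (coequalizer.condition (tensMapL L N) (tensMapR L N))
  simp only [tensMapL, tensMapR, Sigma.ι_desc_assoc, Category.assoc] at this
  exact this

variable {L N}

/-- Since V is closed, tensoring preserves the coend; this is the uniqueness half of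
`tens_existsUnique`. -/
theorem tens_whiskerLeft_ext {p z : V} {f g : p ⊗ tens L N ⟶ z}
    (e : ∀ u, p ◁ tensι L N u ≫ f = p ◁ tensι L N u ≫ g) : f = g := by
  obtain ⟨k, _, hk⟩ := tens_existsUnique L N (fun u => p ◁ tensι L N u ≫ g) (by
    intro a b
    rw [← MonoidalCategory.whiskerLeft_comp_assoc, ← MonoidalCategory.whiskerLeft_comp_assoc,
      tens_condition, Category.assoc])
  rw [hk f e, hk g (fun _ => rfl)]

theorem tens_whiskerRight_ext {p z : V} {f g : tens L N ⊗ p ⟶ z}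
    (e : ∀ u, tensι L N u ▷ p ≫ f = tensι L N u ▷ p ≫ g) : f = g := by
  rw [← cancel_epi (β_ p _).hom]
  apply tens_whiskerLeft_ext
  intro u
  rw [braiding_naturality_right_assoc, braiding_naturality_right_assoc, e]

theorem tens_ext {z : V} {f g : tens L N ⟶ z} (e : ∀ u, tensι L N u ≫ f = tensι L N u ≫ g) :
    f = g := by
  rw [← cancel_epi (λ_ _).hom]
  apply tens_whiskerLeft_ext
  intro u
  rw [leftUnitor_naturality_assoc, leftUnitor_naturality_assoc, e]

theorem exists_tens_whiskerRight {p z : V} (f : ∀ u, (L.obj u ⊗ N.obj u) ⊗ p ⟶ z)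
    (hf : ∀ u u', (L.act u u' ▷ N.obj u') ▷ p ≫ f u' =
      ((α_ _ _ _).hom ≫ L.obj u ◁ N.act u u') ▷ p ≫ f u) :
    ∃ g : tens L N ⊗ p ⟶ z, ∀ u, tensι L N u ▷ p ≫ g = f u := by
  obtain ⟨g, hg, _⟩ := tens_existsUnique L N (fun u => (β_ p _).hom ≫ f u) (by
    intro u u'
    rw [braiding_naturality_right_assoc, hf, braiding_naturality_right_assoc])
  refine ⟨(β_ _ _).hom ≫ g, fun u => ?_⟩
  rw [braiding_naturality_left_assoc, hg, SymmetricCategory.symmetry_assoc]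

theorem exists_tens {z : V} (f : ∀ u, L.obj u ⊗ N.obj u ⟶ z)
    (hf : ∀ u u', L.act u u' ▷ N.obj u' ≫ f u' = (α_ _ _ _).hom ≫ L.obj u ◁ N.act u u' ≫ f u) :
    ∃ g : tens L N ⟶ z, ∀ u, tensι L N u ≫ g = f u := by
  obtain ⟨g, hg⟩ := exists_tens_whiskerRight (p := 𝟙_ V) (fun u => (ρ_ _).hom ≫ f u) (by
    intro u u'
    rw [rightUnitor_naturality_assoc, hf, rightUnitor_naturality_assoc, Category.assoc])
  refine ⟨(ρ_ _).inv ≫ g, fun u => ?_⟩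
  rw [rightUnitor_inv_naturality_assoc, hg, Iso.inv_hom_id_assoc]

end TensLemmas

/-! ### Iterated colimits as colimits weighted by coends. -/

section Composition

open Limits

variable [MonoidalClosed V] [HasCoproducts.{u} V] [HasCoequalizers V]
  {S S' : Shape.{u} V} {C : Type u} [EnrichedCategory V C] {D : Type u} [EnrichedCategory V D]
  {X : Type u₁} [EnrichedCategory V X]

/-- The family of weights given by covariant `V`-functors. -/
@[reducible]
def WtFam.inner (L : S.I → CoPsh V C)
    (act : ∀ e u, S.h e ⊗ (L (S.t e)).obj u ⟶ (L (S.s e)).obj u) : WtFam S C where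
  obj i u := (L i).obj u
  act := act
  ract i u u' := (L i).act u u'

/-- The family of weights given by contravariant `V`-functors. -/
@[reducible]
def WtFam.outer (N : S'.I → D → Psh V C)
    (act : ∀ e d u, S'.h e ⊗ (N (S'.t e) d).obj u ⟶ (N (S'.s e) d).obj u)
    (ract : ∀ j d d' u, (N j d).obj u ⊗ (d ⟶[V] d') ⟶ (N j d').obj u) :
    WtFam ((Shape.ofCat V C).prod S') D where
  obj p d := (N p.2 d).obj p.1
  act
    | .inl e, d => (N e.2 d).act e.1.1 e.1.2
    | .inr e, d => act e.2 d e.1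
  ract p d d' := ract p.2 d d' p.1

/-- The diagram given by `V`-functors. -/
@[reducible]
def Diag.outer (Φ : S'.I → EnrichedFunctor V C X)
    (map : ∀ e u, S'.h e ⟶ ((Φ (S'.s e)).obj u ⟶[V] (Φ (S'.t e)).obj u)) :
    Diag ((Shape.ofCat V C).prod S') X where
  obj p := (Φ p.2).obj p.1
  map
    | .inl e => (Φ e.2).map e.1.1 e.1.2
    | .inr e => map e.2 e.1

/-- The family of weights given by coends. -/
@[reducible]
def WtFam.coend (L : S.I → CoPsh V C) (N : S'.I → D → Psh V C)
    (act₁ : ∀ e j d, S.h e ⊗ tens (L (S.t e)) (N j d) ⟶ tens (L (S.s e)) (N j d))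
    (act₂ : ∀ i e d, S'.h e ⊗ tens (L i) (N (S'.t e) d) ⟶ tens (L i) (N (S'.s e) d))
    (ract : ∀ i j d d', tens (L i) (N j d) ⊗ (d ⟶[V] d') ⟶ tens (L i) (N j d')) :
    WtFam (S.prod S') D where
  obj p d := tens (L p.1) (N p.2 d)
  act
    | .inl e, d => act₁ e.1 e.2 d
    | .inr e, d => act₂ e.1 e.2 d
  ract p d d' := ract p.1 p.2 d d'

/-- The diagram given by a family of diagrams. -/
@[reducible]
def Diag.family (Y : S'.I → Diag S X)
    (map : ∀ i e, S'.h e ⟶ ((Y (S'.s e)).obj i ⟶[V] (Y (S'.t e)).obj i)) :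
    Diag (S.prod S') X where
  obj p := (Y p.2).obj p.1
  map
    | .inl e => (Y e.2).map e.1
    | .inr e => map e.1 e.2

variable {L : S.I → CoPsh V C}
  {actL : ∀ e u, S.h e ⊗ (L (S.t e)).obj u ⟶ (L (S.s e)).obj u}
  {Y : S'.I → Diag S X} {Φ : S'.I → EnrichedFunctor V C X}
  {q : ∀ j i u, (L i).obj u ⟶ ((Y j).obj i ⟶[V] (Φ j).obj u)}
  {N : S'.I → D → Psh V C}
  {actN : ∀ e d u, S'.h e ⊗ (N (S'.t e) d).obj u ⟶ (N (S'.s e) d).obj u}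
  {ractN : ∀ j d d' u, (N j d).obj u ⊗ (d ⟶[V] d') ⟶ (N j d').obj u}
  {mapΦ : ∀ e u, S'.h e ⟶ ((Φ (S'.s e)).obj u ⟶[V] (Φ (S'.t e)).obj u)}
  {M : EnrichedFunctor V D X} {r : ∀ j u d, (N j d).obj u ⟶ ((Φ j).obj u ⟶[V] M.obj d)}
  {act₁ : ∀ e j d, S.h e ⊗ tens (L (S.t e)) (N j d) ⟶ tens (L (S.s e)) (N j d)}
  {act₂ : ∀ i e d, S'.h e ⊗ tens (L i) (N (S'.t e) d) ⟶ tens (L i) (N (S'.s e) d)}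
  {ract : ∀ i j d d', tens (L i) (N j d) ⊗ (d ⟶[V] d') ⟶ tens (L i) (N j d')}
  {mapY : ∀ i e, S'.h e ⟶ ((Y (S'.s e)).obj i ⟶[V] (Y (S'.t e)).obj i)}
  {Q : ∀ i j d, tens (L i) (N j d) ⟶ ((Y j).obj i ⟶[V] M.obj d)}

/-- Iterated weighted colimits are colimits weighted by coends. -/
theorem Presents.coend (hq : ∀ j, Presents (WtFam.inner L actL) (Y j) (Φ j) (q j))
    (hr : Presents (WtFam.outer N actN ractN) (Diag.outer Φ mapΦ) M (fun p d => r p.2 p.1 d))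
    (h₁ : ∀ e j d u, S.h e ◁ tensι (L (S.t e)) (N j d) u ≫ act₁ e j d =
      (α_ _ _ _).inv ≫ actL e u ▷ _ ≫ tensι (L (S.s e)) (N j d) u)
    (h₂ : ∀ i e d u, S'.h e ◁ tensι (L i) (N (S'.t e) d) u ≫ act₂ i e d =
      lcomm _ _ _ ≫ _ ◁ actN e d u ≫ tensι (L i) (N (S'.s e) d) u)
    (h₃ : ∀ i j d d' u, tensι (L i) (N j d) u ▷ _ ≫ ract i j d d' =
      (α_ _ _ _).hom ≫ _ ◁ ractN j d d' u ≫ tensι (L i) (N j d') u)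
    (hsq : ∀ i e u, Sq (q (S'.s e) i u) (mapΦ e u) (mapY i e) (q (S'.t e) i u))
    (hQ : ∀ i j d u, tensι (L i) (N j d) u ≫ Q i j d = q j i u ⨟ r j u d) :
    Presents (WtFam.coend L N act₁ act₂ ract) (Diag.family Y mapY) M
      (fun p d => Q p.1 p.2 d) where
  nat := by
    rintro (⟨e, j⟩ | ⟨i, e⟩) d
    · apply tens_whiskerLeft_ext
      intro u
      have hn : actL e u ≫ q j (S.s e) u = (Y j).map e ⨟ q j (S.t e) u := (hq j).nat e u
      change _ ◁ tensι (L (S.t e)) (N j d) u ≫ act₁ e j d ≫ Q (S.s e) j d =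
        _ ◁ tensι (L (S.t e)) (N j d) u ≫ ((Y j).map e ⨟ Q (S.t e) j d)
      rw [reassoc_of% h₁, hQ, ← comp_ecmp, hn, ← ecmp_assoc', ← hQ, ecmp_comp]
    · apply tens_whiskerLeft_ext
      intro u
      have hn : actN e d u ≫ r (S'.s e) u d = mapΦ e u ⨟ r (S'.t e) u d := hr.nat (.inr (u, e)) d
      change _ ◁ tensι (L i) (N (S'.t e) d) u ≫ act₂ i e d ≫ Q i (S'.s e) d =
        _ ◁ tensι (L i) (N (S'.t e) d) u ≫ (mapY i e ⨟ Q i (S'.t e) d)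
      rw [reassoc_of% h₂, hQ, ← ecmp_comp, hn, (hsq i e u).lcomm_ecmp, ← hQ, ecmp_comp]
  existsUnique d v x t ht := by
    have ht₁ : ∀ e j, act₁ e j d ▷ v ≫ t (S.s e, j) =
        (α_ _ _ _).hom ≫ ((Y j).map e ⨟ t (S.t e, j)) := fun e j => ht (.inl (e, j))
    have ht₂ : ∀ i e, act₂ i e d ▷ v ≫ t (i, S'.s e) =
        (α_ _ _ _).hom ≫ (mapY i e ⨟ t (i, S'.t e)) := fun i e => ht (.inr (i, e))
    -- Restricted along the coprojection at `u` and reassociated, the cocone `t` is a cocone on the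
    -- inner diagram at the larger stage `(N j d).obj u ⊗ v`; the inner colimit turns it into `k j
    -- u`.
    have h : ∀ j u, ∃! k : (N j d).obj u ⊗ v ⟶ ((Φ j).obj u ⟶[V] x),
        ∀ i, q j i u ⨟ k = (α_ _ _ _).inv ≫ tensι (L i) (N j d) u ▷ v ≫ t (i, j) := by
      intro j u
      refine (hq j).existsUnique u _ x _ ?_
      intro e
      have e1 := congrArg (fun k => (S.h e ◁ tensι (L (S.t e)) (N j d) u) ▷ v ≫ k) (ht₁ e j)
      rw [← comp_whiskerRight_assoc, h₁, associator_naturality_middle_assoc, ← ecmp_comp] at e1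
      rw [ecmp_comp]
      change actL e u ▷ _ ≫ _ = _
      have e2 := congrArg (fun k => (α_ _ _ _).inv ≫ (α_ _ _ _).hom ▷ v ≫ k) e1
      simp only [comp_whiskerRight, Category.assoc, hom_inv_whiskerRight_assoc,
        ← associator_inv_naturality_left_assoc] at e2
      rw [e2, pentagon_inv_hom_hom_hom_inv_assoc]
    choose k hk hk' using h
    -- The coend identifies the action of `L i` with that of `N j d`. This relation is the source of
    -- the naturality of `k` in `u`.
    have hbal : ∀ i j u u', (L i).act u u' ▷ _ ≫ (α_ _ _ _).inv ≫ tensι (L i) (N j d) u' ▷ v ≫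
        t (i, j) = (α_ _ _ _).hom ≫ _ ◁ ((α_ _ _ _).inv ≫ (N j d).act u u' ▷ v) ≫ (α_ _ _ _).inv ≫
          tensι (L i) (N j d) u ▷ v ≫ t (i, j) := by
      intro i j u u'
      have e1 := congrArg (fun k => (α_ _ _ _).inv ≫ k ▷ v ≫ t (i, j))
        (tens_condition (L i) (N j d) u u')
      simp only [comp_whiskerRight, Category.assoc] at e1
      rw [associator_inv_naturality_left_assoc, e1]
      simp
    -- The `k j u` form a cocone on the outer diagram. This is tested on inner coprojections: along
    -- morphisms of `C` it is the balancing relation, along edges of `S'` it is `ht₂` combined with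
    -- the square `hsq`.
    obtain ⟨f, hf, hu⟩ := hr.existsUnique d v x (fun p => k p.2 p.1) (by
      rintro (⟨⟨u, u'⟩, j⟩ | ⟨u, e⟩)
      · apply (hq j).ext
        intro i
        have hn : q j i u ⨟ (Φ j).map u u' = (L i).act u u' ≫ q j i u' := (hq j).ract i u u'
        change q j i u ⨟ ((N j d).act u u' ▷ v ≫ k j u) =
          q j i u ⨟ ((α_ _ _ _).hom ≫ ((Φ j).map u u' ⨟ k j u'))
        rw [ecmp_comp, ecmp_comp, hk, ecmp_assoc', hn, comp_ecmp, hk, hbal]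
        simp
      · apply (hq (S'.s e)).ext
        intro i
        change q _ i u ⨟ (actN e d u ▷ v ≫ k _ u) =
          q _ i u ⨟ ((α_ _ _ _).hom ≫ (mapΦ e u ⨟ k _ u))
        have e1 := congrArg (fun k => (S'.h e ◁ tensι (L i) (N (S'.t e) d) u) ▷ v ≫ k) (ht₂ i e)
        rw [← comp_whiskerRight_assoc, h₂, associator_naturality_middle_assoc, ← ecmp_comp] at e1
        have e2 := (hsq i e u).lcomm_ecmp (k (S'.t e) u)
        rw [hk, ecmp_comp, ← Iso.inv_hom_id_assoc (α_ _ _ _) (mapY i e ⨟ _), ← e1,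
          ← cancel_epi (lcomm _ _ _), ← Category.assoc, lcomm_lcomm, Category.id_comp] at e2
        have e3 := lcomm_tensor_right (S'.h e) ((L i).obj u) ((N (S'.t e) d).obj u) v
        rw [ecmp_comp, ecmp_comp, hk, e2]
        simp only [comp_whiskerRight, Category.assoc]
        rw [reassoc_of% e3, associator_inv_naturality_middle_assoc])
    refine ⟨f, fun p => ?_, fun g hg => ?_⟩
    · apply tens_whiskerRight_ext
      intro u
      rw [← comp_ecmp, hQ, ecmp_assoc, show r p.2 u d ⨟ f = k p.2 u from hf (u, p.2), hk,
        Iso.hom_inv_id_assoc]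
    -- Restricted along `r`, another factorization solves the inner problems that define `k`, so
    -- both uniqueness statements apply in turn.
    · apply hu
      intro p
      apply hk'
      intro i
      change q p.2 i p.1 ⨟ (r p.2 p.1 d ⨟ g) = _
      rw [ecmp_assoc', ← hQ, comp_ecmp, show Q i p.2 d ⨟ g = t (i, p.2) from hg (i, p.2)]
  ract p d d' := by
    apply tens_whiskerRight_ext
    intro u
    have hn : r p.2 u d ⨟ M.map d d' = ractN p.2 d d' u ≫ r p.2 u d' := hr.ract (u, p.2) d d'
    rw [← comp_ecmp, hQ, ecmp_assoc, hn, ecmp_comp, ← hQ, reassoc_of% h₃]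

end Composition

/-! ### Replacing the edge actions of a presentation by equal ones. -/

section Congruence

variable {S : Shape.{u} V} {C : Type u₂} [EnrichedCategory V C] {X : Type u₁}
  [EnrichedCategory V X] {W : WtFam S C} {Y : Diag S X} {L : EnrichedFunctor V C X}
  {q : ∀ i c, W.obj i c ⟶ (Y.obj i ⟶[V] L.obj c)}

theorem Presents.congr (H : Presents W Y L q)
    {act : ∀ e c, S.h e ⊗ W.obj (S.t e) c ⟶ W.obj (S.s e) c} (hact : ∀ e c, W.act e c = act e c)
    {map : ∀ e, S.h e ⟶ (Y.obj (S.s e) ⟶[V] Y.obj (S.t e))} (hmap : ∀ e, Y.map e = map e) :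
    Presents ⟨W.obj, act, W.ract⟩ ⟨Y.obj, map⟩ L q := by
  obtain rfl : W.act = act := by ext e c; exact hact e c
  obtain rfl : Y.map = map := by ext e; exact hmap e
  exact H

end Congruence

/-! ### Pointwise extensions along a module as presentations. -/

section KanExtensions

variable {A : Type u} [EnrichedCategory V A] {B : Type u} [EnrichedCategory V B]
  {C : Type u} [EnrichedCategory V C] {D : Type u} [EnrichedCategory V D]
  {X : Type u₁} [EnrichedCategory V X] {Y : Type u₂} [EnrichedCategory V Y]

/-- The coprojections `ι d c : M(d, c) ⟶ X(F d, L c)` exhibit the `V`-functor `L` as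
`c ↦ colim_d (M(d, c), F d)`. -/
structure IsLan (M : VMod V C D) (F : EnrichedFunctor V D X) (L : EnrichedFunctor V C X)
    (ι : ∀ d c, M.obj d c ⟶ (F.obj d ⟶[V] L.obj c)) : Prop where
  isColim : ∀ c, IsColim (M.psh c) F (L.obj c) (fun d => ι d c)
  ract : ∀ d c c', ι d c ⨟ L.map c c' = M.ract d c c' ≫ ι d c'

theorem isLan_lanObj (M : VMod V C D) (F : EnrichedFunctor V D X)
    (h : ∀ c, Colim (M.psh c) F) : IsLan M F (lanObj M F h) (fun d c => lanι M F h c d) where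
  isColim c := (h c).isColim
  ract d c c' := lanι_map M F h c c' d

variable {M : VMod V C D} {F : EnrichedFunctor V D X} {L : EnrichedFunctor V C X}
  {ι : ∀ d c, M.obj d c ⟶ (F.obj d ⟶[V] L.obj c)}

theorem IsLan.comp (h : IsLan M F L ι) {S : EnrichedFunctor V X Y}
    (hS : PreservesColims.{w, u} S) :
    IsLan M (F.comp V S) (L.comp V S) (fun d c => ι d c ≫ S.map (F.obj d) (L.obj c)) where
  isColim c := hS D _ F _ _ (h.isColim c)
  ract d c c' := by
    have := congrArg (fun k => k ≫ S.map _ _) (h.ract d c c')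
    simp only [ecmp_map, Category.assoc] at this
    exact this

/-- The action of the weight and the action of `F` both respect composition, so naturality along two
composable elements gives naturality along their composite. -/
theorem cocone_ecmp {W : Psh V D} {v : V} {x : X} {t : ∀ d, W.obj d ⊗ v ⟶ (F.obj d ⟶[V] x)}
    {a b c : D} {p p' : V} {k : p ⟶ (a ⟶[V] b)} {k' : p' ⟶ (b ⟶[V] c)}
    (hk : (k ▷ _ ≫ W.act a b) ▷ v ≫ t a = (α_ _ _ _).hom ≫ ((k ≫ F.map a b) ⨟ t b))
    (hk' : (k' ▷ _ ≫ W.act b c) ▷ v ≫ t b = (α_ _ _ _).hom ≫ ((k' ≫ F.map b c) ⨟ t c)) :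
    ((k ⨟ k') ▷ _ ≫ W.act a c) ▷ v ≫ t a =
      (α_ _ _ _).hom ≫ (((k ⨟ k') ≫ F.map a c) ⨟ t c) := by
  have e1 : (k ⨟ k') ▷ W.obj c ≫ W.act a c =
      (α_ _ _ _).hom ≫ p ◁ (k' ▷ _ ≫ W.act b c) ≫ k ▷ _ ≫ W.act a b := by
    rw [ecmp, comp_whiskerRight_assoc, W.act_comp, MonoidalCategory.tensorHom_def,
      comp_whiskerRight_assoc, associator_naturality_middle_assoc,
      associator_naturality_left_assoc, whisker_exchange_assoc,
      MonoidalCategory.whiskerLeft_comp_assoc]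
  rw [e1, ecmp_map, ecmp_assoc, ← cancel_epi ((α_ _ _ _).inv ▷ v)]
  have e2 : (α_ p p' (W.obj c)).inv ▷ v ≫ (α_ _ _ _).hom ≫ (α_ p p' (W.obj c ⊗ v)).hom =
      (α_ _ _ _).hom ≫ p ◁ (α_ _ _ _).hom := by monoidal
  rw [reassoc_of% e2, ← ecmp_comp, ← hk', ecmp_comp, ← associator_naturality_middle_assoc, ← hk]
  simp

/-- When the identity of a hom-object factors through a composite `k ⨟ k'`, naturality along `k` and
`k'` gives naturality along the whole hom-object. For a product category the factors are the two
partial actions. -/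
theorem cocone_of_ecmp {W : Psh V D} {v : V} {x : X} {t : ∀ d, W.obj d ⊗ v ⟶ (F.obj d ⟶[V] x)}
    {a b c : D} {p p' : V} {k : p ⟶ (a ⟶[V] b)} {k' : p' ⟶ (b ⟶[V] c)}
    (hk : (k ▷ _ ≫ W.act a b) ▷ v ≫ t a = (α_ _ _ _).hom ≫ ((k ≫ F.map a b) ⨟ t b))
    (hk' : (k' ▷ _ ≫ W.act b c) ▷ v ≫ t b = (α_ _ _ _).hom ≫ ((k' ≫ F.map b c) ⨟ t c))
    (j : (a ⟶[V] c) ⟶ p ⊗ p') (hj : j ≫ (k ⨟ k') = 𝟙 _) :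
    W.act a c ▷ v ≫ t a = (α_ _ _ _).hom ≫ (F.map a c ⨟ t c) := by
  have e := congrArg (fun l => j ▷ _ ▷ v ≫ l) (cocone_ecmp hk hk')
  simp only [← comp_whiskerRight_assoc, associator_naturality_left_assoc, ← comp_ecmp] at e
  simpa only [reassoc_of% hj, ← Category.assoc, hj, ← comp_whiskerRight, id_whiskerRight,
    Category.id_comp] using e

/-- The action of `(-, b)` on hom-objects. -/
def secLMap (a a' : A) (b : B) : (a ⟶[V] a') ⟶ ((a, b) ⟶[V] (a', b)) := (secL b).map a a'

/-- The action of `(a, -)` on hom-objects. -/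
def secRMap (a : A) (b b' : B) : (b ⟶[V] b') ⟶ ((a, b) ⟶[V] (a, b')) := (secR a).map b b'

/-- This is `whR_ecmp_whL` for the identity functor of `A × B`. -/
theorem secLMap_ecmp_secRMap (a a' : A) (b b' : B) :
    secLMap a a' b ⨟ secRMap a' b b' = 𝟙 ((a ⟶[V] a') ⊗ (b ⟶[V] b')) := by
  have := whR_ecmp_whL (T := EnrichedFunctor.id V (A × B)) (𝟙 (a ⟶[V] a')) (𝟙 (b ⟶[V] b'))
  refine Eq.trans (congrArg₂ ecmp ?_ ?_) (this.trans ?_)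
  · rw [whR_eq_map, Category.id_comp]
    exact (Category.comp_id _).symm
  · rw [whL_eq_map, Category.id_comp]
    exact (Category.comp_id _).symm
  · rw [mapPair, id_tensorHom_id, Category.id_comp]
    rfl

theorem IsLan.nat (h : IsLan M F L ι) {d d' : D} {p : V} (k : p ⟶ (d ⟶[V] d')) (c : C) :
    (k ▷ _ ≫ M.lact d d' c) ≫ ι d c = (k ≫ F.map d d') ⨟ ι d' c := by
  have e : M.lact d d' c ≫ ι d c = F.map d d' ⨟ ι d' c := (h.isColim c).nat d d'
  rw [Category.assoc, comp_ecmp, e]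

/-- The contravariant action of a product, one variable at a time. -/
@[reducible]
def VMod.actPair (M : VMod V C (A × B)) : ∀ (e : ((Shape.ofCat V A).prod (Shape.ofCat V B)).E) (c : C),
    ((Shape.ofCat V A).prod (Shape.ofCat V B)).h e ⊗
      M.obj (((Shape.ofCat V A).prod (Shape.ofCat V B)).t e) c ⟶
      M.obj (((Shape.ofCat V A).prod (Shape.ofCat V B)).s e) c
  | .inl e, c => ((M.psh c).restrict (secL e.2)).act e.1.1 e.1.2
  | .inr e, c => ((M.psh c).restrict (secR e.1)).act e.2.1 e.2.2

/-- The diagram on a product of graphs given by a `V`-functor of two variables. -/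
@[reducible]
def Diag.pair (Ψ : EnrichedFunctor V (A × B) X) :
    Diag ((Shape.ofCat V A).prod (Shape.ofCat V B)) X where
  obj p := Ψ.obj p
  map
    | .inl e => ((secL e.2).comp V Ψ).map e.1.1 e.1.2
    | .inr e => ((secR e.1).comp V Ψ).map e.2.1 e.2.2

/-- Every hom-object of the product is a composite of two one-variable actions, so separate
naturality of a cocone in the two variables already gives joint naturality. -/
theorem IsLan.presents_pair {M : VMod V C (A × B)} {Ψ : EnrichedFunctor V (A × B) X}
    {ι : ∀ d c, M.obj d c ⟶ (Ψ.obj d ⟶[V] L.obj c)} (h : IsLan M Ψ L ι) :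
    Presents (WtFam.inner (fun p => M.copsh p) M.actPair) (Diag.pair Ψ) L ι where
  nat := by
    rintro (⟨⟨a, a'⟩, b⟩ | ⟨a, b, b'⟩) c
    · exact h.nat (secLMap a a' b) c
    · exact h.nat (secRMap a b b') c
  existsUnique c v x t ht := by
    refine (h.isColim c).existsUnique v x t ?_
    rintro ⟨a, b⟩ ⟨a', b'⟩
    exact cocone_of_ecmp (W := M.psh c) (F := Ψ) (t := t) (k := secLMap a a' b)
      (k' := secRMap a' b b') (ht (.inl ((a, a'), b))) (ht (.inr (a', (b, b')))) (𝟙 _)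
      ((Category.id_comp _).trans (secLMap_ecmp_secRMap a a' b b'))
  ract := h.ract

/-- The contravariant action of the graph with no edges. -/
@[reducible]
def VMod.actPoint (M : VMod V C PUnit.{u + 1}) :
    ∀ (e : (Shape.point.{u} V).E) (c : C), (Shape.point V).h e ⊗
      M.obj ((Shape.point V).t e) c ⟶ M.obj ((Shape.point V).s e) c :=
  fun e => nomatch e

/-- The diagram on the graph with one vertex. -/
@[reducible]
def Diag.point (x : X) : Diag (Shape.point.{u} V) X where
  obj _ := x
  map e := nomatch e

/-- Over the unit V-category the weight acts by a unitor and the diagram by an identity, so every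
family is a cocone and no edges are needed. -/
theorem IsLan.presents_point {M : VMod V C PUnit.{u + 1}} {Ψ : EnrichedFunctor V PUnit.{u + 1} X}
    {ι : ∀ d c, M.obj d c ⟶ (Ψ.obj d ⟶[V] L.obj c)} (h : IsLan M Ψ L ι) :
    Presents (WtFam.inner (fun p => M.copsh p) M.actPoint) (Diag.point (Ψ.obj PUnit.unit)) L ι where
  nat e := nomatch e
  existsUnique c v x t ht := by
    refine (h.isColim c).existsUnique v x t ?_
    rintro ⟨⟩ ⟨⟩
    have e1 : M.lact PUnit.unit PUnit.unit c = (λ_ _).hom := by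
      have := M.lact_id PUnit.unit c
      rwa [show eId V PUnit.unit = 𝟙 (𝟙_ V) from rfl, id_whiskerRight, Category.id_comp] at this
    have e2 : Ψ.map PUnit.unit PUnit.unit = eId V (Ψ.obj PUnit.unit) := by
      have := Ψ.map_id PUnit.unit
      rwa [show eId V PUnit.unit = 𝟙 (𝟙_ V) from rfl, Category.id_comp] at this
    rw [e2]
    refine Eq.trans ?_ (congrArg _ (eId_ecmp _).symm)
    change M.lact PUnit.unit PUnit.unit c ▷ v ≫ _ = _
    rw [e1]
    simp
    rfl
  ract := h.ract

/-- The action on a family of weights on a graph without edges. -/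
@[reducible]
def pointAct (N : PUnit.{u + 1} → C → Psh V D) :
    ∀ (e : (Shape.point.{u} V).E) (c : C) (d : D), (Shape.point V).h e ⊗
      (N ((Shape.point V).t e) c).obj d ⟶ (N ((Shape.point V).s e) c).obj d := fun e => nomatch e

/-- The action on a family of diagrams on a graph without edges. -/
@[reducible]
def pointMap (Φ : PUnit.{u + 1} → EnrichedFunctor V D X) :
    ∀ (e : (Shape.point.{u} V).E) (d : D), (Shape.point V).h e ⟶
      ((Φ ((Shape.point V).s e)).obj d ⟶[V] (Φ ((Shape.point V).t e)).obj d) := fun e => nomatch e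

/-- A dummy parameter graph with one vertex puts an ordinary weighted colimit in the form of the
outer stage of `Presents.coend`. -/
theorem IsLan.presents_outer (h : IsLan M F L ι) :
    Presents (WtFam.outer (S' := Shape.point.{u} V) (fun _ c => M.psh c) (pointAct (V := V) fun _ c => M.psh c)
      (fun _ c c' d => M.ract d c c')) (Diag.outer (S' := Shape.point.{u} V) (fun _ => F)
      (pointMap (V := V) fun _ => F)) L (fun p c => ι p.1 c) where
  nat := by
    rintro (⟨⟨d, d'⟩, _⟩ | ⟨_, e⟩) c
    · exact (h.isColim c).nat d d'
    · exact nomatch e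
  existsUnique c v x t ht := by
    obtain ⟨f, hf, hu⟩ := (h.isColim c).existsUnique v x (fun d => t (d, PUnit.unit))
      (fun d d' => ht (.inl ((d, d'), PUnit.unit)))
    exact ⟨f, fun p => hf p.1, fun g hg => hu g fun d => hg (d, PUnit.unit)⟩
  ract p c c' := h.ract p.1 c c'

end KanExtensions

/-! ### Extensions of external tensor products, one variable at a time. -/

section TwoVariables

variable {A : Type u} [EnrichedCategory V A] {B : Type u} [EnrichedCategory V B]
  {C : Type u} [EnrichedCategory V C] {X : Type u₁} [EnrichedCategory V X]
  {T : EnrichedFunctor V (X × X) X}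
  [MonoidalClosed V] [Limits.HasProducts.{u} V] [Limits.HasEqualizers V]

theorem secL_extObj_map (F : EnrichedFunctor V A X) (G : EnrichedFunctor V B X) (a a' : A) (b : B) :
    ((secL b).comp V (extObj T F G)).map a a' = whR T (F.map a a') (G.obj b) := by
  change ((ρ_ _).inv ≫ _ ◁ eId V b) ≫ mapPair T (F.map a a') (G.map b b) = _
  rw [whR, Category.assoc, ← mapPair_comp_right, G.map_id]

theorem secR_extObj_map (F : EnrichedFunctor V A X) (G : EnrichedFunctor V B X) (a : A) (b b' : B) :
    ((secR a).comp V (extObj T F G)).map b b' = whL T (F.obj a) (G.map b b') := by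
  change ((λ_ _).inv ≫ eId V a ▷ _) ≫ mapPair T (F.map a a) (G.map b b') = _
  rw [whL, Category.assoc, ← mapPair_comp_left, F.map_id]

variable (T) in
/-- The diagram `(a, b) ↦ F a ⊗ G b`. -/
@[reducible]
def Diag.ext (F : EnrichedFunctor V A X) (G : EnrichedFunctor V B X) :
    Diag ((Shape.ofCat V A).prod (Shape.ofCat V B)) X where
  obj p := T.obj (F.obj p.1, G.obj p.2)
  map
    | .inl e => whR T (F.map e.1.1 e.1.2) (G.obj e.2)
    | .inr e => whL T (F.obj e.1) (G.map e.2.1 e.2.2)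

/-- The image of a diagram under a `V`-functor. -/
@[reducible]
def Diag.comp {S : Shape.{u} V} {Y : Type u₂} [EnrichedCategory V Y] (D : Diag S X)
    (Z : EnrichedFunctor V X Y) : Diag S Y where
  obj i := Z.obj (D.obj i)
  map e := D.map e ≫ Z.map _ _

theorem IsLan.presents_ext {M : VMod V C (A × B)} {F : EnrichedFunctor V A X}
    {G : EnrichedFunctor V B X} {L : EnrichedFunctor V C X}
    {ι : ∀ d c, M.obj d c ⟶ ((extObj T F G).obj d ⟶[V] L.obj c)} (h : IsLan M (extObj T F G) L ι) :
    Presents (WtFam.inner (fun p => M.copsh p) M.actPair) (Diag.ext T F G) L ι :=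
  h.presents_pair.congr (fun _ _ => rfl) (by
    rintro (e | e)
    · exact secL_extObj_map F G _ _ _
    · exact secR_extObj_map F G _ _ _)

/-- Inner stage of a threefold tensor product; `Z` will be tensoring with a fixed object. -/
theorem IsLan.presents_ext_comp {M : VMod V C (A × B)} {F : EnrichedFunctor V A X}
    {G : EnrichedFunctor V B X} {L : EnrichedFunctor V C X}
    {ι : ∀ d c, M.obj d c ⟶ ((extObj T F G).obj d ⟶[V] L.obj c)} (h : IsLan M (extObj T F G) L ι)
    {Z : EnrichedFunctor V X X} (hZ : PreservesColims.{w, u} Z) :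
    Presents (WtFam.inner (fun p => M.copsh p) M.actPair) ((Diag.ext T F G).comp Z)
      (L.comp V Z) (fun d c => ι d c ≫ Z.map _ _) :=
  (h.comp hZ).presents_pair.congr (fun _ _ => rfl) (by
    rintro (e | e)
    · exact (Category.assoc _ _ _).symm.trans (congrArg (· ≫ Z.map _ _) (secL_extObj_map F G _ _ _))
    · exact (Category.assoc _ _ _).symm.trans (congrArg (· ≫ Z.map _ _) (secR_extObj_map F G _ _ _)))

/-- The colimit is read as one over `A`, with `B` reduced to a graph of parameters. This is the
outer stage of `Presents.coend` when the first tensor factor is itself a colimit. -/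
theorem IsLan.presents_left {M : VMod V C (A × B)} {F : EnrichedFunctor V A X}
    {G : EnrichedFunctor V B X} {L : EnrichedFunctor V C X}
    {ι : ∀ d c, M.obj d c ⟶ ((extObj T F G).obj d ⟶[V] L.obj c)} (h : IsLan M (extObj T F G) L ι) :
    Presents (WtFam.outer (S' := Shape.ofCat V B) (fun b c => (M.psh c).restrict (secL b))
        (fun e c a => ((M.psh c).restrict (secR a)).act e.1 e.2)
        (fun b c c' a => M.ract (a, b) c c'))
      (Diag.outer (fun b => F.comp V ((secL (G.obj b)).comp V T))
        (fun e a => whL T (F.obj a) (G.map e.1 e.2))) L (fun p c => ι (p.1, p.2) c) :=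
  h.presents_ext.congr (by
    rintro (e | e) c
    · rfl
    · rfl) (by
    rintro (e | e)
    · exact whR_eq_map T _ _
    · rfl)

/-- The mirror image of `presents_left`, for a second tensor factor that is itself a colimit; the
product graph has to be swapped. -/
theorem IsLan.presents_right {M : VMod V C (A × B)} {F : EnrichedFunctor V A X}
    {G : EnrichedFunctor V B X} {L : EnrichedFunctor V C X}
    {ι : ∀ d c, M.obj d c ⟶ ((extObj T F G).obj d ⟶[V] L.obj c)} (h : IsLan M (extObj T F G) L ι) :
    Presents (WtFam.outer (S' := Shape.ofCat V A) (fun a c => (M.psh c).restrict (secR a))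
        (fun e c b => ((M.psh c).restrict (secL b)).act e.1 e.2)
        (fun a c c' b => M.ract (a, b) c c'))
      (Diag.outer (fun a => G.comp V ((secR (F.obj a)).comp V T))
        (fun e b => whR T (F.map e.1 e.2) (G.obj b))) L (fun p c => ι (p.2, p.1) c) :=
  h.presents_ext.swap.congr (by
    rintro (e | e) c
    · rfl
    · rfl) (by
    rintro (e | e)
    · exact whL_eq_map T _ _
    · rfl)

end TwoVariables

/-! ### The co-Yoneda lemma. -/

section CoYoneda

variable {A : Type u} [EnrichedCategory V A] {X : Type u₁} [EnrichedCategory V X]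

variable (V A) in
/-- The hom-objects of `A` as weights. -/
@[reducible]
def WtFam.hom : WtFam ((Shape.point.{u} V).prod (Shape.ofCat V A)) A where
  obj p a := p.2 ⟶[V] a
  act
    | .inl e, _ => nomatch e.1
    | .inr e, a => eComp V e.2.1 e.2.2 a
  ract p a a' := eComp V p.2 a a'

/-- The diagram underlying a `V`-functor. -/
@[reducible]
def Diag.ofFunctor (F : EnrichedFunctor V A X) :
    Diag ((Shape.point.{u} V).prod (Shape.ofCat V A)) X where
  obj p := F.obj p.2
  map
    | .inl e => nomatch e.1
    | .inr e => F.map e.2.1 e.2.2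

/-- A cocone is recovered from its value at the identity of `c`. The weights here are the codomains
of the unit constraints of a promonoidal category, which is why `F` is the target of the Day
unitors. -/
theorem presents_coYoneda (F : EnrichedFunctor V A X) :
    Presents (WtFam.hom V A) (Diag.ofFunctor F) F (fun p a => F.map p.2 a) where
  nat := by
    rintro (⟨e, _⟩ | ⟨_, a, a'⟩) c
    · exact nomatch e
    · exact F.map_comp a a' c
  existsUnique c v x t ht := by
    have ht' : ∀ a a', eComp V a a' c ▷ v ≫ t (PUnit.unit, a) =
        (α_ _ _ _).hom ≫ (F.map a a' ⨟ t (PUnit.unit, a')) :=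
      fun a a' => ht (.inr (PUnit.unit, (a, a')))
    refine ⟨(λ_ v).inv ≫ eId V c ▷ v ≫ t (PUnit.unit, c), ?_, ?_⟩
    · rintro ⟨⟨⟩, a⟩
      change F.map a c ⨟ ((λ_ v).inv ≫ eId V c ▷ v ≫ t (PUnit.unit, c)) = t (PUnit.unit, a)
      have e := ht' a c
      rw [ecmp_comp, ecmp_comp, ← Iso.inv_hom_id_assoc (α_ _ _ _) (F.map a c ⨟ _), ← e,
        associator_inv_naturality_middle_assoc, ← comp_whiskerRight_assoc, comp_eId']
      simp
    · intro g hg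
      have e : F.map c c ⨟ g = t (PUnit.unit, c) := hg (PUnit.unit, c)
      rw [← e, ← comp_ecmp, F.map_id, eId_ecmp, Iso.inv_hom_id_assoc]
  ract p c c' := (F.map_comp p.2 c c').symm

end CoYoneda

/-! ### Coprojections of extensions are natural in the extended functor. -/

section

variable {A : Type u} [EnrichedCategory V A] {B : Type u} [EnrichedCategory V B]
  {C : Type u} [EnrichedCategory V C] {D : Type u} [EnrichedCategory V D]
  {X : Type u₁} [EnrichedCategory V X] {Y : Type u₂} [EnrichedCategory V Y]

theorem IsLan.ext {M : VMod V C D} {F : EnrichedFunctor V D X} {L : EnrichedFunctor V C X}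
    {ι : ∀ d c, M.obj d c ⟶ (F.obj d ⟶[V] L.obj c)} (h : IsLan M F L ι) {c : C} {v : V} {x : X}
    {f g : v ⟶ (L.obj c ⟶[V] x)} (e : ∀ d, ι d c ⨟ f = ι d c ⨟ g) : f = g :=
  (h.isColim c).hom_ext e

variable [MonoidalClosed V] [Limits.HasProducts.{u} V] [Limits.HasEqualizers V]

theorem sq_lanι (M : VMod V C D) {F G : EnrichedFunctor V D X} (hF : ∀ c, Colim (M.psh c) F)
    (hG : ∀ c, Colim (M.psh c) G) {p : V} (k : p ⟶ (F ⟶[V] G)) (c : C) (d : D) :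
    Sq (lanι M F hF c d) (k ≫ lanHomApp M hF hG c) (k ≫ proj F G d) (lanι M G hG c d) := by
  rw [Sq, ecmp_comp, lanι_lanHomApp, braiding_naturality_right_assoc, comp_ecmp]

theorem sq_existsι (K : VMod V B A) (hK : ∀ (F : EnrichedFunctor V A X) (b : B), Colim (K.psh b) F)
    {F G : EnrichedFunctor V A X} {p : V} (k : p ⟶ (F ⟶[V] G)) (a : A) (b : B) :
    Sq (existsι K hK F a b) ((k ≫ (existsK K hK).map F G) ≫ proj _ _ b) (k ≫ proj F G a)
      (existsι K hK G a b) := by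
  have e : (k ≫ (existsK K hK).map F G) ≫ proj _ _ b = k ≫ lanHomApp K (hK F) (hK G) b := by
    change (k ≫ (𝟙 _ ≫ lanHom K (hK F) (hK G))) ≫ proj _ _ b = _
    rw [Category.id_comp, Category.assoc]
    exact congrArg (k ≫ ·) (lanHom_proj K (hK F) (hK G) b)
  rw [e]
  exact sq_lanι K (hF := hK F) (hG := hK G) k b a

theorem isLan_existsK (K : VMod V B A)
    (hK : ∀ (F : EnrichedFunctor V A X) (b : B), Colim (K.psh b) F) (F : EnrichedFunctor V A X) :
    IsLan K F ((existsK K hK).obj F) (fun a b => existsι K hK F a b) :=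
  isLan_lanObj K F (hK F)

end

/-! ### Composite coprojections factor through coends. -/

section Coprojections

open Limits

variable [MonoidalClosed V] [HasCoproducts.{u} V] [HasCoequalizers V]
  {C : Type u} [EnrichedCategory V C] {X : Type u₁} [EnrichedCategory V X]

/-- The composites `q u ⨟ r u` are balanced because `Φ.map u u'` may be absorbed by `q` on the left
or by `r` on the right. -/
theorem exists_tens_ecmp (L : CoPsh V C) (N : Psh V C) {x z : X} (Φ : EnrichedFunctor V C X)
    (q : ∀ u, L.obj u ⟶ (x ⟶[V] Φ.obj u)) (r : ∀ u, N.obj u ⟶ (Φ.obj u ⟶[V] z))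
    (hq : ∀ u u', q u ⨟ Φ.map u u' = L.act u u' ≫ q u')
    (hr : ∀ u u', N.act u u' ≫ r u = Φ.map u u' ⨟ r u') :
    ∃ θ : tens L N ⟶ (x ⟶[V] z), ∀ u, tensι L N u ≫ θ = q u ⨟ r u :=
  exists_tens _ fun u u' => by
    rw [← comp_ecmp, ← hq, ecmp_assoc, ← hr, ecmp_comp]

end Coprojections

/-! ### Actions on the two sides of the promonoidal associativity. -/

section Promonoidal

open Limits

variable [MonoidalClosed V] [HasCoproducts.{u} V] [HasCoequalizers V]
  {A : Type u} [EnrichedCategory V A] (p : Promonoidal V A)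

namespace Promonoidal

/-- The action of `A(a, a')` on `∫^u P(a₂, a₃, u) ⊗ P(a₁, u, a)`. -/
def rAct (a₁ a₂ a₃ a a' : A) :
    rightComp p.P a₁ a₂ a₃ a ⊗ (a ⟶[V] a') ⟶ rightComp p.P a₁ a₂ a₃ a' :=
  (p.assoc_nat a₁ a₂ a₃ a a').choose

/-- The action of `A(a₁', a₁)` on `∫^u P(a₂, a₃, u) ⊗ P(a₁, u, a)`. -/
def rAct₁ (a₁' a₁ a₂ a₃ a : A) :
    (a₁' ⟶[V] a₁) ⊗ rightComp p.P a₁ a₂ a₃ a ⟶ rightComp p.P a₁' a₂ a₃ a :=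
  (p.assoc_nat₁ a₁' a₁ a₂ a₃ a).choose

/-- The action of `A(a₂', a₂)` on `∫^u P(a₂, a₃, u) ⊗ P(a₁, u, a)`. -/
def rAct₂ (a₁ a₂' a₂ a₃ a : A) :
    (a₂' ⟶[V] a₂) ⊗ rightComp p.P a₁ a₂ a₃ a ⟶ rightComp p.P a₁ a₂' a₃ a :=
  (p.assoc_nat₂ a₁ a₂' a₂ a₃ a).choose

/-- The action of `A(a₃', a₃)` on `∫^u P(a₂, a₃, u) ⊗ P(a₁, u, a)`. -/
def rAct₃ (a₁ a₂ a₃' a₃ a : A) :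
    (a₃' ⟶[V] a₃) ⊗ rightComp p.P a₁ a₂ a₃ a ⟶ rightComp p.P a₁ a₂ a₃' a :=
  (p.assoc_nat₃ a₁ a₂ a₃' a₃ a).choose

theorem rightι_rAct (a₁ a₂ a₃ a a' u : A) :
    rightι p.P a₁ a₂ a₃ a u ▷ _ ≫ p.rAct a₁ a₂ a₃ a a' =
      (α_ _ _ _).hom ≫ _ ◁ p.P.ract (a₁, u) a a' ≫ rightι p.P a₁ a₂ a₃ a' u :=
  (p.assoc_nat a₁ a₂ a₃ a a').choose_spec.1 u

theorem rightι_rAct₁ (a₁' a₁ a₂ a₃ a u : A) :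
    _ ◁ rightι p.P a₁ a₂ a₃ a u ≫ p.rAct₁ a₁' a₁ a₂ a₃ a =
      lcomm _ _ _ ≫ _ ◁ p.P.act₁ a₁' a₁ u a ≫ rightι p.P a₁' a₂ a₃ a u :=
  (p.assoc_nat₁ a₁' a₁ a₂ a₃ a).choose_spec.1 u

theorem rightι_rAct₂ (a₁ a₂' a₂ a₃ a u : A) :
    _ ◁ rightι p.P a₁ a₂ a₃ a u ≫ p.rAct₂ a₁ a₂' a₂ a₃ a =
      (α_ _ _ _).inv ≫ p.P.act₁ a₂' a₂ a₃ u ▷ _ ≫ rightι p.P a₁ a₂' a₃ a u :=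
  (p.assoc_nat₂ a₁ a₂' a₂ a₃ a).choose_spec.1 u

theorem rightι_rAct₃ (a₁ a₂ a₃' a₃ a u : A) :
    _ ◁ rightι p.P a₁ a₂ a₃ a u ≫ p.rAct₃ a₁ a₂ a₃' a₃ a =
      (α_ _ _ _).inv ≫ p.P.act₂ a₂ a₃' a₃ u ▷ _ ≫ rightι p.P a₁ a₂ a₃' a u :=
  (p.assoc_nat₃ a₁ a₂ a₃' a₃ a).choose_spec.1 u

/-- The action of `A(a, a')` on `∫^u P(a₁, a₂, u) ⊗ P(u, a₃, a)`. -/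
def lAct (a₁ a₂ a₃ a a' : A) :
    leftComp p.P a₁ a₂ a₃ a ⊗ (a ⟶[V] a') ⟶ leftComp p.P a₁ a₂ a₃ a' :=
  (p.assoc a₁ a₂ a₃ a).hom ▷ _ ≫ p.rAct a₁ a₂ a₃ a a' ≫ (p.assoc a₁ a₂ a₃ a').inv

/-- The action of `A(a₁', a₁)` on `∫^u P(a₁, a₂, u) ⊗ P(u, a₃, a)`. -/
def lAct₁ (a₁' a₁ a₂ a₃ a : A) :
    (a₁' ⟶[V] a₁) ⊗ leftComp p.P a₁ a₂ a₃ a ⟶ leftComp p.P a₁' a₂ a₃ a :=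
  _ ◁ (p.assoc a₁ a₂ a₃ a).hom ≫ p.rAct₁ a₁' a₁ a₂ a₃ a ≫ (p.assoc a₁' a₂ a₃ a).inv

/-- The action of `A(a₂', a₂)` on `∫^u P(a₁, a₂, u) ⊗ P(u, a₃, a)`. -/
def lAct₂ (a₁ a₂' a₂ a₃ a : A) :
    (a₂' ⟶[V] a₂) ⊗ leftComp p.P a₁ a₂ a₃ a ⟶ leftComp p.P a₁ a₂' a₃ a :=
  _ ◁ (p.assoc a₁ a₂ a₃ a).hom ≫ p.rAct₂ a₁ a₂' a₂ a₃ a ≫ (p.assoc a₁ a₂' a₃ a).inv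

/-- The action of `A(a₃', a₃)` on `∫^u P(a₁, a₂, u) ⊗ P(u, a₃, a)`. -/
def lAct₃ (a₁ a₂ a₃' a₃ a : A) :
    (a₃' ⟶[V] a₃) ⊗ leftComp p.P a₁ a₂ a₃ a ⟶ leftComp p.P a₁ a₂ a₃' a :=
  _ ◁ (p.assoc a₁ a₂ a₃ a).hom ≫ p.rAct₃ a₁ a₂ a₃' a₃ a ≫ (p.assoc a₁ a₂ a₃' a).inv

/-- The action `lAct` is transported from the right-hand coend, so it commutes with the
associativity isomorphism by construction. Naturality of that isomorphism is what shows it to be the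
expected action on the left-hand coprojections; the same holds for `lAct₁`, `lAct₂` and `lAct₃`. -/
theorem leftι_lAct (a₁ a₂ a₃ a a' u : A) :
    leftι p.P a₁ a₂ a₃ a u ▷ _ ≫ p.lAct a₁ a₂ a₃ a a' =
      (α_ _ _ _).hom ≫ _ ◁ p.P.ract (u, a₃) a a' ≫ leftι p.P a₁ a₂ a₃ a' u := by
  have h := (p.assoc_nat a₁ a₂ a₃ a a').choose_spec.2 u
  rw [PromonoidalData.assocι, comp_whiskerRight, Category.assoc] at h
  rw [lAct, ← Category.assoc, ← Category.assoc, Iso.comp_inv_eq, Category.assoc]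
  exact h.trans (by simp [PromonoidalData.assocι])

theorem leftι_lAct₁ (a₁' a₁ a₂ a₃ a u : A) :
    _ ◁ leftι p.P a₁ a₂ a₃ a u ≫ p.lAct₁ a₁' a₁ a₂ a₃ a =
      (α_ _ _ _).inv ≫ p.P.act₁ a₁' a₁ a₂ u ▷ _ ≫ leftι p.P a₁' a₂ a₃ a u := by
  have h := (p.assoc_nat₁ a₁' a₁ a₂ a₃ a).choose_spec.2 u
  rw [PromonoidalData.assocι, MonoidalCategory.whiskerLeft_comp, Category.assoc] at h
  rw [lAct₁, ← Category.assoc, ← Category.assoc, Iso.comp_inv_eq, Category.assoc]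
  exact h.trans (by simp [PromonoidalData.assocι])

theorem leftι_lAct₂ (a₁ a₂' a₂ a₃ a u : A) :
    _ ◁ leftι p.P a₁ a₂ a₃ a u ≫ p.lAct₂ a₁ a₂' a₂ a₃ a =
      (α_ _ _ _).inv ≫ p.P.act₂ a₁ a₂' a₂ u ▷ _ ≫ leftι p.P a₁ a₂' a₃ a u := by
  have h := (p.assoc_nat₂ a₁ a₂' a₂ a₃ a).choose_spec.2 u
  rw [PromonoidalData.assocι, MonoidalCategory.whiskerLeft_comp, Category.assoc] at h
  rw [lAct₂, ← Category.assoc, ← Category.assoc, Iso.comp_inv_eq, Category.assoc]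
  exact h.trans (by simp [PromonoidalData.assocι])

theorem leftι_lAct₃ (a₁ a₂ a₃' a₃ a u : A) :
    _ ◁ leftι p.P a₁ a₂ a₃ a u ≫ p.lAct₃ a₁ a₂ a₃' a₃ a =
      lcomm _ _ _ ≫ _ ◁ p.P.act₂ u a₃' a₃ a ≫ leftι p.P a₁ a₂ a₃' a u := by
  have h := (p.assoc_nat₃ a₁ a₂ a₃' a₃ a).choose_spec.2 u
  rw [PromonoidalData.assocι, MonoidalCategory.whiskerLeft_comp, Category.assoc] at h
  rw [lAct₃, ← Category.assoc, ← Category.assoc, Iso.comp_inv_eq, Category.assoc]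
  exact h.trans (by simp [PromonoidalData.assocι])

end Promonoidal

end Promonoidal

/-! ### Coprojections of the Day convolution and their naturality. -/

section Day

open Limits

variable [MonoidalClosed V] [HasProducts.{u} V] [HasEqualizers V] [HasCoproducts.{u} V]
  [HasCoequalizers V]
  {A : Type u} [EnrichedCategory V A] {X : Type u₁} [EnrichedCategory V X]
  {p : Promonoidal V A} {T : EnrichedFunctor V (X × X) X} {e : X} (d : DayColimits p T e)

theorem isLan_day (F G : EnrichedFunctor V A X) :
    IsLan p.P (extObj T F G) ((dayTensor d).obj (F, G)) (fun q a => dayη d F G q.1 q.2 a) :=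
  isLan_lanObj p.P _ (d.tensor (F, G))

theorem isLan_dayUnit : IsLan p.J (pointFunctor e) (dayUnit d) (fun _ a => dayν d a) :=
  isLan_lanObj p.J _ d.unit

/-- The Day tensor acts on hom-objects through the external tensor product followed by extension
along `P`; so this is `sq_lanι` for the element `f ⊗ g` of the external hom-object. -/
theorem sq_dayη {F F' G G' : EnrichedFunctor V A X} {r s : V} (f : r ⟶ (F ⟶[V] F'))
    (g : s ⟶ (G ⟶[V] G')) (a₁ a₂ a : A) :
    Sq (dayη d F G a₁ a₂ a) (mapPair (dayTensor d) f g ≫ proj _ _ a)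
      (mapPair T (f ≫ proj _ _ a₁) (g ≫ proj _ _ a₂)) (dayη d F' G' a₁ a₂ a) := by
  have e1 : mapPair (dayTensor d) f g ≫ proj _ _ a =
      ((f ⊗ₘ g) ≫ extHom T F F' G G') ≫ lanHomApp p.P (d.tensor (F, G)) (d.tensor (F', G')) a := by
    change ((f ⊗ₘ g) ≫ (extHom T F F' G G' ≫ lanHom p.P _ _)) ≫ proj _ _ a = _
    rw [Category.assoc, Category.assoc]
    exact (congrArg (fun k => _ ≫ _ ≫ k) (lanHom_proj p.P (d.tensor (F, G)) (d.tensor (F', G'))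
      a)).trans (Category.assoc _ _ _).symm
  have e2 : mapPair T (f ≫ proj _ _ a₁) (g ≫ proj _ _ a₂) =
      ((f ⊗ₘ g) ≫ extHom T F F' G G') ≫ proj _ _ (a₁, a₂) := by
    rw [mapPair_comp, Category.assoc]
    exact congrArg ((f ⊗ₘ g) ≫ ·) (extHom_proj T F F' G G' (a₁, a₂)).symm
  rw [e1, e2]
  exact sq_lanι p.P (hF := d.tensor (F, G)) (hG := d.tensor (F', G')) _ a (a₁, a₂)

theorem sq_dayη_left {F F' : EnrichedFunctor V A X} {r : V} (f : r ⟶ (F ⟶[V] F'))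
    (G : EnrichedFunctor V A X) (a₁ a₂ a : A) :
    Sq (dayη d F G a₁ a₂ a) (whR (dayTensor d) f G ≫ proj _ _ a)
      (whR T (f ≫ proj _ _ a₁) (G.obj a₂)) (dayη d F' G a₁ a₂ a) := by
  have := (sq_dayη d f (eId V G) a₁ a₂ a).comp_right (ρ_ r).inv
  rw [eId_proj] at this
  rw [whR, Category.assoc]
  exact this

theorem sq_dayη_right (F : EnrichedFunctor V A X) {G G' : EnrichedFunctor V A X} {r : V}
    (f : r ⟶ (G ⟶[V] G')) (a₁ a₂ a : A) :
    Sq (dayη d F G a₁ a₂ a) (whL (dayTensor d) F f ≫ proj _ _ a)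
      (whL T (F.obj a₁) (f ≫ proj _ _ a₂)) (dayη d F G' a₁ a₂ a) := by
  have := (sq_dayη d (eId V F) f a₁ a₂ a).comp_right (λ_ r).inv
  rw [eId_proj] at this
  rw [whL, Category.assoc]
  exact this

theorem post_dayη_left {F F' : EnrichedFunctor V A X} (f : 𝟙_ V ⟶ (F ⟶[V] F'))
    (G : EnrichedFunctor V A X) (a₁ a₂ a : A) :
    post (dayη d F G a₁ a₂ a) (whR (dayTensor d) f G ≫ proj _ _ a) =
      pre (whR T (f ≫ proj _ _ a₁) (G.obj a₂)) (dayη d F' G a₁ a₂ a) :=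
  sq_unit_iff.1 (sq_dayη_left d f G a₁ a₂ a)

theorem post_dayη_right (F : EnrichedFunctor V A X) {G G' : EnrichedFunctor V A X}
    (f : 𝟙_ V ⟶ (G ⟶[V] G')) (a₁ a₂ a : A) :
    post (dayη d F G a₁ a₂ a) (whL (dayTensor d) F f ≫ proj _ _ a) =
      pre (whL T (F.obj a₁) (f ≫ proj _ _ a₂)) (dayη d F G' a₁ a₂ a) :=
  sq_unit_iff.1 (sq_dayη_right d F f a₁ a₂ a)

theorem dayη_ext {F G : EnrichedFunctor V A X} {a : A} {v : V} {x : X}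
    {f g : v ⟶ (((dayTensor d).obj (F, G)).obj a ⟶[V] x)}
    (h : ∀ a₁ a₂, dayη d F G a₁ a₂ a ⨟ f = dayη d F G a₁ a₂ a ⨟ g) : f = g :=
  (isLan_day d F G).ext fun q => h q.1 q.2

theorem dayη_ract (F G : EnrichedFunctor V A X) (a₁ a₂ a a' : A) :
    dayη d F G a₁ a₂ a ⨟ ((dayTensor d).obj (F, G)).map a a' =
      p.P.ract (a₁, a₂) a a' ≫ dayη d F G a₁ a₂ a' :=
  (isLan_day d F G).ract (a₁, a₂) a a'

theorem dayν_ract (a a' : A) :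
    dayν d a ⨟ (dayUnit d).map a a' = p.J.ract PUnit.unit a a' ≫ dayν d a' :=
  (isLan_dayUnit d).ract PUnit.unit a a'

theorem act₁_dayη (F G : EnrichedFunctor V A X) (a₁' a₁ a₂ a : A) :
    p.P.act₁ a₁' a₁ a₂ a ≫ dayη d F G a₁' a₂ a =
      whR T (F.map a₁' a₁) (G.obj a₂) ⨟ dayη d F G a₁ a₂ a :=
  (isLan_day d F G).presents_ext.nat (.inl ((a₁', a₁), a₂)) a

theorem act₂_dayη (F G : EnrichedFunctor V A X) (a₁ a₂' a₂ a : A) :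
    p.P.act₂ a₁ a₂' a₂ a ≫ dayη d F G a₁ a₂' a =
      whL T (F.obj a₁) (G.map a₂' a₂) ⨟ dayη d F G a₁ a₂ a :=
  (isLan_day d F G).presents_ext.nat (.inr (a₁, (a₂', a₂))) a

end Day

/-! ### Threefold Day convolutions and the associativity constraint. -/

section DayAssociator

open Limits

variable [MonoidalClosed V] [HasProducts.{u} V] [HasEqualizers V] [HasCoproducts.{u} V]
  [HasCoequalizers V]
  {A : Type u} [EnrichedCategory V A] {X : Type u₁} [EnrichedCategory V X]
  {p : Promonoidal V A} {T : EnrichedFunctor V (X × X) X} {e : X} (d : DayColimits p T e)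

theorem whR_map_nat {x : X} {F : EnrichedFunctor V A X} {u u' : A} {r s : V}
    {q : r ⟶ (x ⟶[V] F.obj u)} {q' : s ⟶ (x ⟶[V] F.obj u')} {k : r ⊗ (u ⟶[V] u') ⟶ s}
    (h : q ⨟ F.map u u' = k ≫ q') (y : X) :
    whR T q y ⨟ whR T (F.map u u') y = k ≫ whR T q' y := by
  rw [← whR_ecmp, h, comp_whR]

theorem whL_map_nat {x : X} {F : EnrichedFunctor V A X} {u u' : A} {r s : V}
    {q : r ⟶ (x ⟶[V] F.obj u)} {q' : s ⟶ (x ⟶[V] F.obj u')} {k : r ⊗ (u ⟶[V] u') ⟶ s}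
    (h : q ⨟ F.map u u' = k ≫ q') (y : X) :
    whL T y q ⨟ whL T y (F.map u u') = k ≫ whL T y q' := by
  rw [← whL_ecmp, h, comp_whL]

theorem exists_dayCoprojLeft (F G H : EnrichedFunctor V A X) (a₁ a₂ a₃ a : A) :
    ∃ θ : leftComp p.P a₁ a₂ a₃ a ⟶ (T.obj (T.obj (F.obj a₁, G.obj a₂), H.obj a₃) ⟶[V]
        ((dayTensor d).obj ((dayTensor d).obj (F, G), H)).obj a),
      ∀ u, leftι p.P a₁ a₂ a₃ a u ≫ θ =
        whR T (dayη d F G a₁ a₂ u) (H.obj a₃) ⨟ dayη d ((dayTensor d).obj (F, G)) H u a₃ a := by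
  refine exists_tens_ecmp (p.P.copsh (a₁, a₂)) ((p.P.psh a).restrict (secL a₃))
    (((dayTensor d).obj (F, G)).comp V ((secL (H.obj a₃)).comp V T))
    (fun u => whR T (dayη d F G a₁ a₂ u) (H.obj a₃))
    (fun u => dayη d ((dayTensor d).obj (F, G)) H u a₃ a) ?_ ?_
  · intro u u'
    have h := dayη_ract d F G a₁ a₂ u u'
    have e : (((dayTensor d).obj (F, G)).comp V ((secL (H.obj a₃)).comp V T)).map u u' =
      whR T (((dayTensor d).obj (F, G)).map u u') (H.obj a₃) := (whR_eq_map T _ _).symm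
    exact (congrArg (_ ⨟ ·) e).trans (whR_map_nat h (H.obj a₃))
  · exact fun u u' => (isLan_day d ((dayTensor d).obj (F, G)) H).presents_left.nat
      (.inl ((u, u'), a₃)) a

theorem exists_dayCoprojRight (F G H : EnrichedFunctor V A X) (a₁ a₂ a₃ a : A) :
    ∃ θ : rightComp p.P a₁ a₂ a₃ a ⟶ (T.obj (F.obj a₁, T.obj (G.obj a₂, H.obj a₃)) ⟶[V]
        ((dayTensor d).obj (F, (dayTensor d).obj (G, H))).obj a),
      ∀ u, rightι p.P a₁ a₂ a₃ a u ≫ θ =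
        whL T (F.obj a₁) (dayη d G H a₂ a₃ u) ⨟ dayη d F ((dayTensor d).obj (G, H)) a₁ u a := by
  refine exists_tens_ecmp (p.P.copsh (a₂, a₃)) ((p.P.psh a).restrict (secR a₁))
    (((dayTensor d).obj (G, H)).comp V ((secR (F.obj a₁)).comp V T))
    (fun u => whL T (F.obj a₁) (dayη d G H a₂ a₃ u))
    (fun u => dayη d F ((dayTensor d).obj (G, H)) a₁ u a) ?_ ?_
  · intro u u'
    have h := dayη_ract d G H a₂ a₃ u u'
    have e : (((dayTensor d).obj (G, H)).comp V ((secR (F.obj a₁)).comp V T)).map u u' =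
      whL T (F.obj a₁) (((dayTensor d).obj (G, H)).map u u') := (whL_eq_map T _ _).symm
    exact (congrArg (_ ⨟ ·) e).trans (whL_map_nat h (F.obj a₁))
  · exact fun u u' => (isLan_day d F ((dayTensor d).obj (G, H))).presents_right.nat
      (.inl ((u, u'), a₁)) a

/-- The coprojections of the threefold Day convolution, bracketed on the left. -/
def dayCoprojLeft (F G H : EnrichedFunctor V A X) (a₁ a₂ a₃ a : A) :
    leftComp p.P a₁ a₂ a₃ a ⟶ (T.obj (T.obj (F.obj a₁, G.obj a₂), H.obj a₃) ⟶[V]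
        ((dayTensor d).obj ((dayTensor d).obj (F, G), H)).obj a) :=
  (exists_dayCoprojLeft d F G H a₁ a₂ a₃ a).choose

/-- The coprojections of the threefold Day convolution, bracketed on the right. -/
def dayCoprojRight (F G H : EnrichedFunctor V A X) (a₁ a₂ a₃ a : A) :
    rightComp p.P a₁ a₂ a₃ a ⟶ (T.obj (F.obj a₁, T.obj (G.obj a₂, H.obj a₃)) ⟶[V]
        ((dayTensor d).obj (F, (dayTensor d).obj (G, H))).obj a) :=
  (exists_dayCoprojRight d F G H a₁ a₂ a₃ a).choose

theorem leftι_dayCoprojLeft (F G H : EnrichedFunctor V A X) (a₁ a₂ a₃ a u : A) :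
    leftι p.P a₁ a₂ a₃ a u ≫ dayCoprojLeft d F G H a₁ a₂ a₃ a =
      whR T (dayη d F G a₁ a₂ u) (H.obj a₃) ⨟ dayη d ((dayTensor d).obj (F, G)) H u a₃ a :=
  (exists_dayCoprojLeft d F G H a₁ a₂ a₃ a).choose_spec u

theorem rightι_dayCoprojRight (F G H : EnrichedFunctor V A X) (a₁ a₂ a₃ a u : A) :
    rightι p.P a₁ a₂ a₃ a u ≫ dayCoprojRight d F G H a₁ a₂ a₃ a =
      whL T (F.obj a₁) (dayη d G H a₂ a₃ u) ⨟ dayη d F ((dayTensor d).obj (G, H)) a₁ u a :=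
  (exists_dayCoprojRight d F G H a₁ a₂ a₃ a).choose_spec u

variable (p) in
/-- The weights of the threefold Day convolution, bracketed on the left. -/
@[reducible]
def leftWt : WtFam (((Shape.ofCat V A).prod (Shape.ofCat V A)).prod (Shape.ofCat V A)) A where
  obj q a := leftComp p.P q.1.1 q.1.2 q.2 a
  act
    | .inl (.inl e, a₃), a => p.lAct₁ e.1.1 e.1.2 e.2 a₃ a
    | .inl (.inr e, a₃), a => p.lAct₂ e.1 e.2.1 e.2.2 a₃ a
    | .inr (q, e), a => p.lAct₃ q.1 q.2 e.1 e.2 a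
  ract q a a' := p.lAct q.1.1 q.1.2 q.2 a a'

variable (p) in
/-- The weights of the threefold Day convolution, bracketed on the right. -/
@[reducible]
def rightWt : WtFam (((Shape.ofCat V A).prod (Shape.ofCat V A)).prod (Shape.ofCat V A)) A where
  obj q a := rightComp p.P q.1.1 q.1.2 q.2 a
  act
    | .inl (.inl e, a₃), a => p.rAct₁ e.1.1 e.1.2 e.2 a₃ a
    | .inl (.inr e, a₃), a => p.rAct₂ e.1 e.2.1 e.2.2 a₃ a
    | .inr (q, e), a => p.rAct₃ q.1 q.2 e.1 e.2 a
  ract q a a' := p.rAct q.1.1 q.1.2 q.2 a a'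

variable (T) in
/-- The diagram `(F a₁ ⊗ G a₂) ⊗ H a₃`. -/
@[reducible]
def leftDiag (F G H : EnrichedFunctor V A X) :
    Diag (((Shape.ofCat V A).prod (Shape.ofCat V A)).prod (Shape.ofCat V A)) X where
  obj q := T.obj (T.obj (F.obj q.1.1, G.obj q.1.2), H.obj q.2)
  map
    | .inl (.inl e, a₃) => whR T (whR T (F.map e.1.1 e.1.2) (G.obj e.2)) (H.obj a₃)
    | .inl (.inr e, a₃) => whR T (whL T (F.obj e.1) (G.map e.2.1 e.2.2)) (H.obj a₃)
    | .inr (q, e) => whL T (T.obj (F.obj q.1, G.obj q.2)) (H.map e.1 e.2)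

variable (T) in
/-- The diagram `F a₁ ⊗ (G a₂ ⊗ H a₃)`. -/
@[reducible]
def rightDiag (F G H : EnrichedFunctor V A X) :
    Diag (((Shape.ofCat V A).prod (Shape.ofCat V A)).prod (Shape.ofCat V A)) X where
  obj q := T.obj (F.obj q.1.1, T.obj (G.obj q.1.2, H.obj q.2))
  map
    | .inl (.inl e, a₃) => whR T (F.map e.1.1 e.1.2) (T.obj (G.obj e.2, H.obj a₃))
    | .inl (.inr e, a₃) => whL T (F.obj e.1) (whR T (G.map e.2.1 e.2.2) (H.obj a₃))
    | .inr (q, e) => whL T (F.obj q.1) (whL T (G.obj q.2) (H.map e.1 e.2))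

/-- The inner colimit is `F ∗ G`, kept a colimit by tensoring with `H a₃`; the outer one defines `(F
∗ G) ∗ H`, with `a₃` as parameter. The compatibility square between the stages is the interchange
law of `T`. -/
theorem presents_dayLeft (hL : ∀ x : X, PreservesColims.{w, u} ((secL x).comp V T))
    (F G H : EnrichedFunctor V A X) :
    Presents (leftWt p) (leftDiag T F G H) ((dayTensor d).obj ((dayTensor d).obj (F, G), H))
      (fun q a => dayCoprojLeft d F G H q.1.1 q.1.2 q.2 a) := by
  have hq := fun a₃ => (isLan_day d F G).presents_ext_comp (hL (H.obj a₃))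
  have hr := (isLan_day d ((dayTensor d).obj (F, G)) H).presents_left
  have key := Presents.coend (S := (Shape.ofCat V A).prod (Shape.ofCat V A))
    (S' := Shape.ofCat V A) (L := fun q => p.P.copsh q)
    (N := fun a₃ a => (p.P.psh a).restrict (secL a₃))
    (act₁ := fun e a₃ a => match e with
      | .inl e => p.lAct₁ e.1.1 e.1.2 e.2 a₃ a
      | .inr e => p.lAct₂ e.1 e.2.1 e.2.2 a₃ a)
    (act₂ := fun q e a => p.lAct₃ q.1 q.2 e.1 e.2 a)
    (ract := fun q a₃ a a' => p.lAct q.1 q.2 a₃ a a')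
    (mapY := fun q e => whL T (T.obj (F.obj q.1, G.obj q.2)) (H.map e.1 e.2))
    (Q := fun q a₃ a => dayCoprojLeft d F G H q.1 q.2 a₃ a)
    hq hr (by
      rintro (e | e) a₃ a u
      · exact p.leftι_lAct₁ _ _ _ _ _ u
      · exact p.leftι_lAct₂ _ _ _ _ _ u)
    (fun q e a u => p.leftι_lAct₃ _ _ _ _ _ u)
    (fun q a₃ a a' u => p.leftι_lAct _ _ _ _ _ u)
    (by
      intro q e u
      have := sq_whR_whL (T := T) (dayη d F G q.1 q.2 u) (H.map e.1 e.2)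
      rw [whR_eq_map, whR_eq_map] at this
      exact this)
    (by
      intro q a₃ a u
      have := leftι_dayCoprojLeft d F G H q.1 q.2 a₃ a u
      rw [whR_eq_map] at this
      exact this)
  refine key.congr ?_ ?_
  · rintro (⟨e | e, a₃⟩ | ⟨q, e⟩) a <;> rfl
  · rintro (⟨e | e, a₃⟩ | ⟨q, e⟩)
    · exact (whR_eq_map T _ _).symm
    · exact (whR_eq_map T _ _).symm
    · rfl

/-- Here the inner colimit is `G ∗ H`, tensored on the left with `F a₁`, and `a₁` is the parameter.
-/
theorem presents_dayRight (hR : ∀ x : X, PreservesColims.{w, u} ((secR x).comp V T))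
    (F G H : EnrichedFunctor V A X) :
    Presents (rightWt p) (rightDiag T F G H) ((dayTensor d).obj (F, (dayTensor d).obj (G, H)))
      (fun q a => dayCoprojRight d F G H q.1.1 q.1.2 q.2 a) := by
  have hq := fun a₁ => (isLan_day d G H).presents_ext_comp (hR (F.obj a₁))
  have hr := (isLan_day d F ((dayTensor d).obj (G, H))).presents_right
  have key := Presents.coend (S := (Shape.ofCat V A).prod (Shape.ofCat V A))
    (S' := Shape.ofCat V A) (L := fun q => p.P.copsh q)
    (N := fun a₁ a => (p.P.psh a).restrict (secR a₁))
    (act₁ := fun e a₁ a => match e with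
      | .inl e => p.rAct₂ a₁ e.1.1 e.1.2 e.2 a
      | .inr e => p.rAct₃ a₁ e.1 e.2.1 e.2.2 a)
    (act₂ := fun q e a => p.rAct₁ e.1 e.2 q.1 q.2 a)
    (ract := fun q a₁ a a' => p.rAct a₁ q.1 q.2 a a')
    (mapY := fun q e => whR T (F.map e.1 e.2) (T.obj (G.obj q.1, H.obj q.2)))
    (Q := fun q a₁ a => dayCoprojRight d F G H a₁ q.1 q.2 a)
    hq hr (by
      rintro (e | e) a₁ a u
      · exact p.rightι_rAct₂ _ _ _ _ _ u
      · exact p.rightι_rAct₃ _ _ _ _ _ u)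
    (fun q e a u => p.rightι_rAct₁ _ _ _ _ _ u)
    (fun q a₃ a a' u => p.rightι_rAct _ _ _ _ _ u)
    (by
      intro q e u
      have := (sq_whR_whL (T := T) (F.map e.1 e.2) (dayη d G H q.1 q.2 u)).symm
      rw [whL_eq_map, whL_eq_map] at this
      exact this)
    (by
      intro q a₁ a u
      have := rightι_dayCoprojRight d F G H a₁ q.1 q.2 a u
      rw [whL_eq_map] at this
      exact this)
  -- The vertices come out as `((a₂, a₃), a₁)`; they are reordered to `((a₁, a₂), a₃)` so as to
  -- match the left-hand presentation.
  refine key.swap.assoc.congr ?_ ?_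
  · rintro (⟨e | e, a₃⟩ | ⟨q, e⟩) a <;> rfl
  · rintro (⟨e | e, a₃⟩ | ⟨q, e⟩)
    · rfl
    · exact (whL_eq_map T _ _).symm
    · exact (whL_eq_map T _ _).symm

/-- Both bracketings are presented over the same graph. The promonoidal associativity compares the
weights and the associativity of X compares the diagrams; both are invertible and compatible with
the edges. -/
theorem exists_dayAssoc (mX : MonoidalConstraints T e)
    (hL : ∀ x : X, PreservesColims.{w, u} ((secL x).comp V T))
    (hR : ∀ x : X, PreservesColims.{w, u} ((secR x).comp V T))
    (F G H : EnrichedFunctor V A X) :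
    ∃ f : 𝟙_ V ⟶ ((dayTensor d).obj ((dayTensor d).obj (F, G), H) ⟶[V]
        (dayTensor d).obj (F, (dayTensor d).obj (G, H))),
      IsInvertible f ∧ ∀ a₁ a₂ a₃ a u,
        post (whR T (dayη d F G a₁ a₂ u) (H.obj a₃) ⨟ dayη d ((dayTensor d).obj (F, G)) H u a₃ a)
          (f ≫ proj _ _ a) =
        p.assocι a₁ a₂ a₃ a u ≫ pre (mX.assoc (F.obj a₁) (G.obj a₂) (H.obj a₃))
          (dayCoprojRight d F G H a₁ a₂ a₃ a) := by
  have hl := presents_dayLeft d hL F G H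
  have hr := presents_dayRight d hR F G H
  have hact : ∀ e a, (leftWt p).act e a ≫ (p.assoc _ _ _ a).hom =
      _ ◁ (p.assoc _ _ _ a).hom ≫ (rightWt p).act e a := by
    rintro (⟨e | e, a₃⟩ | ⟨q, e⟩) a
    · simp [Promonoidal.lAct₁]
    · simp [Promonoidal.lAct₂]
    · simp [Promonoidal.lAct₃]
  have hract : ∀ q a a', (leftWt p).ract q a a' ≫ (p.assoc _ _ _ a').hom =
      (p.assoc _ _ _ a).hom ▷ _ ≫ (rightWt p).ract q a a' := by
    intro q a a'
    simp [Promonoidal.lAct]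
  have hmap : ∀ e, post ((leftDiag T F G H).map e) (mX.assoc _ _ _) =
      pre (mX.assoc _ _ _) ((rightDiag T F G H).map e) := by
    rintro (⟨e | e, a₃⟩ | ⟨q, e⟩)
    · exact mX.assoc_nat_left _ _ _
    · exact mX.assoc_nat_middle _ _ _
    · exact mX.assoc_nat_right _ _ _
  obtain ⟨f, hf⟩ := hl.exists_hom (L' := (dayTensor d).obj (F, (dayTensor d).obj (G, H)))
    (fun q a => (p.assoc _ _ _ a).hom ≫ pre (mX.assoc _ _ _)
      (dayCoprojRight d F G H q.1.1 q.1.2 q.2 a)) (by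
      intro e a
      rw [reassoc_of% hact, ← comp_pre, hr.nat, ecmp_comp, ← pre_ecmp, ← hmap, post_ecmp]) (by
      intro q a a'
      rw [comp_ecmp, pre_ecmp, hr.ract, comp_pre, reassoc_of% hract])
  refine ⟨f, hl.isInvertible hr (fun q a => (p.assoc _ _ _ a).hom) (fun q => mX.assoc _ _ _)
    (fun q => mX.assoc_inv _ _ _) hact hract hmap hf, fun a₁ a₂ a₃ a u => ?_⟩
  have := congrArg (fun k => leftι p.P a₁ a₂ a₃ a u ≫ k) (hf ((a₁, a₂), a₃) a)
  rw [← comp_post, leftι_dayCoprojLeft] at this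
  rw [this, PromonoidalData.assocι, Category.assoc]

end DayAssociator

/-! ### The unit constraints of Day convolution. -/

section DayUnitors

open Limits

variable [MonoidalClosed V] [HasProducts.{u} V] [HasEqualizers V] [HasCoproducts.{u} V]
  [HasCoequalizers V]
  {A : Type u} [EnrichedCategory V A] {X : Type u₁} [EnrichedCategory V X]
  {p : Promonoidal V A} {T : EnrichedFunctor V (X × X) X} {e : X} (d : DayColimits p T e)

variable (p) in
/-- The coprojections of `∫^j J j ⊗ P(j, a₁, a)`. -/
def unitLeftι (a₁ a j : A) : p.Jo j ⊗ p.P.obj (j, a₁) a ⟶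
    tens (p.J.copsh PUnit.unit) ((p.P.psh a).restrict (secL a₁)) :=
  tensι (p.J.copsh PUnit.unit) ((p.P.psh a).restrict (secL a₁)) j

variable (p) in
/-- The coprojections of `∫^j J j ⊗ P(a₁, j, a)`. -/
def unitRightι (a₁ a j : A) : p.Jo j ⊗ p.P.obj (a₁, j) a ⟶
    tens (p.J.copsh PUnit.unit) ((p.P.psh a).restrict (secR a₁)) :=
  tensι (p.J.copsh PUnit.unit) ((p.P.psh a).restrict (secR a₁)) j

theorem unitLeftι_lunit (a₁ a j : A) :
    unitLeftι p a₁ a j ≫ (p.lunit a₁ a).hom = p.lunitι a₁ a j := rfl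

theorem unitRightι_runit (a₁ a j : A) :
    unitRightι p a₁ a j ≫ (p.runit a₁ a).hom = p.runitι a₁ a j := rfl

/-- Composition in `A`, transported along the unit isomorphism, gives the action on the coend;
`lunit_nat₁` identifies it on coprojections. The three companions use the other naturality axioms of
the unit constraints. -/
theorem unitLeftι_lact (a₁' a₁ a j : A) :
    _ ◁ unitLeftι p a₁ a j ≫
        (_ ◁ (p.lunit a₁ a).hom ≫ eComp V a₁' a₁ a ≫ (p.lunit a₁' a).inv) =
      lcomm _ _ _ ≫ _ ◁ p.P.act₂ j a₁' a₁ a ≫ unitLeftι p a₁' a j := by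
  have h := p.lunit_nat₁ a₁' a₁ a j
  rw [← unitLeftι_lunit, MonoidalCategory.whiskerLeft_comp, Category.assoc] at h
  rw [← Category.assoc, ← Category.assoc, Iso.comp_inv_eq, Category.assoc, h, ← unitLeftι_lunit]
  simp

theorem unitLeftι_ract (a₁ a a' j : A) :
    unitLeftι p a₁ a j ▷ _ ≫
        ((p.lunit a₁ a).hom ▷ _ ≫ eComp V a₁ a a' ≫ (p.lunit a₁ a').inv) =
      (α_ _ _ _).hom ≫ _ ◁ p.P.ract (j, a₁) a a' ≫ unitLeftι p a₁ a' j := by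
  have h := p.lunit_nat a₁ a a' j
  rw [← unitLeftι_lunit, comp_whiskerRight, Category.assoc] at h
  rw [← Category.assoc, ← Category.assoc, Iso.comp_inv_eq, Category.assoc, h, ← unitLeftι_lunit]
  simp

theorem unitRightι_lact (a₁' a₁ a j : A) :
    _ ◁ unitRightι p a₁ a j ≫
        (_ ◁ (p.runit a₁ a).hom ≫ eComp V a₁' a₁ a ≫ (p.runit a₁' a).inv) =
      lcomm _ _ _ ≫ _ ◁ p.P.act₁ a₁' a₁ j a ≫ unitRightι p a₁' a j := by
  have h := p.runit_nat₁ a₁' a₁ a j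
  rw [← unitRightι_runit, MonoidalCategory.whiskerLeft_comp, Category.assoc] at h
  rw [← Category.assoc, ← Category.assoc, Iso.comp_inv_eq, Category.assoc, h, ← unitRightι_runit]
  simp

theorem unitRightι_ract (a₁ a a' j : A) :
    unitRightι p a₁ a j ▷ _ ≫
        ((p.runit a₁ a).hom ▷ _ ≫ eComp V a₁ a a' ≫ (p.runit a₁ a').inv) =
      (α_ _ _ _).hom ≫ _ ◁ p.P.ract (a₁, j) a a' ≫ unitRightι p a₁ a' j := by
  have h := p.runit_nat a₁ a a' j
  rw [← unitRightι_runit, comp_whiskerRight, Category.assoc] at h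
  rw [← Category.assoc, ← Category.assoc, Iso.comp_inv_eq, Category.assoc, h, ← unitRightι_runit]
  simp

theorem exists_dayCoprojUnitLeft (F : EnrichedFunctor V A X) (a₁ a : A) :
    ∃ θ : tens (p.J.copsh PUnit.unit) ((p.P.psh a).restrict (secL a₁)) ⟶
        (T.obj (e, F.obj a₁) ⟶[V] ((dayTensor d).obj (dayUnit d, F)).obj a),
      ∀ j, unitLeftι p a₁ a j ≫ θ =
        whR T (dayν d j) (F.obj a₁) ⨟ dayη d (dayUnit d) F j a₁ a := by
  refine exists_tens_ecmp (p.J.copsh PUnit.unit) ((p.P.psh a).restrict (secL a₁))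
    ((dayUnit d).comp V ((secL (F.obj a₁)).comp V T))
    (fun j => whR T (dayν d j) (F.obj a₁)) (fun j => dayη d (dayUnit d) F j a₁ a) ?_ ?_
  · intro j j'
    have h := dayν_ract d j j'
    have e : ((dayUnit d).comp V ((secL (F.obj a₁)).comp V T)).map j j' =
      whR T ((dayUnit d).map j j') (F.obj a₁) := (whR_eq_map T _ _).symm
    exact (congrArg (_ ⨟ ·) e).trans (whR_map_nat h (F.obj a₁))
  · exact fun j j' => (isLan_day d (dayUnit d) F).presents_left.nat (.inl ((j, j'), a₁)) a

theorem exists_dayCoprojUnitRight (F : EnrichedFunctor V A X) (a₁ a : A) :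
    ∃ θ : tens (p.J.copsh PUnit.unit) ((p.P.psh a).restrict (secR a₁)) ⟶
        (T.obj (F.obj a₁, e) ⟶[V] ((dayTensor d).obj (F, dayUnit d)).obj a),
      ∀ j, unitRightι p a₁ a j ≫ θ =
        whL T (F.obj a₁) (dayν d j) ⨟ dayη d F (dayUnit d) a₁ j a := by
  refine exists_tens_ecmp (p.J.copsh PUnit.unit) ((p.P.psh a).restrict (secR a₁))
    ((dayUnit d).comp V ((secR (F.obj a₁)).comp V T))
    (fun j => whL T (F.obj a₁) (dayν d j)) (fun j => dayη d F (dayUnit d) a₁ j a) ?_ ?_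
  · intro j j'
    have h := dayν_ract d j j'
    have e : ((dayUnit d).comp V ((secR (F.obj a₁)).comp V T)).map j j' =
      whL T (F.obj a₁) ((dayUnit d).map j j') := (whL_eq_map T _ _).symm
    exact (congrArg (_ ⨟ ·) e).trans (whL_map_nat h (F.obj a₁))
  · exact fun j j' => (isLan_day d F (dayUnit d)).presents_right.nat (.inl ((j, j'), a₁)) a

variable (p) in
/-- The weights `∫^j J j ⊗ P(j, a₁, a)`. -/
@[reducible]
def unitLeftWt : WtFam ((Shape.point.{u} V).prod (Shape.ofCat V A)) A where
  obj q a := tens (p.J.copsh PUnit.unit) ((p.P.psh a).restrict (secL q.2))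
  act
    | .inl e, _ => nomatch e.1
    | .inr e, a => _ ◁ (p.lunit e.2.2 a).hom ≫ eComp V e.2.1 e.2.2 a ≫ (p.lunit e.2.1 a).inv
  ract q a a' := (p.lunit q.2 a).hom ▷ _ ≫ eComp V q.2 a a' ≫ (p.lunit q.2 a').inv

variable (p) in
/-- The weights `∫^j J j ⊗ P(a₁, j, a)`. -/
@[reducible]
def unitRightWt : WtFam ((Shape.point.{u} V).prod (Shape.ofCat V A)) A where
  obj q a := tens (p.J.copsh PUnit.unit) ((p.P.psh a).restrict (secR q.2))
  act
    | .inl e, _ => nomatch e.1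
    | .inr e, a => _ ◁ (p.runit e.2.2 a).hom ≫ eComp V e.2.1 e.2.2 a ≫ (p.runit e.2.1 a).inv
  ract q a a' := (p.runit q.2 a).hom ▷ _ ≫ eComp V q.2 a a' ≫ (p.runit q.2 a').inv

variable (T e) in
/-- The diagram `e ⊗ F a₁`. -/
@[reducible]
def unitLeftDiag (F : EnrichedFunctor V A X) :
    Diag ((Shape.point.{u} V).prod (Shape.ofCat V A)) X where
  obj q := T.obj (e, F.obj q.2)
  map
    | .inl e => nomatch e.1
    | .inr q => whL T e (F.map q.2.1 q.2.2)

variable (T e) in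
/-- The diagram `F a₁ ⊗ e`. -/
@[reducible]
def unitRightDiag (F : EnrichedFunctor V A X) :
    Diag ((Shape.point.{u} V).prod (Shape.ofCat V A)) X where
  obj q := T.obj (F.obj q.2, e)
  map
    | .inl e => nomatch e.1
    | .inr q => whR T (F.map q.2.1 q.2.2) e

/-- The unit is a colimit over the one-vertex graph, so the inner diagram is the single object `e ⊗
F a₁` and only `a₁` survives as an index. -/
theorem presents_dayUnitLeft (hL : ∀ x : X, PreservesColims.{w, u} ((secL x).comp V T))
    (F : EnrichedFunctor V A X) :
    Presents (unitLeftWt p) (unitLeftDiag T e F) ((dayTensor d).obj (dayUnit d, F))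
      (fun q a => (exists_dayCoprojUnitLeft d F q.2 a).choose) := by
  have hq := fun a₁ => ((isLan_dayUnit d).comp (hL (F.obj a₁))).presents_point
  have hr := (isLan_day d (dayUnit d) F).presents_left
  have key := Presents.coend (S := Shape.point.{u} V)
    (S' := Shape.ofCat V A) (L := fun q => p.J.copsh q)
    (N := fun a₃ a => (p.P.psh a).restrict (secL a₃))
    (act₁ := fun e => nomatch e)
    (act₂ := fun q e a =>
      _ ◁ (p.lunit e.2 a).hom ≫ eComp V e.1 e.2 a ≫ (p.lunit e.1 a).inv)
    (ract := fun q a₁ a a' => (p.lunit a₁ a).hom ▷ _ ≫ eComp V a₁ a a' ≫ (p.lunit a₁ a').inv)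
    (mapY := fun _ q => whL T e (F.map q.1 q.2))
    (Q := fun _ a₁ a => (exists_dayCoprojUnitLeft d F a₁ a).choose)
    hq hr (fun e => nomatch e)
    (fun _ e a j => unitLeftι_lact e.1 e.2 a j)
    (fun _ a₁ a a' j => unitLeftι_ract a₁ a a' j)
    (by
      intro q e u
      have := sq_whR_whL (T := T) (dayν d u) (F.map e.1 e.2)
      rw [whR_eq_map, whR_eq_map] at this
      exact this)
    (by
      intro q a₃ a j
      have := (exists_dayCoprojUnitLeft d F a₃ a).choose_spec j
      rw [whR_eq_map] at this
      exact this)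
  refine key.congr ?_ ?_
  · rintro (⟨e, _⟩ | ⟨q, e⟩) a
    · exact nomatch e
    · rfl
  · rintro (⟨e, _⟩ | ⟨q, e⟩)
    · exact nomatch e
    · rfl

theorem presents_dayUnitRight (hR : ∀ x : X, PreservesColims.{w, u} ((secR x).comp V T))
    (F : EnrichedFunctor V A X) :
    Presents (unitRightWt p) (unitRightDiag T e F) ((dayTensor d).obj (F, dayUnit d))
      (fun q a => (exists_dayCoprojUnitRight d F q.2 a).choose) := by
  have hq := fun a₁ => ((isLan_dayUnit d).comp (hR (F.obj a₁))).presents_point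
  have hr := (isLan_day d F (dayUnit d)).presents_right
  have key := Presents.coend (S := Shape.point.{u} V)
    (S' := Shape.ofCat V A) (L := fun q => p.J.copsh q)
    (N := fun a₃ a => (p.P.psh a).restrict (secR a₃))
    (act₁ := fun e => nomatch e)
    (act₂ := fun q e a =>
      _ ◁ (p.runit e.2 a).hom ≫ eComp V e.1 e.2 a ≫ (p.runit e.1 a).inv)
    (ract := fun q a₁ a a' => (p.runit a₁ a).hom ▷ _ ≫ eComp V a₁ a a' ≫ (p.runit a₁ a').inv)
    (mapY := fun _ q => whR T (F.map q.1 q.2) e)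
    (Q := fun _ a₁ a => (exists_dayCoprojUnitRight d F a₁ a).choose)
    hq hr (fun e => nomatch e)
    (fun _ e a j => unitRightι_lact e.1 e.2 a j)
    (fun _ a₁ a a' j => unitRightι_ract a₁ a a' j)
    (by
      intro q e u
      have := (sq_whR_whL (T := T) (F.map e.1 e.2) (dayν d u)).symm
      rw [whL_eq_map, whL_eq_map] at this
      exact this)
    (by
      intro q a₃ a j
      have := (exists_dayCoprojUnitRight d F a₃ a).choose_spec j
      rw [whL_eq_map] at this
      exact this)
  refine key.congr ?_ ?_
  · rintro (⟨e, _⟩ | ⟨q, e⟩) a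
    · exact nomatch e
    · rfl
  · rintro (⟨e, _⟩ | ⟨q, e⟩)
    · exact nomatch e
    · rfl

/-- The promonoidal unit isomorphism compares the weights with the hom-objects, and the unit
constraint of X compares `e ⊗ F a₁` with `F a₁`; the co-Yoneda lemma identifies the resulting
colimit with `F`. -/
theorem exists_dayLunit (mX : MonoidalConstraints T e)
    (hL : ∀ x : X, PreservesColims.{w, u} ((secL x).comp V T)) (F : EnrichedFunctor V A X) :
    ∃ f : 𝟙_ V ⟶ ((dayTensor d).obj (dayUnit d, F) ⟶[V] F), IsInvertible f ∧ ∀ a₁ a j,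
      post (whR T (dayν d j) (F.obj a₁) ⨟ dayη d (dayUnit d) F j a₁ a) (f ≫ proj _ _ a) =
        p.lunitι a₁ a j ≫ pre (mX.lunit (F.obj a₁)) (F.map a₁ a) := by
  have hl := presents_dayUnitLeft d hL F
  have hr := presents_coYoneda F
  have hact : ∀ e a, (unitLeftWt p).act e a ≫ (p.lunit _ a).hom =
      _ ◁ (p.lunit _ a).hom ≫ (WtFam.hom V A).act e a := by
    rintro (⟨e, _⟩ | ⟨q, e⟩) a
    · exact nomatch e
    · simp
  have hract : ∀ q a a', (unitLeftWt p).ract q a a' ≫ (p.lunit _ a').hom =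
      (p.lunit _ a).hom ▷ _ ≫ (WtFam.hom V A).ract q a a' := by
    intro q a a'
    simp
  have hmap : ∀ q, post ((unitLeftDiag T e F).map q) (mX.lunit _) =
      pre (mX.lunit _) ((Diag.ofFunctor F).map q) := by
    rintro (⟨e, _⟩ | ⟨q, e⟩)
    · exact nomatch e
    · exact mX.lunit_nat' _
  obtain ⟨f, hf⟩ := hl.exists_hom (L' := F)
    (fun q a => (p.lunit _ a).hom ≫ pre (mX.lunit _) (F.map q.2 a)) (by
      intro e a
      rw [reassoc_of% hact, ← comp_pre, hr.nat, ecmp_comp, ← pre_ecmp, ← hmap, post_ecmp]) (by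
      intro q a a'
      rw [comp_ecmp, pre_ecmp, hr.ract, comp_pre]
      have := congrArg (· ≫ pre (mX.lunit (F.obj q.2)) (F.map q.2 a')) (hract q a a')
      simpa only [Category.assoc] using this.symm)
  refine ⟨f, hl.isInvertible hr (fun q a => (p.lunit _ a).hom) (fun q => mX.lunit _)
    (fun q => mX.lunit_inv _) hact hract hmap hf, fun a₁ a j => ?_⟩
  have := congrArg (fun k => unitLeftι p a₁ a j ≫ k) (hf (PUnit.unit, a₁) a)
  rw [← comp_post, (exists_dayCoprojUnitLeft d F a₁ a).choose_spec] at this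
  rw [this, ← unitLeftι_lunit, Category.assoc]

theorem exists_dayRunit (mX : MonoidalConstraints T e)
    (hR : ∀ x : X, PreservesColims.{w, u} ((secR x).comp V T)) (F : EnrichedFunctor V A X) :
    ∃ f : 𝟙_ V ⟶ ((dayTensor d).obj (F, dayUnit d) ⟶[V] F), IsInvertible f ∧ ∀ a₁ a j,
      post (whL T (F.obj a₁) (dayν d j) ⨟ dayη d F (dayUnit d) a₁ j a) (f ≫ proj _ _ a) =
        p.runitι a₁ a j ≫ pre (mX.runit (F.obj a₁)) (F.map a₁ a) := by
  have hl := presents_dayUnitRight d hR F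
  have hr := presents_coYoneda F
  have hact : ∀ e a, (unitRightWt p).act e a ≫ (p.runit _ a).hom =
      _ ◁ (p.runit _ a).hom ≫ (WtFam.hom V A).act e a := by
    rintro (⟨e, _⟩ | ⟨q, e⟩) a
    · exact nomatch e
    · simp
  have hract : ∀ q a a', (unitRightWt p).ract q a a' ≫ (p.runit _ a').hom =
      (p.runit _ a).hom ▷ _ ≫ (WtFam.hom V A).ract q a a' := by
    intro q a a'
    simp
  have hmap : ∀ q, post ((unitRightDiag T e F).map q) (mX.runit _) =
      pre (mX.runit _) ((Diag.ofFunctor F).map q) := by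
    rintro (⟨e, _⟩ | ⟨q, e⟩)
    · exact nomatch e
    · exact mX.runit_nat' _
  obtain ⟨f, hf⟩ := hl.exists_hom (L' := F)
    (fun q a => (p.runit _ a).hom ≫ pre (mX.runit _) (F.map q.2 a)) (by
      intro e a
      rw [reassoc_of% hact, ← comp_pre, hr.nat, ecmp_comp, ← pre_ecmp, ← hmap, post_ecmp]) (by
      intro q a a'
      rw [comp_ecmp, pre_ecmp, hr.ract, comp_pre]
      have := congrArg (· ≫ pre (mX.runit (F.obj q.2)) (F.map q.2 a')) (hract q a a')
      simpa only [Category.assoc] using this.symm)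
  refine ⟨f, hl.isInvertible hr (fun q a => (p.runit _ a).hom) (fun q => mX.runit _)
    (fun q => mX.runit_inv _) hact hract hmap hf, fun a₁ a j => ?_⟩
  have := congrArg (fun k => unitRightι p a₁ a j ≫ k) (hf (PUnit.unit, a₁) a)
  rw [← comp_post, (exists_dayCoprojUnitRight d F a₁ a).choose_spec] at this
  rw [this, ← unitRightι_runit, Category.assoc]

end DayUnitors

/-! ### Whiskering squares and transporting naturality to colimits. -/

section Squares

variable {X : Type u₁} [EnrichedCategory V X]

theorem Sq.mapPair_whR {Y : Type u₂} [EnrichedCategory V Y] {Z : Type u₃} [EnrichedCategory V Z]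
    {T : EnrichedFunctor V (X × Y) Z} {x y x' y' : X} {p q r : V} {h : p ⟶ (x ⟶[V] y)}
    {f : q ⟶ (y ⟶[V] y')} {g : q ⟶ (x ⟶[V] x')} {h' : p ⟶ (x' ⟶[V] y')} (s : Sq h f g h')
    {z z' : Y} (k : r ⟶ (z ⟶[V] z')) :
    Sq (Enr.whR T h z) (mapPair T f k) (mapPair T g k) (Enr.whR T h' z') := by
  rw [← whR_ecmp_whL, ← whR_ecmp_whL]
  exact (s.whR z).hcomp (sq_whR_whL h' k)

theorem Sq.mapPair_whL {Y : Type u₂} [EnrichedCategory V Y] {Z : Type u₃} [EnrichedCategory V Z]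
    {T : EnrichedFunctor V (X × Y) Z} {x y x' y' : Y} {p q r : V} {h : p ⟶ (x ⟶[V] y)}
    {f : q ⟶ (y ⟶[V] y')} {g : q ⟶ (x ⟶[V] x')} {h' : p ⟶ (x' ⟶[V] y')} (s : Sq h f g h')
    {z z' : X} (k : r ⟶ (z ⟶[V] z')) :
    Sq (Enr.whL T z h) (mapPair T k f) (mapPair T k g) (Enr.whL T z' h') := by
  rw [← whR_ecmp_whL, ← whR_ecmp_whL]
  exact (sq_whR_whL k h).symm.hcomp (s.whL z')

/-- Naturality of the morphisms induced by a change of coprojections. -/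
theorem Sq.transport {xl xr yl yr xl' xr' yl' yr' : X} {v w s t : V}
    {cl : v ⟶ (xl ⟶[V] yl)} {cr : w ⟶ (xr ⟶[V] yr)} {cl' : v ⟶ (xl' ⟶[V] yl')}
    {cr' : w ⟶ (xr' ⟶[V] yr')} {Ml : s ⟶ (yl ⟶[V] yl')} {ml : s ⟶ (xl ⟶[V] xl')}
    {Mr : t ⟶ (yr ⟶[V] yr')} {mr : t ⟶ (xr ⟶[V] xr')}
    (hl : Sq cl Ml ml cl') (hr : Sq cr Mr mr cr') {φ : v ⟶ w} {f : 𝟙_ V ⟶ (yl ⟶[V] yr)}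
    {f' : 𝟙_ V ⟶ (yl' ⟶[V] yr')} {y : 𝟙_ V ⟶ (xl ⟶[V] xr)} {y' : 𝟙_ V ⟶ (xl' ⟶[V] xr')}
    {k : s ⟶ t} (h : post cl f = φ ≫ pre y cr) (h' : post cl' f' = φ ≫ pre y' cr')
    (hy : post ml y' = k ≫ pre y mr) : cl ⨟ post Ml f' = cl ⨟ (k ≫ pre f Mr) := by
  -- `Ml` is slid off the colimit through `hl`, `f'` is replaced by `φ` and `y'`, naturality `hy`
  -- exchanges `ml` for `mr`, and `hr` slides back onto the colimit.
  rw [ecmp_post, hl, comp_post, ← ecmp_post, h', ecmp_comp, ← post_ecmp, hy, comp_ecmp, pre_ecmp,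
    ecmp_comp, ← post_ecmp, h, comp_ecmp, pre_ecmp, hr, comp_pre, whisker_exchange_assoc,
    braiding_naturality_left_assoc, braiding_naturality_right_assoc]

end Squares

/-! ### Testing squares on the coprojections of a coend. -/

section TensSquares

open Limits

variable [MonoidalClosed V] [HasCoproducts.{u} V] [HasCoequalizers V]
  {C : Type u} [EnrichedCategory V C] {X : Type u₁} [EnrichedCategory V X]

theorem sq_tens {L : CoPsh V C} {N : Psh V C} {x y x' y' : X} {s : V}
    {c : tens L N ⟶ (x ⟶[V] y)} {M : s ⟶ (y ⟶[V] y')} {m : s ⟶ (x ⟶[V] x')}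
    {c' : tens L N ⟶ (x' ⟶[V] y')} (h : ∀ u, Sq (tensι L N u ≫ c) M m (tensι L N u ≫ c')) :
    Sq c M m c' := by
  apply tens_whiskerRight_ext
  intro u
  rw [← comp_ecmp, h u, braiding_naturality_left_assoc, ← ecmp_comp]

end TensSquares

/-! ### Naturality of the Day constraints. -/

section DayNaturality

open Limits

variable [MonoidalClosed V] [HasProducts.{u} V] [HasEqualizers V] [HasCoproducts.{u} V]
  [HasCoequalizers V]
  {A : Type u} [EnrichedCategory V A] {X : Type u₁} [EnrichedCategory V X]
  {p : Promonoidal V A} {T : EnrichedFunctor V (X × X) X} {e : X} (d : DayColimits p T e)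
  {F F' G G' H H' : EnrichedFunctor V A X}

theorem sq_dayη_dayη_left {r s t : V} (f : r ⟶ (F ⟶[V] F')) (g : s ⟶ (G ⟶[V] G'))
    (h : t ⟶ (H ⟶[V] H')) (a₁ a₂ a₃ u a : A) :
    Sq (whR T (dayη d F G a₁ a₂ u) (H.obj a₃) ⨟ dayη d ((dayTensor d).obj (F, G)) H u a₃ a)
      (mapPair (dayTensor d) (mapPair (dayTensor d) f g) h ≫ proj _ _ a)
      (mapPair T (mapPair T (f ≫ proj _ _ a₁) (g ≫ proj _ _ a₂)) (h ≫ proj _ _ a₃))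
      (whR T (dayη d F' G' a₁ a₂ u) (H'.obj a₃) ⨟
        dayη d ((dayTensor d).obj (F', G')) H' u a₃ a) :=
  ((sq_dayη d f g a₁ a₂ u).mapPair_whR (h ≫ proj _ _ a₃)).vcomp
    (sq_dayη d (mapPair (dayTensor d) f g) h u a₃ a)

theorem sq_dayη_dayη_right {r s t : V} (f : r ⟶ (F ⟶[V] F')) (g : s ⟶ (G ⟶[V] G'))
    (h : t ⟶ (H ⟶[V] H')) (a₁ a₂ a₃ u a : A) :
    Sq (whL T (F.obj a₁) (dayη d G H a₂ a₃ u) ⨟ dayη d F ((dayTensor d).obj (G, H)) a₁ u a)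
      (mapPair (dayTensor d) f (mapPair (dayTensor d) g h) ≫ proj _ _ a)
      (mapPair T (f ≫ proj _ _ a₁) (mapPair T (g ≫ proj _ _ a₂) (h ≫ proj _ _ a₃)))
      (whL T (F'.obj a₁) (dayη d G' H' a₂ a₃ u) ⨟
        dayη d F' ((dayTensor d).obj (G', H')) a₁ u a) :=
  ((sq_dayη d g h a₂ a₃ u).mapPair_whL (f ≫ proj _ _ a₁)).vcomp
    (sq_dayη d f (mapPair (dayTensor d) g h) a₁ u a)

theorem sq_dayCoprojRight {r s t : V} (f : r ⟶ (F ⟶[V] F')) (g : s ⟶ (G ⟶[V] G'))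
    (h : t ⟶ (H ⟶[V] H')) (a₁ a₂ a₃ a : A) :
    Sq (dayCoprojRight d F G H a₁ a₂ a₃ a)
      (mapPair (dayTensor d) f (mapPair (dayTensor d) g h) ≫ proj _ _ a)
      (mapPair T (f ≫ proj _ _ a₁) (mapPair T (g ≫ proj _ _ a₂) (h ≫ proj _ _ a₃)))
      (dayCoprojRight d F' G' H' a₁ a₂ a₃ a) := by
  apply sq_tens
  intro u
  have := sq_dayη_dayη_right d f g h a₁ a₂ a₃ u a
  rw [← rightι_dayCoprojRight, ← rightι_dayCoprojRight] at this
  exact this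

/-- Tensoring with `y` preserves the Day colimit, so the whiskered coprojections are still jointly
epimorphic. The next four lemmas rest on the same point. -/
theorem whR_dayη_ext (hL : ∀ x : X, PreservesColims.{w, u} ((secL x).comp V T)) {y x : X} {u : A}
    {v : V} {f g : v ⟶ (T.obj (((dayTensor d).obj (F, G)).obj u, y) ⟶[V] x)}
    (h : ∀ a₁ a₂, whR T (dayη d F G a₁ a₂ u) y ⨟ f = whR T (dayη d F G a₁ a₂ u) y ⨟ g) : f = g := by
  refine ((isLan_day d F G).comp (hL y)).ext (c := u) fun q => ?_
  have := h q.1 q.2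
  rw [whR_eq_map] at this
  exact this

theorem whR_whR_dayη_ext (hL : ∀ x : X, PreservesColims.{w, u} ((secL x).comp V T)) {y z x : X}
    {u : A} {v : V} {f g : v ⟶ (T.obj (T.obj (((dayTensor d).obj (F, G)).obj u, y), z) ⟶[V] x)}
    (h : ∀ a₁ a₂, whR T (whR T (dayη d F G a₁ a₂ u) y) z ⨟ f =
      whR T (whR T (dayη d F G a₁ a₂ u) y) z ⨟ g) : f = g := by
  refine (((isLan_day d F G).comp (hL y)).comp (hL z)).ext (c := u) fun q => ?_
  have := h q.1 q.2
  rw [whR_eq_map, whR_eq_map] at this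
  exact this

theorem whR_dayν_ext (hL : ∀ x : X, PreservesColims.{w, u} ((secL x).comp V T)) {y x : X} {j : A}
    {v : V} {f g : v ⟶ (T.obj ((dayUnit d).obj j, y) ⟶[V] x)}
    (h : whR T (dayν d j) y ⨟ f = whR T (dayν d j) y ⨟ g) : f = g := by
  refine ((isLan_dayUnit d).comp (hL y)).ext (c := j) fun q => ?_
  rw [whR_eq_map] at h
  exact h

theorem whL_dayν_ext (hR : ∀ x : X, PreservesColims.{w, u} ((secR x).comp V T)) {y x : X} {j : A}
    {v : V} {f g : v ⟶ (T.obj (y, (dayUnit d).obj j) ⟶[V] x)}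
    (h : whL T y (dayν d j) ⨟ f = whL T y (dayν d j) ⨟ g) : f = g := by
  refine ((isLan_dayUnit d).comp (hR y)).ext (c := j) fun q => ?_
  rw [whL_eq_map] at h
  exact h

theorem whR_whL_dayν_ext (hL : ∀ x : X, PreservesColims.{w, u} ((secL x).comp V T))
    (hR : ∀ x : X, PreservesColims.{w, u} ((secR x).comp V T)) {y z x : X} {j : A}
    {v : V} {f g : v ⟶ (T.obj (T.obj (y, (dayUnit d).obj j), z) ⟶[V] x)}
    (h : whR T (whL T y (dayν d j)) z ⨟ f = whR T (whL T y (dayν d j)) z ⨟ g) : f = g := by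
  refine (((isLan_dayUnit d).comp (hR y)).comp (hL z)).ext (c := j) fun q => ?_
  rw [whR_eq_map, whL_eq_map] at h
  exact h

theorem ecmp_ecmp_ext {x y z t : X} {r s v : V} {c : r ⟶ (x ⟶[V] y)} {c' : s ⟶ (y ⟶[V] z)}
    {f g : v ⟶ (z ⟶[V] t)} (h : (c ⨟ c') ⨟ f = (c ⨟ c') ⨟ g) : c ⨟ (c' ⨟ f) = c ⨟ (c' ⨟ g) := by
  rw [ecmp_assoc', ecmp_assoc', h]

theorem dayη_dayη_ext (hL : ∀ x : X, PreservesColims.{w, u} ((secL x).comp V T)) {a : A} {v : V}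
    {x : X}
    {f g : v ⟶ (((dayTensor d).obj ((dayTensor d).obj (F, G), H)).obj a ⟶[V] x)}
    (h : ∀ a₁ a₂ a₃ u,
      (whR T (dayη d F G a₁ a₂ u) (H.obj a₃) ⨟ dayη d ((dayTensor d).obj (F, G)) H u a₃ a) ⨟ f =
      (whR T (dayη d F G a₁ a₂ u) (H.obj a₃) ⨟ dayη d ((dayTensor d).obj (F, G)) H u a₃ a) ⨟ g) :
    f = g :=
  dayη_ext d fun u a₃ => whR_dayη_ext d hL fun a₁ a₂ => ecmp_ecmp_ext (h a₁ a₂ a₃ u)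

theorem dayν_dayη_ext_left (hL : ∀ x : X, PreservesColims.{w, u} ((secL x).comp V T)) {a : A}
    {v : V} {x : X} {f g : v ⟶ (((dayTensor d).obj (dayUnit d, F)).obj a ⟶[V] x)}
    (h : ∀ a₁ j,
      (whR T (dayν d j) (F.obj a₁) ⨟ dayη d (dayUnit d) F j a₁ a) ⨟ f =
      (whR T (dayν d j) (F.obj a₁) ⨟ dayη d (dayUnit d) F j a₁ a) ⨟ g) : f = g :=
  dayη_ext d fun j a₁ => whR_dayν_ext d hL (ecmp_ecmp_ext (h a₁ j))

theorem dayν_dayη_ext_right (hR : ∀ x : X, PreservesColims.{w, u} ((secR x).comp V T)) {a : A}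
    {v : V} {x : X} {f g : v ⟶ (((dayTensor d).obj (F, dayUnit d)).obj a ⟶[V] x)}
    (h : ∀ a₁ j,
      (whL T (F.obj a₁) (dayν d j) ⨟ dayη d F (dayUnit d) a₁ j a) ⨟ f =
      (whL T (F.obj a₁) (dayν d j) ⨟ dayη d F (dayUnit d) a₁ j a) ⨟ g) : f = g :=
  dayη_ext d fun a₁ j => whL_dayν_ext d hR (ecmp_ecmp_ext (h a₁ j))

/-- The equations of a Day convolution structure for the associativity constraint. -/
def IsDayAssoc (mX : MonoidalConstraints T e)
    (α : ∀ F G H : EnrichedFunctor V A X,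
      𝟙_ V ⟶ ((dayTensor d).obj ((dayTensor d).obj (F, G), H) ⟶[V]
        (dayTensor d).obj (F, (dayTensor d).obj (G, H)))) : Prop :=
  ∀ F G H a₁ a₂ a₃ a u,
    post (whR T (dayη d F G a₁ a₂ u) (H.obj a₃) ⨟ dayη d ((dayTensor d).obj (F, G)) H u a₃ a)
      (α F G H ≫ proj _ _ a) =
    p.assocι a₁ a₂ a₃ a u ≫ pre (mX.assoc (F.obj a₁) (G.obj a₂) (H.obj a₃))
      (dayCoprojRight d F G H a₁ a₂ a₃ a)

/-- The equations of a Day convolution structure for the left unit constraint. -/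
def IsDayLunit (mX : MonoidalConstraints T e)
    (l : ∀ F : EnrichedFunctor V A X, 𝟙_ V ⟶ ((dayTensor d).obj (dayUnit d, F) ⟶[V] F)) : Prop :=
  ∀ F a₁ a j,
    post (whR T (dayν d j) (F.obj a₁) ⨟ dayη d (dayUnit d) F j a₁ a) (l F ≫ proj _ _ a) =
      p.lunitι a₁ a j ≫ pre (mX.lunit (F.obj a₁)) (F.map a₁ a)

/-- The equations of a Day convolution structure for the right unit constraint. -/
def IsDayRunit (mX : MonoidalConstraints T e)
    (r : ∀ F : EnrichedFunctor V A X, 𝟙_ V ⟶ ((dayTensor d).obj (F, dayUnit d) ⟶[V] F)) : Prop :=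
  ∀ F a₁ a j,
    post (whL T (F.obj a₁) (dayν d j) ⨟ dayη d F (dayUnit d) a₁ j a) (r F ≫ proj _ _ a) =
      p.runitι a₁ a j ≫ pre (mX.runit (F.obj a₁)) (F.map a₁ a)

variable {d} {mX : MonoidalConstraints T e}

/-- On coprojections the constraint is determined by the associativity of X, so `Sq.transport`
reduces its naturality to `assoc_nat'`. -/
theorem IsDayAssoc.nat (hL : ∀ x : X, PreservesColims.{w, u} ((secL x).comp V T))
    {α : ∀ F G H : EnrichedFunctor V A X,
      𝟙_ V ⟶ ((dayTensor d).obj ((dayTensor d).obj (F, G), H) ⟶[V]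
        (dayTensor d).obj (F, (dayTensor d).obj (G, H)))} (hα : IsDayAssoc d mX α)
    {r s t : V} (f : r ⟶ (F ⟶[V] F')) (g : s ⟶ (G ⟶[V] G')) (h : t ⟶ (H ⟶[V] H')) :
    post (mapPair (dayTensor d) (mapPair (dayTensor d) f g) h) (α F' G' H') =
      (α_ _ _ _).hom ≫ pre (α F G H) (mapPair (dayTensor d) f (mapPair (dayTensor d) g h)) := by
  apply hom_ext
  intro a
  rw [Category.assoc, post_proj, pre_proj]
  apply dayη_dayη_ext d hL
  intro a₁ a₂ a₃ u
  exact (sq_dayη_dayη_left d f g h a₁ a₂ a₃ u a).transport (sq_dayCoprojRight d f g h a₁ a₂ a₃ a)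
    (hα F G H a₁ a₂ a₃ a u) (hα F' G' H' a₁ a₂ a₃ a u) (mX.assoc_nat' _ _ _)

theorem IsDayLunit.nat (hL : ∀ x : X, PreservesColims.{w, u} ((secL x).comp V T))
    {l : ∀ F : EnrichedFunctor V A X, 𝟙_ V ⟶ ((dayTensor d).obj (dayUnit d, F) ⟶[V] F)}
    (hl : IsDayLunit d mX l) {r : V} (f : r ⟶ (F ⟶[V] F')) :
    post (whL (dayTensor d) (dayUnit d) f) (l F') = pre (l F) f := by
  apply hom_ext
  intro a
  rw [post_proj, pre_proj]
  apply dayν_dayη_ext_left d hL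
  intro a₁ j
  -- On the target side the coprojections are the `F.map a₁ a`, and their square is the naturality
  -- of `f` itself.
  have := ((sq_whR_whL (dayν d j) (f ≫ proj _ _ a₁)).vcomp
    (sq_dayη_right d (dayUnit d) f j a₁ a)).transport (sq_proj f a₁ a).symm (hl F a₁ a j)
    (hl F' a₁ a j) (k := 𝟙 _) (by rw [Category.id_comp]; exact mX.lunit_nat' _)
  rwa [Category.id_comp] at this

theorem IsDayRunit.nat (hR : ∀ x : X, PreservesColims.{w, u} ((secR x).comp V T))
    {l : ∀ F : EnrichedFunctor V A X, 𝟙_ V ⟶ ((dayTensor d).obj (F, dayUnit d) ⟶[V] F)}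
    (hl : IsDayRunit d mX l) {r : V} (f : r ⟶ (F ⟶[V] F')) :
    post (whR (dayTensor d) f (dayUnit d)) (l F') = pre (l F) f := by
  apply hom_ext
  intro a
  rw [post_proj, pre_proj]
  apply dayν_dayη_ext_right d hR
  intro a₁ j
  have := ((sq_whR_whL (f ≫ proj _ _ a₁) (dayν d j)).symm.vcomp
    (sq_dayη_left d f (dayUnit d) a₁ j a)).transport (sq_proj f a₁ a).symm (hl F a₁ a j)
    (hl F' a₁ a j) (k := 𝟙 _) (by rw [Category.id_comp]; exact mX.runit_nat' _)
  rwa [Category.id_comp] at this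

end DayNaturality

/-! ### Pentagon and triangle for Day convolution. -/

section DayCoherence

open Limits

variable [MonoidalClosed V] [HasProducts.{u} V] [HasEqualizers V] [HasCoproducts.{u} V]
  [HasCoequalizers V]
  {A : Type u} [EnrichedCategory V A] {X : Type u₁} [EnrichedCategory V X]
  {p : Promonoidal V A} {T : EnrichedFunctor V (X × X) X} {e : X} (d : DayColimits p T e)
  {mX : MonoidalConstraints T e} {F G H K L : EnrichedFunctor V A X}

theorem rightι_post_dayCoprojRight (k : 𝟙_ V ⟶ ((dayTensor d).obj (G, H) ⟶[V] K))
    (a₁ a₂ a₃ a w : A) :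
    rightι p.P a₁ a₂ a₃ a w ≫ post (dayCoprojRight d F G H a₁ a₂ a₃ a)
        (whL (dayTensor d) F k ≫ proj _ _ a) =
      whL T (F.obj a₁) (post (dayη d G H a₂ a₃ w) (k ≫ proj _ _ w)) ⨟ dayη d F K a₁ w a := by
  rw [← comp_post, rightι_dayCoprojRight, ← ecmp_post, post_dayη_right, ← post_ecmp, ← whL_post]

theorem ecmp_dayη_post_whR {x : X} {r : V} {y : A} (c : r ⟶ (x ⟶[V] F.obj y))
    (k : 𝟙_ V ⟶ (F ⟶[V] K)) (a₄ a : A) :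
    post (whR T c (L.obj a₄) ⨟ dayη d F L y a₄ a) (whR (dayTensor d) k L ≫ proj _ _ a) =
      whR T (post c (k ≫ proj _ _ y)) (L.obj a₄) ⨟ dayη d K L y a₄ a := by
  rw [← ecmp_post, post_dayη_left, ← post_ecmp, ← whR_post]

theorem dayη_dayη_dayη_ext (hL : ∀ x : X, PreservesColims.{w, u} ((secL x).comp V T)) {a : A}
    {x : X} {f g : 𝟙_ V ⟶ (((dayTensor d).obj ((dayTensor d).obj
      ((dayTensor d).obj (F, G), H), L)).obj a ⟶[V] x)}
    (h : ∀ a₁ a₂ a₃ a₄ u y,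
      post (whR T (whR T (dayη d F G a₁ a₂ u) (H.obj a₃) ⨟
        dayη d ((dayTensor d).obj (F, G)) H u a₃ y) (L.obj a₄) ⨟
        dayη d ((dayTensor d).obj ((dayTensor d).obj (F, G), H)) L y a₄ a) f =
      post (whR T (whR T (dayη d F G a₁ a₂ u) (H.obj a₃) ⨟
        dayη d ((dayTensor d).obj (F, G)) H u a₃ y) (L.obj a₄) ⨟
        dayη d ((dayTensor d).obj ((dayTensor d).obj (F, G), H)) L y a₄ a) g) : f = g := by
  refine dayη_ext d fun y a₄ => whR_dayη_ext d hL fun u a₃ => whR_whR_dayη_ext d hL fun a₁ a₂ => ?_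
  have := h a₁ a₂ a₃ a₄ u y
  rw [ecmp_assoc', ecmp_assoc', ← whR_ecmp, ecmp_assoc', ecmp_eq_post, this, ← ecmp_eq_post,
    ← ecmp_assoc', whR_ecmp, ecmp_assoc, Iso.inv_hom_id_assoc]

variable {d}
variable {α : ∀ F G H : EnrichedFunctor V A X,
      𝟙_ V ⟶ ((dayTensor d).obj ((dayTensor d).obj (F, G), H) ⟶[V]
        (dayTensor d).obj (F, (dayTensor d).obj (G, H)))}

theorem IsDayAssoc.post_pre (hα : IsDayAssoc d mX α)
    (k : 𝟙_ V ⟶ ((dayTensor d).obj (F, (dayTensor d).obj (G, H)) ⟶[V] K)) (a₁ a₂ a₃ a u : A) :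
    post (whR T (dayη d F G a₁ a₂ u) (H.obj a₃) ⨟ dayη d ((dayTensor d).obj (F, G)) H u a₃ a)
      (pre (α F G H) k ≫ proj _ _ a) =
    p.assocι a₁ a₂ a₃ a u ≫ pre (mX.assoc (F.obj a₁) (G.obj a₂) (H.obj a₃))
      (post (dayCoprojRight d F G H a₁ a₂ a₃ a) (k ≫ proj _ _ a)) := by
  rw [pre_proj, ← post_post, hα, comp_post, pre_post]

/-- Tested on the coprojections of the fourfold tensor product, both sides are maps out of iterated
coends of `P`. The promonoidal pentagon, with `z` a hom-object of X, says exactly that they agree,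
once each use of a Day associator has been traded for one of `A` and one of X. -/
theorem IsDayAssoc.pentagon (hL : ∀ x : X, PreservesColims.{w, u} ((secL x).comp V T))
    (hα : IsDayAssoc d mX α) (F G H L : EnrichedFunctor V A X) :
    pre (whR (dayTensor d) (α F G H) L)
        (pre (α F ((dayTensor d).obj (G, H)) L) (whL (dayTensor d) F (α G H L))) =
      pre (α ((dayTensor d).obj (F, G)) H L) (α F G ((dayTensor d).obj (H, L))) := by
  apply hom_ext
  intro a
  apply dayη_dayη_dayη_ext d hL
  intro a₁ a₂ a₃ a₄ u y
  rw [pre_proj, ← post_post, ecmp_dayη_post_whR, hα]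
  -- The two-step side is unfolded first at the associator of `F ∗ G`, `H`, `L`, with the
  -- coprojection of `F ∗ G` kept in front; this exhibits the family `g₁` of the promonoidal
  -- pentagon.
  have e1 : post (whR T (whR T (dayη d F G a₁ a₂ u) (H.obj a₃) ⨟
        dayη d ((dayTensor d).obj (F, G)) H u a₃ y) (L.obj a₄) ⨟
        dayη d ((dayTensor d).obj ((dayTensor d).obj (F, G), H)) L y a₄ a)
          (pre (α ((dayTensor d).obj (F, G)) H L) (α F G ((dayTensor d).obj (H, L))) ≫
            proj _ _ a) =
      (α_ _ _ _).hom ≫ _ ◁ p.assocι u a₃ a₄ a y ≫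
        (whR T (whR T (dayη d F G a₁ a₂ u) (H.obj a₃)) (L.obj a₄) ⨟
          pre (mX.assoc (((dayTensor d).obj (F, G)).obj u) (H.obj a₃) (L.obj a₄))
            (post (dayCoprojRight d ((dayTensor d).obj (F, G)) H L u a₃ a₄ a)
              (α F G ((dayTensor d).obj (H, L)) ≫ proj _ _ a))) := by
    rw [whR_ecmp, ecmp_assoc, comp_post, ← ecmp_post, hα.post_pre, ecmp_comp]
  rw [e1, comp_whR, comp_ecmp, comp_post]
  -- The families `g₄`, `g₃`, `g₂`, `g₅`, `g₁` in this order. Each is what remains of the composite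
  -- after some of the coprojections have been joined into a coend, preceded by those associators of
  -- X already split off.
  refine p.pentagon a₁ a₂ a₃ a₄ a _
    (fun x => pre (whR T (mX.assoc (F.obj a₁) (G.obj a₂) (H.obj a₃)) (L.obj a₄))
      (pre (mX.assoc (F.obj a₁) (T.obj (G.obj a₂, H.obj a₃)) (L.obj a₄))
        (pre (whL T (F.obj a₁) (mX.assoc (G.obj a₂) (H.obj a₃) (L.obj a₄)))
          (whL T (F.obj a₁) (dayCoprojRight d G H L a₂ a₃ a₄ x) ⨟
            dayη d F ((dayTensor d).obj (G, (dayTensor d).obj (H, L))) a₁ x a))))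
    (fun u => pre (whR T (mX.assoc (F.obj a₁) (G.obj a₂) (H.obj a₃)) (L.obj a₄))
      (whR T (whL T (F.obj a₁) (dayη d G H a₂ a₃ u)) (L.obj a₄) ⨟
        pre (mX.assoc (F.obj a₁) (((dayTensor d).obj (G, H)).obj u) (L.obj a₄))
          (post (dayCoprojRight d F ((dayTensor d).obj (G, H)) L a₁ u a₄ a)
            (whL (dayTensor d) F (α G H L) ≫ proj _ _ a))))
    (fun y => post (whR T (pre (mX.assoc (F.obj a₁) (G.obj a₂) (H.obj a₃))
        (dayCoprojRight d F G H a₁ a₂ a₃ y)) (L.obj a₄) ⨟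
          dayη d ((dayTensor d).obj (F, (dayTensor d).obj (G, H))) L y a₄ a)
      (pre (α F ((dayTensor d).obj (G, H)) L) (whL (dayTensor d) F (α G H L)) ≫ proj _ _ a))
    (fun u => pre (mX.assoc (T.obj (F.obj a₁, G.obj a₂)) (H.obj a₃) (L.obj a₄))
      (pre (mX.assoc (F.obj a₁) (G.obj a₂) (T.obj (H.obj a₃, L.obj a₄)))
        (whL T (F.obj a₁) (whL T (G.obj a₂) (dayη d H L a₃ a₄ u)) ⨟
          dayCoprojRight d F G ((dayTensor d).obj (H, L)) a₁ a₂ u a)))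
    (fun u => whR T (whR T (dayη d F G a₁ a₂ u) (H.obj a₃)) (L.obj a₄) ⨟
      pre (mX.assoc (((dayTensor d).obj (F, G)).obj u) (H.obj a₃) (L.obj a₄))
        (post (dayCoprojRight d ((dayTensor d).obj (F, G)) H L u a₃ a₄ a)
          (α F G ((dayTensor d).obj (H, L)) ≫ proj _ _ a)))
    ?_ ?_ ?_ ?_ u y
  · intro u x
    rw [← comp_pre, ← ecmp_comp, ← comp_pre, rightι_post_dayCoprojRight, ← post_ecmp,
      mX.assoc_nat_middle, pre_ecmp, ecmp_assoc', ← whL_ecmp, ecmp_post, hα, comp_whL, comp_ecmp,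
      whL_pre, pre_ecmp, comp_pre, comp_pre, comp_pre, comp_pre]
  · intro u y
    rw [← comp_post, ← comp_pre, ← comp_ecmp, ← comp_whR, ← comp_pre, rightι_dayCoprojRight, whR_pre,
      pre_ecmp, ← pre_post, whR_ecmp, ecmp_assoc, comp_post, ← ecmp_post, hα.post_pre,
      ecmp_comp, comp_pre]
  -- Here the two-step and three-step sides meet: the two associators of X in `g₅` become the three
  -- in `g₄` by the pentagon of X.
  · intro u x
    rw [← comp_pre, ← comp_pre, ← ecmp_comp, rightι_dayCoprojRight, ecmp_assoc', ← whL_ecmp,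
      ← rightι_dayCoprojRight, comp_whL, comp_ecmp, comp_pre, comp_pre, comp_pre, comp_pre,
      pre_pre, pre_pre, pre_pre, ← mX.pentagon]
    simp only [pre_pre]
  -- The associator of `F`, `G`, `H ∗ L` is resolved after the coprojection of `F ∗ G` has been
  -- commuted past that of `H ∗ L`, which produces `lcomm`.
  · intro u x
    rw [← ecmp_comp, ← comp_pre, ← comp_post, rightι_dayCoprojRight, ← post_ecmp,
      mX.assoc_nat_left, pre_ecmp, ← ecmp_post, ← (sq_whR_whL _ _).symm.lcomm_ecmp, ecmp_post, hα,
      ecmp_comp, comp_pre, comp_pre, ← post_ecmp, mX.assoc_nat_right, pre_ecmp]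

theorem dayη_dayν_dayη_ext (hL : ∀ x : X, PreservesColims.{w, u} ((secL x).comp V T))
    (hR : ∀ x : X, PreservesColims.{w, u} ((secR x).comp V T)) {a : A}
    {x : X} {f g : 𝟙_ V ⟶ (((dayTensor d).obj ((dayTensor d).obj (F, dayUnit d), G)).obj a ⟶[V] x)}
    (h : ∀ a₁ a₂ j u,
      post (whR T (whL T (F.obj a₁) (dayν d j) ⨟ dayη d F (dayUnit d) a₁ j u) (G.obj a₂) ⨟
        dayη d ((dayTensor d).obj (F, dayUnit d)) G u a₂ a) f =
      post (whR T (whL T (F.obj a₁) (dayν d j) ⨟ dayη d F (dayUnit d) a₁ j u) (G.obj a₂) ⨟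
        dayη d ((dayTensor d).obj (F, dayUnit d)) G u a₂ a) g) : f = g := by
  refine dayη_ext d fun u a₂ => whR_dayη_ext d hL fun a₁ j => whR_whL_dayν_ext d hL hR ?_
  have := h a₁ a₂ j u
  rw [ecmp_assoc', ecmp_assoc', ← whR_ecmp, ecmp_assoc', ecmp_eq_post, this, ← ecmp_eq_post,
    ← ecmp_assoc', whR_ecmp, ecmp_assoc, Iso.inv_hom_id_assoc]

/-- The map `t` supplied by the promonoidal triangle mediates. Resolving the left unit on one side
of it and the right unit on the other, the triangle of X reconciles the constraints of X that are
split off. -/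
theorem IsDayAssoc.triangle (hL : ∀ x : X, PreservesColims.{w, u} ((secL x).comp V T))
    (hR : ∀ x : X, PreservesColims.{w, u} ((secR x).comp V T)) (hα : IsDayAssoc d mX α)
    {l : ∀ F : EnrichedFunctor V A X, 𝟙_ V ⟶ ((dayTensor d).obj (dayUnit d, F) ⟶[V] F)}
    (hl : IsDayLunit d mX l)
    {r : ∀ F : EnrichedFunctor V A X, 𝟙_ V ⟶ ((dayTensor d).obj (F, dayUnit d) ⟶[V] F)}
    (hr : IsDayRunit d mX r) (F G : EnrichedFunctor V A X) :
    pre (α F (dayUnit d) G) (whL (dayTensor d) F (l G)) = whR (dayTensor d) (r F) G := by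
  apply hom_ext
  intro a
  apply dayη_dayν_dayη_ext hL hR
  intro a₁ a₂ j u
  obtain ⟨t, ht, ht'⟩ := p.triangle a₁ a₂ a j
  -- Both sides are maps out of `J j ⊗ ∫^w P(j, a₂, w) ⊗ P(a₁, w, a)`, so they are compared at each
  -- `w`, where `ht` describes `t` through the left unit constraint.
  have key : whR T (whL T (F.obj a₁) (dayν d j)) (G.obj a₂) ⨟
      pre (mX.assoc (F.obj a₁) ((dayUnit d).obj j) (G.obj a₂))
        (post (dayCoprojRight d F (dayUnit d) G a₁ j a₂ a)
          (whL (dayTensor d) F (l G) ≫ proj _ _ a)) =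
      t ≫ pre (whR T (mX.runit (F.obj a₁)) (G.obj a₂)) (dayη d F G a₁ a₂ a) := by
    apply tens_whiskerLeft_ext
    intro w
    change _ ◁ rightι p.P a₁ j a₂ a w ≫ _ = _ ◁ rightι p.P a₁ j a₂ a w ≫ _
    rw [reassoc_of% (ht w), ← ecmp_comp, ← comp_pre, rightι_post_dayCoprojRight, ← post_ecmp,
      mX.assoc_nat_middle, pre_ecmp, ecmp_assoc', ← whL_ecmp, ecmp_post, hl, comp_whL, comp_ecmp,
      whL_pre, pre_ecmp, comp_pre, comp_pre, pre_pre, mX.triangle, ← act₂_dayη, comp_pre]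
  rw [ecmp_dayη_post_whR, hr, comp_whR, comp_ecmp, whR_pre, pre_ecmp, ← act₁_dayη, comp_pre,
    whR_ecmp, ecmp_assoc, comp_post, ← ecmp_post, hα.post_pre, ecmp_comp, key,
    reassoc_of% (ht' u), Iso.hom_inv_id_assoc]

theorem nonempty_dayConvolution (d : DayColimits p T e) (mX : MonoidalConstraints T e)
    (hL : ∀ x : X, PreservesColims.{w, u} ((secL x).comp V T))
    (hR : ∀ x : X, PreservesColims.{w, u} ((secR x).comp V T)) :
    Nonempty (DayConvolution mX d) := by
  choose α hα hα' using exists_dayAssoc d mX hL hR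
  choose l hl hl' using exists_dayLunit d mX hL
  choose r hr hr' using exists_dayRunit d mX hR
  have hα' : IsDayAssoc d mX α := hα'
  have hl' : IsDayLunit d mX l := hl'
  have hr' : IsDayRunit d mX r := hr'
  exact ⟨{
    assoc := α
    lunit := l
    runit := r
    assoc_inv := hα
    lunit_inv := hl
    runit_inv := hr
    assoc_nat := fun _ _ _ _ _ _ => hα'.nat hL _ _ _
    lunit_nat := fun _ _ => hl'.nat hL _
    runit_nat := fun _ _ => hr'.nat hR _
    pentagon := hα'.pentagon hL
    triangle := hα'.triangle hL hR hl' hr'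
    assoc_eq := fun F G H a₁ a₂ a₃ a => ⟨dayCoprojRight d F G H a₁ a₂ a₃ a,
      rightι_dayCoprojRight d F G H a₁ a₂ a₃ a, hα' F G H a₁ a₂ a₃ a⟩
    lunit_eq := hl'
    runit_eq := hr' }⟩

/-- The equations satisfied by the associativity constraint of a Day convolution structure. -/
theorem DayConvolution.isDayAssoc (m : DayConvolution mX d) : IsDayAssoc d mX m.assoc := by
  intro F G H a₁ a₂ a₃ a u
  obtain ⟨θ, hθ, h⟩ := m.assoc_eq F G H a₁ a₂ a₃ a
  have : θ = dayCoprojRight d F G H a₁ a₂ a₃ a :=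
    tens_ext fun w => (hθ w).trans (rightι_dayCoprojRight d F G H a₁ a₂ a₃ a w).symm
  rw [← this]
  exact h u

end DayCoherence

/-! ### Actions induced on coends. -/

section TensActions

open Limits

variable [MonoidalClosed V] [HasCoproducts.{u} V] [HasCoequalizers V]
  {C : Type u} [EnrichedCategory V C]

/-- An action on `L` that commutes with its covariant structure respects the balancing relation and
descends. This supplies the contravariant actions on the source of `φ`, which a promonoidal module
does not carry as data. -/
theorem exists_tens_lact {L L' : CoPsh V C} (N : Psh V C) {h : V}
    (f : ∀ u, h ⊗ L.obj u ⟶ L'.obj u)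
    (hf : ∀ u u', f u ▷ _ ≫ L'.act u u' = (α_ _ _ _).hom ≫ h ◁ L.act u u' ≫ f u') :
    ∃ g : h ⊗ tens L N ⟶ tens L' N,
      ∀ u, h ◁ tensι L N u ≫ g = (α_ _ _ _).inv ≫ f u ▷ _ ≫ tensι L' N u := by
  obtain ⟨g, hg, _⟩ := tens_existsUnique L N
    (fun u => (α_ _ _ _).inv ≫ f u ▷ _ ≫ tensι L' N u) (by
      intro a b
      have e : f b ▷ N.obj b = 𝟙 _ ≫ f b ▷ N.obj b := (Category.id_comp _).symm
      rw [associator_inv_naturality_middle_assoc, ← comp_whiskerRight_assoc,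
        ← Iso.inv_hom_id_assoc (α_ _ _ _) (h ◁ L.act a b ≫ f b), ← hf, comp_whiskerRight_assoc,
        comp_whiskerRight_assoc, tens_condition]
      have e' : f a ▷ (a ⟶[V] b) ▷ N.obj b ≫ (α_ _ _ _).hom ≫ _ ◁ N.act a b =
        (α_ _ _ _).hom ≫ _ ◁ N.act a b ≫ f a ▷ _ := by
        rw [associator_naturality_left_assoc, ← whisker_exchange]
      rw [reassoc_of% e']
      simp)
  exact ⟨g, hg⟩

theorem exists_tens_ract (L : CoPsh V C) {N N' : Psh V C} {h : V}
    (f : ∀ u, N.obj u ⊗ h ⟶ N'.obj u)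
    (hf : ∀ u u', N.act u u' ▷ h ≫ f u = (α_ _ _ _).hom ≫ _ ◁ f u' ≫ N'.act u u') :
    ∃ g : tens L N ⊗ h ⟶ tens L N',
      ∀ u, tensι L N u ▷ h ≫ g = (α_ _ _ _).hom ≫ _ ◁ f u ≫ tensι L N' u :=
  exists_tens_whiskerRight (fun u => (α_ _ _ _).hom ≫ _ ◁ f u ≫ tensι L N' u) (by
    intro a b
    have e : (L.act a b ▷ N.obj b) ▷ h ≫ (α_ _ _ _).hom ≫ _ ◁ f b =
        (α_ _ _ _).hom ≫ (α_ _ _ _).hom ≫ L.obj a ◁ _ ◁ f b ≫ (α_ _ _ _).inv ≫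
          L.act a b ▷ N'.obj b := by
      rw [associator_naturality_left_assoc, ← whisker_exchange, associator_inv_naturality_right_assoc,
        Iso.hom_inv_id_assoc]
    rw [reassoc_of% e, tens_condition, comp_whiskerRight_assoc, associator_naturality_middle_assoc,
      ← MonoidalCategory.whiskerLeft_comp_assoc, hf]
    simp)

end TensActions

/-! ### Extending a presented functor along a module. -/

section CompLan

open Limits

variable [MonoidalClosed V] [HasCoproducts.{u} V] [HasCoequalizers V]
  {S : Shape.{u} V} {C : Type u} [EnrichedCategory V C] {D : Type u} [EnrichedCategory V D]
  {X : Type u₁} [EnrichedCategory V X]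

/-- The case of `Presents.coend` in which the parameter graph is a single vertex, which is then
discarded. -/
theorem Presents.comp_lan {L : S.I → CoPsh V C}
    {actL : ∀ e u, S.h e ⊗ (L (S.t e)).obj u ⟶ (L (S.s e)).obj u} {Y : Diag S X}
    {Φ : EnrichedFunctor V C X} {q : ∀ i u, (L i).obj u ⟶ (Y.obj i ⟶[V] Φ.obj u)}
    (hq : Presents (WtFam.inner L actL) Y Φ q) {M : VMod V D C} {Z : EnrichedFunctor V D X}
    {ι : ∀ u d, M.obj u d ⟶ (Φ.obj u ⟶[V] Z.obj d)} (h : IsLan M Φ Z ι)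
    {act : ∀ e d, S.h e ⊗ tens (L (S.t e)) (M.psh d) ⟶ tens (L (S.s e)) (M.psh d)}
    {ract : ∀ i d d', tens (L i) (M.psh d) ⊗ (d ⟶[V] d') ⟶ tens (L i) (M.psh d')}
    {Q : ∀ i d, tens (L i) (M.psh d) ⟶ (Y.obj i ⟶[V] Z.obj d)}
    (h₁ : ∀ e d u, S.h e ◁ tensι (L (S.t e)) (M.psh d) u ≫ act e d =
      (α_ _ _ _).inv ≫ actL e u ▷ _ ≫ tensι (L (S.s e)) (M.psh d) u)
    (h₃ : ∀ i d d' u, tensι (L i) (M.psh d) u ▷ _ ≫ ract i d d' =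
      (α_ _ _ _).hom ≫ _ ◁ M.ract u d d' ≫ tensι (L i) (M.psh d') u)
    (hQ : ∀ i d u, tensι (L i) (M.psh d) u ≫ Q i d = q i u ⨟ ι u d) :
    Presents ⟨fun i d => tens (L i) (M.psh d), act, ract⟩ Y Z Q := by
  have key := Presents.coend (S' := Shape.point.{u} V) (L := L) (actL := actL)
    (Y := fun _ => Y) (Φ := fun _ => Φ) (q := fun _ => q) (N := fun _ d => M.psh d)
    (r := fun _ u d => ι u d)
    (act₁ := fun e _ d => act e d) (act₂ := fun _ e => nomatch e) (ract := fun i _ d d' => ract i d d')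
    (mapY := fun _ e => nomatch e) (Q := fun i _ d => Q i d) (fun _ => hq) h.presents_outer
    (fun e _ d u => h₁ e d u) (fun _ e => nomatch e) (fun i _ d d' u => h₃ i d d' u)
    (fun _ e => nomatch e) (fun i _ d u => hQ i d u)
  refine ⟨fun e d => key.nat (.inl (e, PUnit.unit)) d, fun d v x t ht => ?_,
    fun i d d' => key.ract (i, PUnit.unit) d d'⟩
  obtain ⟨f, hf, hu⟩ := key.existsUnique d v x (fun p => t p.1) (by
    rintro (⟨e, _⟩ | ⟨_, e⟩)
    · exact ht e
    · exact nomatch e)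
  exact ⟨f, fun i => hf (i, PUnit.unit), fun g hg => hu g fun p => hg p.1⟩

end CompLan

/-! ### Tensor products of two extensions. -/

section ExternalProducts

variable {A : Type u} [EnrichedCategory V A] {B : Type u} [EnrichedCategory V B]
  {X : Type u₁} [EnrichedCategory V X] {T : EnrichedFunctor V (X × X) X}

theorem whR_ecmp_mapPair {x x' x'' y y' : X} {p q r : V} (f : p ⟶ (x ⟶[V] x'))
    (g : q ⟶ (x' ⟶[V] x'')) (h : r ⟶ (y ⟶[V] y')) :
    whR T f y ⨟ mapPair T g h = (α_ _ _ _).inv ≫ mapPair T (f ⨟ g) h := by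
  rw [← whR_ecmp_whL, ← whR_ecmp_whL, ecmp_assoc', whR_ecmp]

theorem whL_ecmp_mapPair {x x' y y' y'' : X} {p q r : V} (f : p ⟶ (y ⟶[V] y'))
    (g : q ⟶ (x ⟶[V] x')) (h : r ⟶ (y' ⟶[V] y'')) :
    whL T x f ⨟ mapPair T g h = lcomm _ _ _ ≫ mapPair T g (f ⨟ h) := by
  rw [← whR_ecmp_whL, ← whR_ecmp_whL, whL_ecmp, (sq_whR_whL g f).lcomm_ecmp]

variable {K : VMod V B A} {F : EnrichedFunctor V A X} {L : EnrichedFunctor V B X}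
    {κ : ∀ a b, K.obj a b ⟶ (F.obj a ⟶[V] L.obj b)}

theorem IsLan.whR_ext (h : IsLan K F L κ)
    (hL : ∀ x : X, PreservesColims.{w, u} ((secL x).comp V T)) {b : B} {v : V} {x y : X}
    {f g : v ⟶ (T.obj (L.obj b, y) ⟶[V] x)}
    (e : ∀ a, whR T (κ a b) y ⨟ f = whR T (κ a b) y ⨟ g) : f = g := by
  refine (h.comp (hL y)).ext (c := b) fun a => ?_
  have := e a
  rw [whR_eq_map] at this
  exact this

theorem IsLan.whL_ext (h : IsLan K F L κ)
    (hR : ∀ x : X, PreservesColims.{w, u} ((secR x).comp V T)) {b : B} {v : V} {x y : X}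
    {f g : v ⟶ (T.obj (y, L.obj b) ⟶[V] x)}
    (e : ∀ a, whL T y (κ a b) ⨟ f = whL T y (κ a b) ⨟ g) : f = g := by
  refine (h.comp (hR y)).ext (c := b) fun a => ?_
  have := e a
  rw [whL_eq_map] at this
  exact this

theorem IsLan.exists_whR (h : IsLan K F L κ)
    (hL : ∀ x : X, PreservesColims.{w, u} ((secL x).comp V T)) {b : B} {v : V} {x y : X}
    (t : ∀ a, K.obj a b ⊗ v ⟶ (T.obj (F.obj a, y) ⟶[V] x))
    (ht : ∀ a a', K.lact a a' b ▷ v ≫ t a = (α_ _ _ _).hom ≫ (whR T (F.map a a') y ⨟ t a')) :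
    ∃ f : v ⟶ (T.obj (L.obj b, y) ⟶[V] x), ∀ a, whR T (κ a b) y ⨟ f = t a := by
  obtain ⟨f, hf, _⟩ := ((h.comp (hL y)).isColim b).existsUnique v x t (by
    intro a a'
    have := ht a a'
    rw [whR_eq_map] at this
    exact this)
  refine ⟨f, fun a => ?_⟩
  rw [whR_eq_map]
  exact hf a

theorem IsLan.exists_whL (h : IsLan K F L κ)
    (hR : ∀ x : X, PreservesColims.{w, u} ((secR x).comp V T)) {b : B} {v : V} {x y : X}
    (t : ∀ a, K.obj a b ⊗ v ⟶ (T.obj (y, F.obj a) ⟶[V] x))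
    (ht : ∀ a a', K.lact a a' b ▷ v ≫ t a = (α_ _ _ _).hom ≫ (whL T y (F.map a a') ⨟ t a')) :
    ∃ f : v ⟶ (T.obj (y, L.obj b) ⟶[V] x), ∀ a, whL T y (κ a b) ⨟ f = t a := by
  obtain ⟨f, hf, _⟩ := ((h.comp (hR y)).isColim b).existsUnique v x t (by
    intro a a'
    have := ht a a'
    rw [whL_eq_map] at this
    exact this)
  refine ⟨f, fun a => ?_⟩
  rw [whL_eq_map]
  exact hf a

/-- The contravariant actions on `K(a₁, b₁) ⊗ K(a₂, b₂)`. -/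
@[reducible]
def VMod.actExt (K : VMod V B A) : ∀ (e : ((Shape.ofCat V A).prod (Shape.ofCat V A)).E) (c : B × B),
    ((Shape.ofCat V A).prod (Shape.ofCat V A)).h e ⊗
      (K.obj (((Shape.ofCat V A).prod (Shape.ofCat V A)).t e).1 c.1 ⊗
        K.obj (((Shape.ofCat V A).prod (Shape.ofCat V A)).t e).2 c.2) ⟶
      K.obj (((Shape.ofCat V A).prod (Shape.ofCat V A)).s e).1 c.1 ⊗
        K.obj (((Shape.ofCat V A).prod (Shape.ofCat V A)).s e).2 c.2
  | .inl e, c => (α_ _ _ _).inv ≫ K.lact e.1.1 e.1.2 c.1 ▷ _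
  | .inr e, c => lcomm _ _ _ ≫ _ ◁ K.lact e.2.1 e.2.2 c.2

variable [MonoidalClosed V] [Limits.HasProducts.{u} V] [Limits.HasEqualizers V]
  {F' : EnrichedFunctor V A X} {L' : EnrichedFunctor V B X}
  {κ' : ∀ a b, K.obj a b ⟶ (F'.obj a ⟶[V] L'.obj b)}

/-- The two colimits are taken in succession: `- ⊗ F' a₂` preserves the first, then `L b₁ ⊗ -`
preserves the second. -/
theorem IsLan.exists_mapPair (h : IsLan K F L κ) (h' : IsLan K F' L' κ')
    (hL : ∀ x : X, PreservesColims.{w, u} ((secL x).comp V T))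
    (hR : ∀ x : X, PreservesColims.{w, u} ((secR x).comp V T)) {b₁ b₂ : B} {v : V} {x : X}
    (t : ∀ a₁ a₂, (K.obj a₁ b₁ ⊗ K.obj a₂ b₂) ⊗ v ⟶ (T.obj (F.obj a₁, F'.obj a₂) ⟶[V] x))
    (ht : ∀ a₁ a₁' a₂, ((α_ _ _ _).inv ≫ K.lact a₁ a₁' b₁ ▷ _) ▷ v ≫ t a₁ a₂ =
      (α_ _ _ _).hom ≫ (whR T (F.map a₁ a₁') (F'.obj a₂) ⨟ t a₁' a₂))
    (ht' : ∀ a₁ a₂ a₂', (lcomm _ _ _ ≫ _ ◁ K.lact a₂ a₂' b₂) ▷ v ≫ t a₁ a₂ =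
      (α_ _ _ _).hom ≫ (whL T (F.obj a₁) (F'.map a₂ a₂') ⨟ t a₁ a₂')) :
    ∃ f : v ⟶ (T.obj (L.obj b₁, L'.obj b₂) ⟶[V] x),
      ∀ a₁ a₂, mapPair T (κ a₁ b₁) (κ' a₂ b₂) ⨟ f = t a₁ a₂ := by
  choose g hg using fun a₂ => h.exists_whR hL (b := b₁) (v := K.obj a₂ b₂ ⊗ v) (y := F'.obj a₂)
    (fun a₁ => (α_ _ _ _).inv ≫ t a₁ a₂) (by
      intro a₁ a₁'
      rw [ecmp_comp, ← Iso.inv_hom_id_assoc (α_ _ _ _) (whR T _ _ ⨟ _), ← ht]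
      simp)
  -- Naturality of the intermediate maps `g` in `a₂` is tested on the first coprojections;
  -- interchange moves the action past them and `lcomm_tensor_right` removes the permutation of
  -- stages.
  obtain ⟨f, hf⟩ := h'.exists_whL hR (b := b₂) (v := v) (y := L.obj b₁) g (by
    intro a₂ a₂'
    refine h.whR_ext hL fun a₁ => ?_
    rw [ecmp_comp, hg, ecmp_comp, ← (sq_whR_whL (κ a₁ b₁) (F'.map a₂ a₂')).symm.lcomm_ecmp, hg,
      ecmp_comp, ← Iso.inv_hom_id_assoc (α_ _ _ _) (whL T _ _ ⨟ _), ← ht',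
      comp_whiskerRight_assoc, reassoc_of% (lcomm_tensor_right (a₂ ⟶[V] a₂') (K.obj a₁ b₁)),
      ← associator_inv_naturality_middle_assoc])
  refine ⟨f, fun a₁ a₂ => ?_⟩
  rw [← whR_ecmp_whL, ecmp_assoc, hf, hg, Iso.hom_inv_id_assoc]

theorem IsLan.mapPair_ext (h : IsLan K F L κ) (h' : IsLan K F' L' κ')
    (hL : ∀ x : X, PreservesColims.{w, u} ((secL x).comp V T))
    (hR : ∀ x : X, PreservesColims.{w, u} ((secR x).comp V T)) {b₁ b₂ : B} {v : V} {x : X}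
    {f g : v ⟶ (T.obj (L.obj b₁, L'.obj b₂) ⟶[V] x)}
    (e : ∀ a₁ a₂, mapPair T (κ a₁ b₁) (κ' a₂ b₂) ⨟ f = mapPair T (κ a₁ b₁) (κ' a₂ b₂) ⨟ g) :
    f = g := by
  refine h'.whL_ext hR fun a₂ => h.whR_ext hL fun a₁ => ?_
  rw [ecmp_assoc', ecmp_assoc', whR_ecmp_whL, e]

/-- Because the tensor product preserves colimits in each variable, the weight is the external
product of the two weights. This is the inner stage for `∃_K F ∗ ∃_K G`. -/
theorem IsLan.presents_mapPair (h : IsLan K F L κ) (h' : IsLan K F' L' κ')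
    (hL : ∀ x : X, PreservesColims.{w, u} ((secL x).comp V T))
    (hR : ∀ x : X, PreservesColims.{w, u} ((secR x).comp V T)) :
    Presents (WtFam.inner (fun q : A × A => (K.copsh q.1).ext (K.copsh q.2)) K.actExt)
      (Diag.ext T F F') (extObj T L L') (fun q c => mapPair T (κ q.1 c.1) (κ' q.2 c.2)) where
  nat := by
    rintro (⟨⟨a₁, a₁'⟩, a₂⟩ | ⟨a₁, a₂, a₂'⟩) ⟨b₁, b₂⟩
    · change ((α_ _ _ _).inv ≫ K.lact a₁ a₁' b₁ ▷ _) ≫ mapPair T (κ a₁ b₁) (κ' a₂ b₂) =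
        whR T (F.map a₁ a₁') (F'.obj a₂) ⨟ mapPair T (κ a₁' b₁) (κ' a₂ b₂)
      have e : K.lact a₁ a₁' b₁ ≫ κ a₁ b₁ = F.map a₁ a₁' ⨟ κ a₁' b₁ := (h.isColim b₁).nat a₁ a₁'
      rw [Category.assoc, ← mapPair_comp_left, e, whR_ecmp_mapPair]
    · change (lcomm _ _ _ ≫ _ ◁ K.lact a₂ a₂' b₂) ≫ mapPair T (κ a₁ b₁) (κ' a₂ b₂) =
        whL T (F.obj a₁) (F'.map a₂ a₂') ⨟ mapPair T (κ a₁ b₁) (κ' a₂' b₂)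
      have e : K.lact a₂ a₂' b₂ ≫ κ' a₂ b₂ = F'.map a₂ a₂' ⨟ κ' a₂' b₂ :=
        (h'.isColim b₂).nat a₂ a₂'
      rw [Category.assoc, ← mapPair_comp_right, e, whL_ecmp_mapPair]
  existsUnique := by
    rintro ⟨b₁, b₂⟩ v x t ht
    obtain ⟨f, hf⟩ := h.exists_mapPair h' hL hR (b₁ := b₁) (b₂ := b₂) (v := v) (x := x)
      (fun a₁ a₂ => t (a₁, a₂)) (fun a₁ a₁' a₂ => ht (.inl ((a₁, a₁'), a₂)))
      (fun a₁ a₂ a₂' => ht (.inr (a₁, (a₂, a₂'))))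
    refine ⟨f, fun q => hf q.1 q.2, fun g hg => ?_⟩
    exact h.mapPair_ext h' hL hR fun a₁ a₂ => (hg (a₁, a₂)).trans (hf a₁ a₂).symm
  ract := by
    rintro ⟨a₁, a₂⟩ ⟨b₁, b₂⟩ ⟨b₁', b₂'⟩
    change mapPair T (κ a₁ b₁) (κ' a₂ b₂) ⨟ mapPair T (L.map b₁ b₁') (L'.map b₂ b₂') =
      (tensorμ _ _ _ _ ≫ (K.ract a₁ b₁ b₁' ⊗ₘ K.ract a₂ b₂ b₂')) ≫ mapPair T _ _
    rw [mapPair_ecmp, h.ract, h'.ract, mapPair_comp, Category.assoc]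

end ExternalProducts

/-- The braidings of `h` with `k` and of `l` with `m` act on disjoint factors and so commute; the
rest is monoidal coherence. -/
theorem tensorμ_lcomm (h k l m n : V) :
    lcomm h k l ▷ (m ⊗ n) ≫ tensorμ k (h ⊗ l) m n =
      (α_ _ _ _).hom ≫ h ◁ tensorμ k l m n ≫ lcomm h (k ⊗ m) (l ⊗ n) ≫
        (k ⊗ m) ◁ (α_ h l n).inv := by
  simp only [tensorμ, lcomm, braiding_tensor_left_hom, braiding_tensor_right_hom]
  calc
    _ = 𝟙 _ ⊗≫ ((β_ h k).hom ▷ (l ⊗ m) ≫ (k ⊗ h) ◁ (β_ l m).hom) ▷ n ⊗≫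
          k ◁ (β_ h m).hom ▷ l ▷ n ⊗≫ 𝟙 _ := by monoidal
    _ = 𝟙 _ ⊗≫ ((h ⊗ k) ◁ (β_ l m).hom ≫ (β_ h k).hom ▷ (m ⊗ l)) ▷ n ⊗≫
          k ◁ (β_ h m).hom ▷ l ▷ n ⊗≫ 𝟙 _ := by rw [whisker_exchange]
    _ = _ := by monoidal

theorem tensorμ_assoc_left (h k l m n : V) :
    (α_ h k l).inv ▷ (m ⊗ n) ≫ tensorμ (h ⊗ k) l m n =
      (α_ _ _ _).hom ≫ h ◁ tensorμ k l m n ≫ (α_ _ _ _).inv ≫ (α_ h k m).inv ▷ (l ⊗ n) := by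
  simp only [tensorμ]
  monoidal

/-- Commutation `e` of the two actions in the first factor passes to the external product, since the
second factor is only carried along. -/
theorem tensorμ_lact_left {h k k' l m n q q' r : V} {f : h ⊗ k' ⟶ k} {g : k ⊗ m ⟶ q}
    {g' : k' ⊗ m ⟶ q'} {f' : h ⊗ q' ⟶ q} (e : f ▷ m ≫ g = (α_ _ _ _).hom ≫ h ◁ g' ≫ f')
    (s : l ⊗ n ⟶ r) :
    ((α_ _ _ _).inv ≫ f ▷ l) ▷ (m ⊗ n) ≫ tensorμ _ _ _ _ ≫ (g ⊗ₘ s) =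
      (α_ _ _ _).hom ≫ h ◁ (tensorμ _ _ _ _ ≫ (g' ⊗ₘ s)) ≫ (α_ _ _ _).inv ≫ f' ▷ r := by
  rw [comp_whiskerRight_assoc, ← tensorHom_id f l, tensorμ_natural_left_assoc,
    tensorHom_comp_tensorHom, e, id_whiskerRight, Category.id_comp,
    reassoc_of% (tensorμ_assoc_left h k' l m n), ← tensorHom_id (α_ h k' m).inv,
    tensorHom_comp_tensorHom, Iso.inv_hom_id_assoc, Category.id_comp,
    MonoidalCategory.whiskerLeft_comp_assoc, ← id_tensorHom h (g' ⊗ₘ s),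
    associator_inv_naturality_assoc, ← tensorHom_id f' r, tensorHom_comp_tensorHom,
    Category.comp_id, id_tensorHom h g']

theorem lcomm_naturality (q : V) {x y x' y' : V} (f : x ⟶ x') (g : y ⟶ y') :
    lcomm q x y ≫ (f ⊗ₘ q ◁ g) = q ◁ (f ⊗ₘ g) ≫ lcomm q x' y' := by
  rw [lcomm, lcomm, ← id_tensorHom, ← id_tensorHom, Category.assoc, Category.assoc,
    ← associator_naturality, associator_inv_naturality_assoc, ← tensorHom_id, ← tensorHom_id,
    tensorHom_comp_tensorHom_assoc, tensorHom_comp_tensorHom_assoc, tensorHom_id, id_tensorHom,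
    braiding_naturality_right, Category.id_comp, Category.comp_id]

theorem tensorμ_lact_right {h k l l' m n q q' r : V} {f : h ⊗ l' ⟶ l} {g : l ⊗ n ⟶ q}
    {g' : l' ⊗ n ⟶ q'} {f' : h ⊗ q' ⟶ q} (e : f ▷ n ≫ g = (α_ _ _ _).hom ≫ h ◁ g' ≫ f')
    (s : k ⊗ m ⟶ r) :
    (lcomm _ _ _ ≫ k ◁ f) ▷ (m ⊗ n) ≫ tensorμ _ _ _ _ ≫ (s ⊗ₘ g) =
      (α_ _ _ _).hom ≫ h ◁ (tensorμ _ _ _ _ ≫ (s ⊗ₘ g')) ≫ lcomm _ _ _ ≫ r ◁ f' := by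
  rw [comp_whiskerRight_assoc, ← id_tensorHom k f, tensorμ_natural_left_assoc,
    tensorHom_comp_tensorHom, e, id_whiskerRight, Category.id_comp,
    reassoc_of% (tensorμ_lcomm h k l' m n), ← id_tensorHom (k ⊗ m) (α_ h l' n).inv,
    tensorHom_comp_tensorHom, Iso.inv_hom_id_assoc, Category.id_comp,
    MonoidalCategory.whiskerLeft_comp_assoc, ← reassoc_of% (lcomm_naturality h s g'),
    ← id_tensorHom r f', tensorHom_comp_tensorHom, Category.comp_id]

/-! ### The two actions on K(a₁, b₁) ⊗ K(a₂, b₂) commute. -/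

section SourceWeights

open Limits

variable {A : Type u} [EnrichedCategory V A] {B : Type u} [EnrichedCategory V B]

/-- Each edge acts on only one factor, and there the claim is `lact_ract`. It is the hypothesis of
`exists_tens_lact` for the source of `φ`. -/
theorem VMod.actExt_act (K : VMod V B A) (e : ((Shape.ofCat V A).prod (Shape.ofCat V A)).E)
    (c c' : B × B) :
    K.actExt e c ▷ _ ≫ ((K.copsh (((Shape.ofCat V A).prod (Shape.ofCat V A)).s e).1).ext
        (K.copsh (((Shape.ofCat V A).prod (Shape.ofCat V A)).s e).2)).act c c' =
      (α_ _ _ _).hom ≫ _ ◁ ((K.copsh (((Shape.ofCat V A).prod (Shape.ofCat V A)).t e).1).ext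
        (K.copsh (((Shape.ofCat V A).prod (Shape.ofCat V A)).t e).2)).act c c' ≫ K.actExt e c' := by
  rcases c with ⟨b₁, b₂⟩
  rcases c' with ⟨b₁', b₂'⟩
  rcases e with ⟨⟨a₁, a₁'⟩, a₂⟩ | ⟨a₁, a₂, a₂'⟩
  · change ((α_ _ _ _).inv ≫ K.lact a₁ a₁' b₁ ▷ K.obj a₂ b₂) ▷ ((b₁ ⟶[V] b₁') ⊗ (b₂ ⟶[V] b₂')) ≫
        tensorμ _ _ _ _ ≫ (K.ract a₁ b₁ b₁' ⊗ₘ K.ract a₂ b₂ b₂') =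
      (α_ _ _ _).hom ≫ (a₁ ⟶[V] a₁') ◁ (tensorμ _ _ _ _ ≫
        (K.ract a₁' b₁ b₁' ⊗ₘ K.ract a₂ b₂ b₂')) ≫ (α_ _ _ _).inv ≫ K.lact a₁ a₁' b₁' ▷ _
    exact tensorμ_lact_left (K.lact_ract a₁ a₁' b₁ b₁') _
  · change (lcomm _ _ _ ≫ K.obj a₁ b₁ ◁ K.lact a₂ a₂' b₂) ▷ ((b₁ ⟶[V] b₁') ⊗ (b₂ ⟶[V] b₂')) ≫
        tensorμ _ _ _ _ ≫ (K.ract a₁ b₁ b₁' ⊗ₘ K.ract a₂ b₂ b₂') =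
      (α_ _ _ _).hom ≫ (a₂ ⟶[V] a₂') ◁ (tensorμ _ _ _ _ ≫
        (K.ract a₁ b₁ b₁' ⊗ₘ K.ract a₂' b₂ b₂')) ≫ lcomm _ _ _ ≫ _ ◁ K.lact a₂ a₂' b₂'
    exact tensorμ_lact_right (K.lact_ract a₂ a₂' b₂ b₂') _

end SourceWeights
-- Comparing two colimits of the same diagram.
section Presentations

open Limits

variable {X : Type u₁} [EnrichedCategory V X] {S : Shape.{u} V} {C : Type u} [EnrichedCategory V C]
  [MonoidalClosed V] [HasProducts.{u} V] [HasEqualizers V]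
  {W W' : WtFam S C} {Y : Diag S X} {L L' : EnrichedFunctor V C X}
  {q : ∀ i c, W.obj i c ⟶ (Y.obj i ⟶[V] L.obj c)}
  {q' : ∀ i c, W'.obj i c ⟶ (Y.obj i ⟶[V] L'.obj c)}

/-- The morphism of colimits induced by a morphism of weights, invertible if the latter is. -/
theorem Presents.exists_hom_of_map (H : Presents W Y L q) (H' : Presents W' Y L' q')
    (φ : ∀ i c, W.obj i c ⟶ W'.obj i c)
    (hact : ∀ e c, W.act e c ≫ φ (S.s e) c = S.h e ◁ φ (S.t e) c ≫ W'.act e c)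
    (hract : ∀ i c c', W.ract i c c' ≫ φ i c' = φ i c ▷ _ ≫ W'.ract i c c') :
    ∃ f : 𝟙_ V ⟶ (L ⟶[V] L'), (∀ i c, post (q i c) (f ≫ proj L L' c) = φ i c ≫ q' i c) ∧
      ((∀ i c, IsIso (φ i c)) → IsInvertible f) := by
  obtain ⟨f, hf⟩ := H.exists_hom (fun i c => φ i c ≫ q' i c) (by
      intro e c
      rw [reassoc_of% (hact e c), H'.nat, ecmp_comp]) (by
      intro i c c'
      rw [comp_ecmp, H'.ract, reassoc_of% (hract i c c')])
  refine ⟨f, hf, fun _ => ?_⟩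
  exact H.isInvertible H' φ (fun _ => eId V _) (fun _ => isInvertible_eId _) hact hract
    (fun e => by rw [pre_eId, post_eId]) (fun i c => by rw [pre_eId, hf])

end Presentations

/-! ### Construction of μ and ε from φ and φ₀. -/

section Induced

open Limits

variable {A : Type u} [EnrichedCategory V A] {B : Type u} [EnrichedCategory V B]
  {X : Type u₁} [EnrichedCategory V X]
  [MonoidalClosed V] [HasProducts.{u} V] [HasEqualizers V] [HasCoproducts.{u} V]
  [HasCoequalizers V]
  {pA : Promonoidal V A} {pB : Promonoidal V B} {T : EnrichedFunctor V (X × X) X} {e : X}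

section Coprojections

variable (dA : DayColimits pA T e) (K : VMod V B A)
  (hK : ∀ (F : EnrichedFunctor V A X) (b : B), Colim (K.psh b) F)

theorem exists_tgtCoproj (F G : EnrichedFunctor V A X) (a₁ a₂ : A) (b : B) :
    ∃ θ : tgtComp pA.P K a₁ a₂ b ⟶ (T.obj (F.obj a₁, G.obj a₂) ⟶[V]
        ((existsK K hK).obj ((dayTensor dA).obj (F, G))).obj b),
      ∀ a, tgtι pA.P K a₁ a₂ b a ≫ θ =
        dayη dA F G a₁ a₂ a ⨟ existsι K hK ((dayTensor dA).obj (F, G)) a b :=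
  exists_tens_ecmp _ _ ((dayTensor dA).obj (F, G)) _ _ (fun a a' => dayη_ract dA F G a₁ a₂ a a')
    (fun a a' => ((isLan_existsK K hK _).isColim b).nat a a')

/-- The coprojection `∫^a P(a₁, a₂, a) ⊗ K(a, b) ⟶ X(F a₁ ⊗ G a₂, (∃_K (F ∗ G)) b)`. -/
def tgtCoproj (F G : EnrichedFunctor V A X) (a₁ a₂ : A) (b : B) :
    tgtComp pA.P K a₁ a₂ b ⟶ (T.obj (F.obj a₁, G.obj a₂) ⟶[V]
        ((existsK K hK).obj ((dayTensor dA).obj (F, G))).obj b) :=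
  (exists_tgtCoproj dA K hK F G a₁ a₂ b).choose

theorem tgtι_tgtCoproj (F G : EnrichedFunctor V A X) (a₁ a₂ : A) (b : B) (a : A) :
    tgtι pA.P K a₁ a₂ b a ≫ tgtCoproj dA K hK F G a₁ a₂ b =
        dayη dA F G a₁ a₂ a ⨟ existsι K hK ((dayTensor dA).obj (F, G)) a b :=
  (exists_tgtCoproj dA K hK F G a₁ a₂ b).choose_spec a

theorem exists_unitCoproj (b : B) :
    ∃ θ : unitComp pA.J K b ⟶ (e ⟶[V] ((existsK K hK).obj (dayUnit dA)).obj b),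
      ∀ a, unitι pA.J K b a ≫ θ = dayν dA a ⨟ existsι K hK (dayUnit dA) a b :=
  exists_tens_ecmp _ _ (dayUnit dA) _ _ (fun a a' => dayν_ract dA a a')
    (fun a a' => ((isLan_existsK K hK _).isColim b).nat a a')

/-- The coprojection `∫^a J a ⊗ K(a, b) ⟶ X(e, (∃_K N) b)`. -/
def unitCoproj (b : B) :
    unitComp pA.J K b ⟶ (e ⟶[V] ((existsK K hK).obj (dayUnit dA)).obj b) :=
  (exists_unitCoproj dA K hK b).choose

theorem unitι_unitCoproj (b : B) (a : A) :
    unitι pA.J K b a ≫ unitCoproj dA K hK b = dayν dA a ⨟ existsι K hK (dayUnit dA) a b :=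
  (exists_unitCoproj dA K hK b).choose_spec a

end Coprojections

variable (dA : DayColimits pA T e) (dB : DayColimits pB T e) (k : PromonoidalModule pA pB)
  (hK : ∀ (F : EnrichedFunctor V A X) (b : B), Colim (k.K.psh b) F)

/-- Both functors are colimits of the one-vertex diagram `e`: the unit over `B` is weighted by `J
b`, and its counterpart by `∫^a J a ⊗ K(a, b)`. The map `φ₀` is a morphism between these weights. -/
theorem exists_ε :
    ∃ ε : 𝟙_ V ⟶ (dayUnit dB ⟶[V] (existsK k.K hK).obj (dayUnit dA)),
      (∀ b, post (dayν dB b) (ε ≫ proj _ _ b) = k.φ₀ b ≫ unitCoproj dA k.K hK b) ∧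
      ((∀ b, IsIso (k.φ₀ b)) → IsInvertible ε) := by
  choose r hr hr' using k.φ₀_nat
  have tgt := (isLan_dayUnit dA).presents_point.comp_lan (isLan_existsK k.K hK (dayUnit dA))
    (act := fun e => nomatch e) (ract := fun _ b b' => r b b')
    (Q := fun _ b => unitCoproj dA k.K hK b) (fun e => nomatch e)
    (fun _ b b' a => hr b b' a) (fun _ b a => unitι_unitCoproj dA k.K hK b a)
  obtain ⟨f, hf, hf'⟩ := (isLan_dayUnit dB).presents_point.exists_hom_of_map tgt
    (fun _ b => k.φ₀ b) (fun e => nomatch e) (fun _ b b' => (hr' b b').symm)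
  exact ⟨f, fun b => hf PUnit.unit b, fun h => hf' fun _ b => h b⟩

/-- Source and target are colimits of the same diagram `F a₁ ⊗ G a₂`, weighted by the source and the
target of `φ`. Naturality of `φ` makes it a morphism of weights. -/
theorem exists_μ (hL : ∀ x : X, PreservesColims.{w, u} ((secL x).comp V T))
    (hR : ∀ x : X, PreservesColims.{w, u} ((secR x).comp V T)) (F G : EnrichedFunctor V A X) :
    ∃ μ : 𝟙_ V ⟶ ((dayTensor dB).obj ((existsK k.K hK).obj F, (existsK k.K hK).obj G) ⟶[V]
        (existsK k.K hK).obj ((dayTensor dA).obj (F, G))),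
      (∀ a₁ a₂ b b₁ b₂, post (mapPair T (existsι k.K hK F a₁ b₁) (existsι k.K hK G a₂ b₂) ⨟
          dayη dB ((existsK k.K hK).obj F) ((existsK k.K hK).obj G) b₁ b₂ b) (μ ≫ proj _ _ b) =
        k.φι a₁ a₂ b b₁ b₂ ≫ tgtCoproj dA k.K hK F G a₁ a₂ b) ∧
      ((∀ a₁ a₂ b, IsIso (k.φ a₁ a₂ b)) → IsInvertible μ) := by
  have hext := (isLan_existsK k.K hK F).presents_mapPair (T := T) (isLan_existsK k.K hK G) hL hR
  choose r hr hr' using k.φ_nat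
  -- The naturality axioms of `φ` in `a₁` and in `a₂` are merged into one statement over the edges
  -- of the product graph. Its witnesses `s` are the contravariant actions on the target weights.
  have hact' : ∀ (i : ((Shape.ofCat V A).prod (Shape.ofCat V A)).E) (b : B),
      ∃ s : ((Shape.ofCat V A).prod (Shape.ofCat V A)).h i ⊗
          tgtComp pA.P k.K (((Shape.ofCat V A).prod (Shape.ofCat V A)).t i).1
            (((Shape.ofCat V A).prod (Shape.ofCat V A)).t i).2 b ⟶
          tgtComp pA.P k.K (((Shape.ofCat V A).prod (Shape.ofCat V A)).s i).1
            (((Shape.ofCat V A).prod (Shape.ofCat V A)).s i).2 b,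
        (∀ a, _ ◁ tgtι pA.P k.K _ _ b a ≫ s =
          (α_ _ _ _).inv ≫ pA.P.actPair i a ▷ _ ≫ tgtι pA.P k.K _ _ b a) ∧
        ∀ c : B × B, _ ◁ k.φι _ _ b c.1 c.2 ≫ s =
          (α_ _ _ _).inv ≫ k.K.actExt i c ▷ _ ≫ k.φι _ _ b c.1 c.2 := by
    rintro (⟨⟨a₁, a₁'⟩, a₂⟩ | ⟨a₁, a₂, a₂'⟩) b
    · obtain ⟨s, h, h'⟩ := k.φ_nat₁ a₁ a₁' a₂ b
      exact ⟨s, h, fun c => h' c.1 c.2⟩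
    · obtain ⟨s, h, h'⟩ := k.φ_nat₂ a₁ a₂ a₂' b
      exact ⟨s, h, fun c => h' c.1 c.2⟩
  choose s hs hs' using hact'
  -- Target: first the Day colimit over `A × A`, then extension along `K`.
  have tgt := (isLan_day dA F G).presents_ext.comp_lan
    (isLan_existsK k.K hK ((dayTensor dA).obj (F, G)))
    (act := s) (ract := fun i b b' => r i.1 i.2 b b')
    (Q := fun i b => tgtCoproj dA k.K hK F G i.1 i.2 b) (fun i b a => hs i b a)
    (fun i b b' a => hr i.1 i.2 b b' a) (fun i b a => tgtι_tgtCoproj dA k.K hK F G i.1 i.2 b a)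
  choose l hl using fun (i : ((Shape.ofCat V A).prod (Shape.ofCat V A)).E) (b : B) =>
    exists_tens_lact
      (L := (k.K.copsh (((Shape.ofCat V A).prod (Shape.ofCat V A)).t i).1).ext
        (k.K.copsh (((Shape.ofCat V A).prod (Shape.ofCat V A)).t i).2))
      (L' := (k.K.copsh (((Shape.ofCat V A).prod (Shape.ofCat V A)).s i).1).ext
        (k.K.copsh (((Shape.ofCat V A).prod (Shape.ofCat V A)).s i).2))
      (pB.P.psh b) (k.K.actExt i) (k.K.actExt_act i)
  choose m hm using fun (i : A × A) (b b' : B) =>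
    exists_tens_ract ((k.K.copsh i.1).ext (k.K.copsh i.2)) (N := pB.P.psh b) (N' := pB.P.psh b')
      (fun c => pB.P.ract c b b') (fun c c' => pB.P.lact_ract c c' b b')
  choose Q hQ using fun (i : A × A) (b : B) =>
    exists_tens_ecmp ((k.K.copsh i.1).ext (k.K.copsh i.2)) (pB.P.psh b)
      (extObj T ((existsK k.K hK).obj F) ((existsK k.K hK).obj G)) _ _
      (fun c c' => hext.ract i c c') (fun c c' => ((isLan_day dB ((existsK k.K hK).obj F)
        ((existsK k.K hK).obj G)).isColim b).nat c c')
  -- Source: first the tensor product of the two extensions along `K`, then the Day colimit over `B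
  -- × B`.
  have src := hext.comp_lan (isLan_day dB ((existsK k.K hK).obj F) ((existsK k.K hK).obj G))
    (act := l) (ract := m) (Q := Q) hl hm hQ
  obtain ⟨f, hf, hf'⟩ := src.exists_hom_of_map tgt (fun i b => k.φ i.1 i.2 b) (by
      intro i b
      apply tens_whiskerLeft_ext
      intro c
      exact ((reassoc_of% (hl i b c)) _).trans ((hs' i b c).symm.trans
        (MonoidalCategory.whiskerLeft_comp_assoc _ _ _ _))) (by
      intro i b b'
      apply tens_whiskerRight_ext
      intro c
      exact ((reassoc_of% (hm i b b' c)) _).trans ((hr' i.1 i.2 b b' c.1 c.2).symm.trans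
        (comp_whiskerRight_assoc _ _ _ _)))
  refine ⟨f, fun a₁ a₂ b b₁ b₂ => ?_, fun h => hf' fun i b => h i.1 i.2 b⟩
  have e := congrArg (fun z => tensι _ _ (b₁, b₂) ≫ z) (hf (a₁, a₂) b)
  have e' := congrArg (fun z => post z (f ≫ proj _ _ b)) (hQ (a₁, a₂) b (b₁, b₂))
  exact e'.symm.trans ((comp_post _ _ _).trans (e.trans (Category.assoc _ _ _).symm))

end Induced

/-! ### Reordering composites of four generalized elements. -/

section Shuffles

variable {X : Type u₁} [EnrichedCategory V X]

/-- The inner two of four factors are commuted by a square. This and the two shuffles below rewrite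
composites of coprojections into the order in which the axioms of a promonoidal module state them.
-/
theorem Sq.tensorμ_ecmp {x y z t z' r : X} {p q l m : V} {g : q ⟶ (y ⟶[V] z)}
    {h : l ⟶ (z ⟶[V] t)} {h' : l ⟶ (y ⟶[V] z')} {g' : q ⟶ (z' ⟶[V] t)} (s : Sq g h h' g')
    (f : p ⟶ (x ⟶[V] y)) (k : m ⟶ (t ⟶[V] r)) :
    (f ⨟ g) ⨟ (h ⨟ k) = tensorμ _ _ _ _ ≫ ((f ⨟ h') ⨟ (g' ⨟ k)) := by
  rw [ecmp_assoc, ecmp_assoc' g, show g ⨟ h = _ from s, comp_ecmp, ecmp_assoc, ecmp_comp,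
    ecmp_comp, ecmp_comp, ecmp_assoc' f, tensorμ]
  simp only [Category.assoc]

theorem ecmp_ecmp_shuffleL {x y z t r : X} {p q l m : V} (f : p ⟶ (x ⟶[V] y))
    (g : q ⟶ (y ⟶[V] z)) (h : l ⟶ (z ⟶[V] t)) (k : m ⟶ (t ⟶[V] r)) :
    (f ⨟ g) ⨟ (h ⨟ k) = shuffleL _ _ _ _ ≫ (f ⨟ ((g ⨟ h) ⨟ k)) := by
  rw [ecmp_assoc, ecmp_assoc' g, ecmp_comp, shuffleL, Category.assoc]

theorem Sq.shuffleR_ecmp {x y z t z' r : X} {p q l m : V} {g : q ⟶ (y ⟶[V] z)}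
    {h : l ⟶ (z ⟶[V] t)} {h' : l ⟶ (y ⟶[V] z')} {g' : q ⟶ (z' ⟶[V] t)} (s : Sq g h h' g')
    (f : p ⟶ (x ⟶[V] y)) (k : m ⟶ (t ⟶[V] r)) :
    (f ⨟ g) ⨟ (h ⨟ k) = shuffleR _ _ _ _ ≫ (f ⨟ ((h' ⨟ g') ⨟ k)) := by
  rw [ecmp_ecmp_shuffleL, show g ⨟ h = _ from s, comp_ecmp, ecmp_comp, shuffleR, Category.assoc]

theorem Sq.mapPair {Y : Type u₂} [EnrichedCategory V Y] {Z : Type u₃} [EnrichedCategory V Z]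
    {T : EnrichedFunctor V (X × Y) Z} {x y x' y' : X} {p q : V} {h : p ⟶ (x ⟶[V] y)}
    {f : q ⟶ (y ⟶[V] y')} {g : q ⟶ (x ⟶[V] x')} {h' : p ⟶ (x' ⟶[V] y')} (s : Sq h f g h')
    {z t z' t' : Y} {r l : V} {k : r ⟶ (z ⟶[V] t)} {m : l ⟶ (t ⟶[V] t')} {n : l ⟶ (z ⟶[V] z')}
    {k' : r ⟶ (z' ⟶[V] t')} (s' : Sq k m n k') :
    Sq (Enr.mapPair T h k) (Enr.mapPair T f m) (Enr.mapPair T g n) (Enr.mapPair T h' k') := by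
  rw [← whR_ecmp_whL h k, ← whR_ecmp_whL h' k']
  exact (s.mapPair_whR n).vcomp (s'.mapPair_whL f)

end Shuffles

/-! ### Naturality of the induced multiplication. -/

section InducedMultiplication

open Limits

variable {A : Type u} [EnrichedCategory V A] {B : Type u} [EnrichedCategory V B]
  {X : Type u₁} [EnrichedCategory V X]
  [MonoidalClosed V] [HasProducts.{u} V] [HasEqualizers V] [HasCoproducts.{u} V]
  [HasCoequalizers V]
  {pA : Promonoidal V A} {pB : Promonoidal V B} {T : EnrichedFunctor V (X × X) X} {e : X}

theorem post_existsι (K : VMod V B A)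
    (hK : ∀ (F : EnrichedFunctor V A X) (b : B), Colim (K.psh b) F)
    {F G : EnrichedFunctor V A X} (f : 𝟙_ V ⟶ (F ⟶[V] G)) (a : A) (b : B) :
    post (existsι K hK F a b) ((f ≫ (existsK K hK).map F G) ≫ proj _ _ b) =
      pre (f ≫ proj F G a) (existsι K hK G a b) :=
  sq_unit_iff.1 (sq_existsι K hK f a b)

theorem existsι_map (K : VMod V B A)
    (hK : ∀ (F : EnrichedFunctor V A X) (b : B), Colim (K.psh b) F) (F : EnrichedFunctor V A X)
    (a : A) (b b' : B) : existsι K hK F a b ⨟ ((existsK K hK).obj F).map b b' =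
      K.ract a b b' ≫ existsι K hK F a b' :=
  (isLan_existsK K hK F).ract a b b'

theorem lact_existsι (K : VMod V B A)
    (hK : ∀ (F : EnrichedFunctor V A X) (b : B), Colim (K.psh b) F) (F : EnrichedFunctor V A X)
    (a a' : A) (b : B) : K.lact a a' b ≫ existsι K hK F a b = F.map a a' ⨟ existsι K hK F a' b :=
  ((isLan_existsK K hK F).isColim b).nat a a'

variable (dA : DayColimits pA T e) (dB : DayColimits pB T e) (k : PromonoidalModule pA pB)
  (hK : ∀ (F : EnrichedFunctor V A X) (b : B), Colim (k.K.psh b) F)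

/-- The equations defining the multiplication constraint of `∃_K`. -/
def IsInducedMul (μ : ∀ F G : EnrichedFunctor V A X,
    𝟙_ V ⟶ ((dayTensor dB).obj ((existsK k.K hK).obj F, (existsK k.K hK).obj G) ⟶[V]
      (existsK k.K hK).obj ((dayTensor dA).obj (F, G)))) : Prop :=
  ∀ F G a₁ a₂ b b₁ b₂, post (mapPair T (existsι k.K hK F a₁ b₁) (existsι k.K hK G a₂ b₂) ⨟
      dayη dB ((existsK k.K hK).obj F) ((existsK k.K hK).obj G) b₁ b₂ b) (μ F G ≫ proj _ _ b) =
    k.φι a₁ a₂ b b₁ b₂ ≫ tgtCoproj dA k.K hK F G a₁ a₂ b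

variable {F F' G G' H : EnrichedFunctor V A X}

theorem mapPair_existsι_dayη_ext (hL : ∀ x : X, PreservesColims.{w, u} ((secL x).comp V T))
    (hR : ∀ x : X, PreservesColims.{w, u} ((secR x).comp V T)) {b : B} {v : V} {x : X}
    {f g : v ⟶ (((dayTensor dB).obj ((existsK k.K hK).obj F, (existsK k.K hK).obj G)).obj b ⟶[V] x)}
    (h : ∀ a₁ a₂ b₁ b₂, (mapPair T (existsι k.K hK F a₁ b₁) (existsι k.K hK G a₂ b₂) ⨟
          dayη dB ((existsK k.K hK).obj F) ((existsK k.K hK).obj G) b₁ b₂ b) ⨟ f =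
        (mapPair T (existsι k.K hK F a₁ b₁) (existsι k.K hK G a₂ b₂) ⨟
          dayη dB ((existsK k.K hK).obj F) ((existsK k.K hK).obj G) b₁ b₂ b) ⨟ g) : f = g :=
  dayη_ext dB fun b₁ b₂ => (isLan_existsK k.K hK F).mapPair_ext (isLan_existsK k.K hK G) hL hR
    fun a₁ a₂ => ecmp_ecmp_ext (h a₁ a₂ b₁ b₂)

theorem sq_tgtCoproj {r s : V} (f : r ⟶ (F ⟶[V] F')) (g : s ⟶ (G ⟶[V] G')) (a₁ a₂ : A) (b : B) :
    Sq (tgtCoproj dA k.K hK F G a₁ a₂ b)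
      ((mapPair (dayTensor dA) f g ≫ (existsK k.K hK).map _ _) ≫ proj _ _ b)
      (mapPair T (f ≫ proj _ _ a₁) (g ≫ proj _ _ a₂)) (tgtCoproj dA k.K hK F' G' a₁ a₂ b) := by
  apply sq_tens
  intro a
  have := (sq_dayη dA f g a₁ a₂ a).vcomp (sq_existsι k.K hK (mapPair (dayTensor dA) f g) a b)
  rw [← tgtι_tgtCoproj, ← tgtι_tgtCoproj] at this
  exact this

variable {dA dB k hK} {μ : ∀ F G : EnrichedFunctor V A X,
    𝟙_ V ⟶ ((dayTensor dB).obj ((existsK k.K hK).obj F, (existsK k.K hK).obj G) ⟶[V]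
      (existsK k.K hK).obj ((dayTensor dA).obj (F, G)))}

/-- The two presentations share their diagram, so `Sq.transport` applies with identities as the
comparison morphisms of diagrams. -/
theorem IsInducedMul.nat (hμ : IsInducedMul dA dB k hK μ)
    (hL : ∀ x : X, PreservesColims.{w, u} ((secL x).comp V T))
    (hR : ∀ x : X, PreservesColims.{w, u} ((secR x).comp V T)) {r s : V}
    (f : r ⟶ (F ⟶[V] F')) (g : s ⟶ (G ⟶[V] G')) :
    post (mapPair (dayTensor dB) (f ≫ (existsK k.K hK).map _ _) (g ≫ (existsK k.K hK).map _ _))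
        (μ F' G') =
      pre (μ F G) (mapPair (dayTensor dA) f g ≫ (existsK k.K hK).map _ _) := by
  apply hom_ext
  intro b
  rw [post_proj, pre_proj]
  apply mapPair_existsι_dayη_ext dB k hK hL hR
  intro a₁ a₂ b₁ b₂
  have := (((sq_existsι k.K hK f a₁ b₁).mapPair (T := T) (sq_existsι k.K hK g a₂ b₂)).vcomp
    (sq_dayη dB _ _ b₁ b₂ b)).transport (sq_tgtCoproj dA k hK f g a₁ a₂ b)
    (φ := k.φι a₁ a₂ b b₁ b₂) (f := μ F G ≫ proj _ _ b) (f' := μ F' G' ≫ proj _ _ b)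
    (y := eId V _) (y' := eId V _) (k := 𝟙 _) (by rw [pre_eId]; exact hμ F G a₁ a₂ b b₁ b₂)
    (by rw [pre_eId]; exact hμ F' G' a₁ a₂ b b₁ b₂) (by rw [pre_eId, post_eId, Category.id_comp])
  rwa [Category.id_comp] at this

end InducedMultiplication

/-! ### Associativity of the induced multiplication. -/

section InducedCoherence

open Limits

variable {A : Type u} [EnrichedCategory V A] {B : Type u} [EnrichedCategory V B]
  {X : Type u₁} [EnrichedCategory V X]
  [MonoidalClosed V] [HasProducts.{u} V] [HasEqualizers V] [HasCoproducts.{u} V]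
  [HasCoequalizers V]
  {pA : Promonoidal V A} {pB : Promonoidal V B} {T : EnrichedFunctor V (X × X) X} {e : X}
  {mX : MonoidalConstraints T e}
  {dA : DayColimits pA T e} {dB : DayColimits pB T e} {k : PromonoidalModule pA pB}
  {hK : ∀ (F : EnrichedFunctor V A X) (b : B), Colim (k.K.psh b) F}
  {μ : ∀ F G : EnrichedFunctor V A X,
    𝟙_ V ⟶ ((dayTensor dB).obj ((existsK k.K hK).obj F, (existsK k.K hK).obj G) ⟶[V]
      (existsK k.K hK).obj ((dayTensor dA).obj (F, G)))}
  {F G H : EnrichedFunctor V A X}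

/-- A morphism in the first tensor factor slides back past the element `h` of the second factor by
interchange, and is absorbed into `g`. -/
theorem dayη_post_whR_pre {C : Type u} [EnrichedCategory V C] {p : Promonoidal V C}
    (d : DayColimits p T e) {F K L M : EnrichedFunctor V C X} {x y : X} {r s : V} {c : C}
    (g : r ⟶ (x ⟶[V] F.obj c)) (m : 𝟙_ V ⟶ (F ⟶[V] K)) {b' : C} (h : s ⟶ (y ⟶[V] L.obj b'))
    (R : 𝟙_ V ⟶ ((dayTensor d).obj (K, L) ⟶[V] M)) (b : C) :
    post (whR T g y ⨟ (whL T (F.obj c) h ⨟ dayη d F L c b' b))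
        (pre (whR (dayTensor d) m L) R ≫ proj _ _ b) =
      post (whR T (post g (m ≫ proj _ _ c)) y ⨟ (whL T (K.obj c) h ⨟ dayη d K L c b' b))
        (R ≫ proj _ _ b) := by
  rw [pre_proj, ← post_post, ← ecmp_post, ← ecmp_post, ← ecmp_post, post_dayη_left, ← post_ecmp,
    sq_unit_iff.1 (sq_whR_whL (m ≫ proj _ _ c) h).symm, pre_ecmp, ← pre_post, ← post_ecmp,
    ← whR_post, ecmp_post]

theorem dayη_post_whL_pre {C : Type u} [EnrichedCategory V C] {p : Promonoidal V C}
    (d : DayColimits p T e) {F K L M : EnrichedFunctor V C X} {x y : X} {r s : V} {c : C}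
    (g : r ⟶ (x ⟶[V] F.obj c)) (m : 𝟙_ V ⟶ (F ⟶[V] K)) {b' : C} (h : s ⟶ (y ⟶[V] L.obj b'))
    (R : 𝟙_ V ⟶ ((dayTensor d).obj (L, K) ⟶[V] M)) (b : C) :
    post (whL T y g ⨟ (whR T h (F.obj c) ⨟ dayη d L F b' c b))
        (pre (whL (dayTensor d) L m) R ≫ proj _ _ b) =
      post (whL T y (post g (m ≫ proj _ _ c)) ⨟ (whR T h (K.obj c) ⨟ dayη d L K b' c b))
        (R ≫ proj _ _ b) := by
  rw [pre_proj, ← post_post, ← ecmp_post, ← ecmp_post, ← ecmp_post, post_dayη_right, ← post_ecmp,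
    sq_unit_iff.1 (sq_whR_whL h (m ≫ proj _ _ c)), pre_ecmp, ← pre_post, ← post_ecmp,
    ← whL_post, ecmp_post]

/-- The permutation produced here is the one in the condition on `g₇` in `φ_assoc`. -/
theorem mapPair_ecmp_whL_ecmp {x x' y y' y'' z : X} {p q l m : V} (f : p ⟶ (x ⟶[V] x'))
    (g : q ⟶ (y ⟶[V] y')) (h : l ⟶ (y' ⟶[V] y'')) (k : m ⟶ (T.obj (x', y'') ⟶[V] z)) :
    mapPair T f g ⨟ (whL T x' h ⨟ k) =
      (β_ p q).hom ▷ _ ≫ tensorμ _ _ _ _ ≫ (whL T x (g ⨟ h) ⨟ (whR T f y'' ⨟ k)) := by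
  rw [whL_ecmp, ← (sq_whR_whL f h).tensorμ_ecmp, whL_ecmp_whR, comp_ecmp,
    ← comp_whiskerRight_assoc, SymmetricCategory.symmetry, id_whiskerRight, Category.id_comp]

theorem IsLan.whR_mapPair_ext {K : VMod V B A} {L L' : EnrichedFunctor V B X}
    {κ : ∀ a b, K.obj a b ⟶ (F.obj a ⟶[V] L.obj b)}
    {κ' : ∀ a b, K.obj a b ⟶ (G.obj a ⟶[V] L'.obj b)} (h : IsLan K F L κ) (h' : IsLan K G L' κ')
    (hL : ∀ x : X, PreservesColims.{w, u} ((secL x).comp V T))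
    (hR : ∀ x : X, PreservesColims.{w, u} ((secR x).comp V T)) {b₁ b₂ : B} {v : V} {x y : X}
    {f g : v ⟶ (T.obj (T.obj (L.obj b₁, L'.obj b₂), y) ⟶[V] x)}
    (e : ∀ a₁ a₂, whR T (mapPair T (κ a₁ b₁) (κ' a₂ b₂)) y ⨟ f =
      whR T (mapPair T (κ a₁ b₁) (κ' a₂ b₂)) y ⨟ g) : f = g := by
  refine ((h'.comp (hR (L.obj b₁))).comp (hL y)).ext (c := b₂) fun a₂ =>
    ((h.comp (hL (G.obj a₂))).comp (hL y)).ext (c := b₁) fun a₁ => ?_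
  have := e a₁ a₂
  rw [← whR_ecmp_whL, whR_ecmp] at this
  have := ecmp_ecmp_ext this
  rw [whR_eq_map T (Enr.whR T _ _), whR_eq_map T (Enr.whL T _ _), whR_eq_map, whL_eq_map] at this
  exact this

theorem existsι_dayη_dayη_ext (hL : ∀ x : X, PreservesColims.{w, u} ((secL x).comp V T))
    (hR : ∀ x : X, PreservesColims.{w, u} ((secR x).comp V T)) {b : B} {x : X}
    {f g : 𝟙_ V ⟶ (((dayTensor dB).obj ((dayTensor dB).obj ((existsK k.K hK).obj F,
      (existsK k.K hK).obj G), (existsK k.K hK).obj H)).obj b ⟶[V] x)}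
    (h : ∀ a₁ a₂ a₃ b₁ b₂ b₃ c,
      post (whR T (mapPair T (existsι k.K hK F a₁ b₁) (existsι k.K hK G a₂ b₂) ⨟
          dayη dB ((existsK k.K hK).obj F) ((existsK k.K hK).obj G) b₁ b₂ c) (H.obj a₃) ⨟
        (whL T _ (existsι k.K hK H a₃ b₃) ⨟ dayη dB ((dayTensor dB).obj ((existsK k.K hK).obj F,
          (existsK k.K hK).obj G)) ((existsK k.K hK).obj H) c b₃ b)) f =
      post (whR T (mapPair T (existsι k.K hK F a₁ b₁) (existsι k.K hK G a₂ b₂) ⨟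
          dayη dB ((existsK k.K hK).obj F) ((existsK k.K hK).obj G) b₁ b₂ c) (H.obj a₃) ⨟
        (whL T _ (existsι k.K hK H a₃ b₃) ⨟ dayη dB ((dayTensor dB).obj ((existsK k.K hK).obj F,
          (existsK k.K hK).obj G)) ((existsK k.K hK).obj H) c b₃ b)) g) : f = g := by
  refine dayη_ext dB fun c b₃ => (isLan_existsK k.K hK H).whL_ext hR fun a₃ =>
    whR_dayη_ext dB hL fun b₁ b₂ =>
      (isLan_existsK k.K hK F).whR_mapPair_ext (isLan_existsK k.K hK G) hL hR fun a₁ a₂ => ?_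
  have := h a₁ a₂ a₃ b₁ b₂ b₃ c
  rw [whR_ecmp] at this
  refine ecmp_ecmp_ext ?_
  rw [ecmp_assoc' (whL T _ _), ecmp_assoc' (whL T _ _), ecmp_comp, ecmp_comp]
  exact congrArg _ (ecmp_ecmp_ext (by rw [ecmp_eq_post, this, ← ecmp_eq_post]))

/-- On the coprojections of the threefold product of extensions, the two composites are the two
sides of `φ_assoc` with `z` a hom-object of X. The Day associators contribute the associativities of
`A` and `B` and one associator of X. -/
theorem IsInducedMul.assoc (hμ : IsInducedMul dA dB k hK μ)
    (hL : ∀ x : X, PreservesColims.{w, u} ((secL x).comp V T))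
    (hR : ∀ x : X, PreservesColims.{w, u} ((secR x).comp V T))
    {α : ∀ F G H : EnrichedFunctor V A X,
      𝟙_ V ⟶ ((dayTensor dA).obj ((dayTensor dA).obj (F, G), H) ⟶[V]
        (dayTensor dA).obj (F, (dayTensor dA).obj (G, H)))} (hα : IsDayAssoc dA mX α)
    {β : ∀ F G H : EnrichedFunctor V B X,
      𝟙_ V ⟶ ((dayTensor dB).obj ((dayTensor dB).obj (F, G), H) ⟶[V]
        (dayTensor dB).obj (F, (dayTensor dB).obj (G, H)))} (hβ : IsDayAssoc dB mX β)
    (F G H : EnrichedFunctor V A X) :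
    pre (whR (dayTensor dB) (μ F G) ((existsK k.K hK).obj H))
        (pre (μ ((dayTensor dA).obj (F, G)) H) (α F G H ≫ (existsK k.K hK).map _ _)) =
      pre (β ((existsK k.K hK).obj F) ((existsK k.K hK).obj G) ((existsK k.K hK).obj H))
        (pre (whL (dayTensor dB) ((existsK k.K hK).obj F) (μ G H))
          (μ F ((dayTensor dA).obj (G, H)))) := by
  apply hom_ext
  intro b
  apply existsι_dayη_dayη_ext hL hR
  intro a₁ a₂ a₃ b₁ b₂ b₃ c
  -- The side that starts with the associator over `B` is brought to the form ending in `g₇`: the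
  -- third coprojection is commuted past that of the first Day product, and the associator of X is
  -- moved to the front.
  have e1 : post (whR T (mapPair T (existsι k.K hK F a₁ b₁) (existsι k.K hK G a₂ b₂) ⨟
          dayη dB ((existsK k.K hK).obj F) ((existsK k.K hK).obj G) b₁ b₂ c) (H.obj a₃) ⨟
        (whL T _ (existsι k.K hK H a₃ b₃) ⨟ dayη dB ((dayTensor dB).obj ((existsK k.K hK).obj F,
          (existsK k.K hK).obj G)) ((existsK k.K hK).obj H) c b₃ b))
        (pre (β ((existsK k.K hK).obj F) ((existsK k.K hK).obj G) ((existsK k.K hK).obj H))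
          (pre (whL (dayTensor dB) ((existsK k.K hK).obj F) (μ G H))
          (μ F ((dayTensor dA).obj (G, H)))) ≫ proj _ _ b) =
      tensorμ _ _ _ _ ≫ (α_ _ _ _).hom ▷ _ ≫ _ ◁ pB.assocι b₁ b₂ b₃ b c ≫
        pre (mX.assoc (F.obj a₁) (G.obj a₂) (H.obj a₃))
          (mapPair T (existsι k.K hK F a₁ b₁)
            (mapPair T (existsι k.K hK G a₂ b₂) (existsι k.K hK H a₃ b₃)) ⨟
          post (dayCoprojRight dB ((existsK k.K hK).obj F) ((existsK k.K hK).obj G)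
              ((existsK k.K hK).obj H) b₁ b₂ b₃ b)
            (pre (whL (dayTensor dB) ((existsK k.K hK).obj F) (μ G H))
              (μ F ((dayTensor dA).obj (G, H))) ≫ proj _ _ b)) := by
    rw [whR_ecmp, (sq_whR_whL _ _).tensorμ_ecmp, whR_ecmp_whL, comp_post, ← ecmp_post, hβ.post_pre,
      ecmp_comp, ← post_ecmp, mX.assoc_nat', comp_ecmp, pre_ecmp, whisker_exchange_assoc]
  rw [dayη_post_whR_pre, hμ, comp_whR, comp_ecmp, comp_post, e1]
  -- The families `g₄`, `g₃`, `g₂`, `g₅`, `g₆`, `g₇` in this order: `g₃`, `g₂` for applying μ twice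
  -- and then the associator over `A`, the last three for the associator over `B` followed by μ
  -- twice.
  refine k.φ_assoc a₁ a₂ a₃ b _
    (fun a => pre (mX.assoc (F.obj a₁) (G.obj a₂) (H.obj a₃))
      (dayCoprojRight dA F G H a₁ a₂ a₃ a ⨟ existsι k.K hK _ a b))
    (fun u => whR T (dayη dA F G a₁ a₂ u) (H.obj a₃) ⨟
      post (tgtCoproj dA k.K hK ((dayTensor dA).obj (F, G)) H u a₃ b)
        ((α F G H ≫ (existsK k.K hK).map _ _) ≫ proj _ _ b))
    (fun c b₃ => post (whR T (tgtCoproj dA k.K hK F G a₁ a₂ c) (H.obj a₃) ⨟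
        (whL T _ (existsι k.K hK H a₃ b₃) ⨟ dayη dB ((existsK k.K hK).obj
          ((dayTensor dA).obj (F, G))) ((existsK k.K hK).obj H) c b₃ b))
      (pre (μ ((dayTensor dA).obj (F, G)) H) (α F G H ≫ (existsK k.K hK).map _ _) ≫ proj _ _ b))
    (fun w => pre (mX.assoc (F.obj a₁) (G.obj a₂) (H.obj a₃))
      (whL T (F.obj a₁) (dayη dA G H a₂ a₃ w) ⨟
        tgtCoproj dA k.K hK F ((dayTensor dA).obj (G, H)) a₁ w b))
    (fun b₁ d => pre (mX.assoc (F.obj a₁) (G.obj a₂) (H.obj a₃))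
      (post (whL T (F.obj a₁) (tgtCoproj dA k.K hK G H a₂ a₃ d) ⨟
        (whR T (existsι k.K hK F a₁ b₁) _ ⨟ dayη dB ((existsK k.K hK).obj F)
          ((existsK k.K hK).obj ((dayTensor dA).obj (G, H))) b₁ d b))
        (μ F ((dayTensor dA).obj (G, H)) ≫ proj _ _ b)))
    (fun b₁ b₂ b₃ => pre (mX.assoc (F.obj a₁) (G.obj a₂) (H.obj a₃))
      (mapPair T (existsι k.K hK F a₁ b₁)
          (mapPair T (existsι k.K hK G a₂ b₂) (existsι k.K hK H a₃ b₃)) ⨟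
        post (dayCoprojRight dB ((existsK k.K hK).obj F) ((existsK k.K hK).obj G)
            ((existsK k.K hK).obj H) b₁ b₂ b₃ b)
          (pre (whL (dayTensor dB) ((existsK k.K hK).obj F) (μ G H))
            (μ F ((dayTensor dA).obj (G, H))) ≫ proj _ _ b)))
    ?_ ?_ ?_ ?_ ?_ b₁ b₂ b₃ c
  -- The associator over `A` is resolved through `hα`; the next obligation resolves the second of
  -- the two multiplications on this side through `hμ`.
  · intro u a
    rw [← ecmp_comp, ← comp_post, tgtι_tgtCoproj, ← ecmp_post, post_existsι, ← post_ecmp,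
      ecmp_assoc', ecmp_post, hα, comp_ecmp, pre_ecmp]
  · intro u c b₃
    rw [← comp_post, ← comp_ecmp, ← comp_whR, tgtι_tgtCoproj, whR_ecmp, ecmp_ecmp_shuffleL,
      whR_ecmp_whL, comp_post, ← ecmp_post, pre_proj, ← post_post, hμ, comp_post, ecmp_comp]
  · intro w a
    rw [← comp_pre, ← ecmp_comp, tgtι_tgtCoproj, ecmp_assoc', ← rightι_dayCoprojRight, comp_ecmp,
      comp_pre, comp_pre]
  · intro w b₁ d
    rw [← comp_pre, ← comp_post, ← comp_ecmp, ← comp_whL, tgtι_tgtCoproj, whL_ecmp,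
      (sq_whR_whL _ _).symm.shuffleR_ecmp, whR_ecmp_whL, comp_post, comp_pre, ← ecmp_post, hμ,
      ecmp_comp, comp_pre]
  -- The multiplication of `G` and `H` is resolved inside the second tensor factor, after the
  -- coprojection of `F` has been moved out of the way.
  · intro b₁ b₂ b₃ d
    rw [← comp_pre, ← ecmp_comp, pre_proj, ← post_post, ← comp_post, rightι_post_dayCoprojRight, ecmp_post,
      mapPair_ecmp_whL_ecmp, ecmp_post, hμ, comp_whL, comp_ecmp, comp_post, comp_post, comp_post,
      comp_pre, comp_pre, comp_pre]

end InducedCoherence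

/-! ### Unit axioms for the induced structure. -/

section InducedUnits

open Limits

variable {A : Type u} [EnrichedCategory V A] {B : Type u} [EnrichedCategory V B]
  {X : Type u₁} [EnrichedCategory V X]
  [MonoidalClosed V] [HasProducts.{u} V] [HasEqualizers V] [HasCoproducts.{u} V]
  [HasCoequalizers V]
  {pA : Promonoidal V A} {pB : Promonoidal V B} {T : EnrichedFunctor V (X × X) X} {e : X}
  {mX : MonoidalConstraints T e}
  {dA : DayColimits pA T e} {dB : DayColimits pB T e} {k : PromonoidalModule pA pB}
  {hK : ∀ (F : EnrichedFunctor V A X) (b : B), Colim (k.K.psh b) F}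
  {μ : ∀ F G : EnrichedFunctor V A X,
    𝟙_ V ⟶ ((dayTensor dB).obj ((existsK k.K hK).obj F, (existsK k.K hK).obj G) ⟶[V]
      (existsK k.K hK).obj ((dayTensor dA).obj (F, G)))}
  {ε : 𝟙_ V ⟶ (dayUnit dB ⟶[V] (existsK k.K hK).obj (dayUnit dA))}
  {F : EnrichedFunctor V A X}

theorem dayν_existsι_dayη_ext_left (hL : ∀ x : X, PreservesColims.{w, u} ((secL x).comp V T))
    (hR : ∀ x : X, PreservesColims.{w, u} ((secR x).comp V T)) {b : B} {x : X}
    {f g : 𝟙_ V ⟶ (((dayTensor dB).obj (dayUnit dB, (existsK k.K hK).obj F)).obj b ⟶[V] x)}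
    (h : ∀ a j b',
      post (whR T (dayν dB j) (F.obj a) ⨟ (whL T _ (existsι k.K hK F a b') ⨟
        dayη dB (dayUnit dB) ((existsK k.K hK).obj F) j b' b)) f =
      post (whR T (dayν dB j) (F.obj a) ⨟ (whL T _ (existsι k.K hK F a b') ⨟
        dayη dB (dayUnit dB) ((existsK k.K hK).obj F) j b' b)) g) : f = g := by
  refine dayη_ext dB fun j b' => (isLan_existsK k.K hK F).whL_ext hR fun a =>
    whR_dayν_ext dB hL ?_
  rw [ecmp_assoc' (whL T _ _), ecmp_assoc' (whL T _ _), ecmp_comp, ecmp_comp]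
  exact congrArg _ (ecmp_ecmp_ext (by rw [ecmp_eq_post, h, ← ecmp_eq_post]))

theorem dayν_existsι_dayη_ext_right (hL : ∀ x : X, PreservesColims.{w, u} ((secL x).comp V T))
    (hR : ∀ x : X, PreservesColims.{w, u} ((secR x).comp V T)) {b : B} {x : X}
    {f g : 𝟙_ V ⟶ (((dayTensor dB).obj ((existsK k.K hK).obj F, dayUnit dB)).obj b ⟶[V] x)}
    (h : ∀ a j b',
      post (whL T (F.obj a) (dayν dB j) ⨟ (whR T (existsι k.K hK F a b') _ ⨟
        dayη dB ((existsK k.K hK).obj F) (dayUnit dB) b' j b)) f =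
      post (whL T (F.obj a) (dayν dB j) ⨟ (whR T (existsι k.K hK F a b') _ ⨟
        dayη dB ((existsK k.K hK).obj F) (dayUnit dB) b' j b)) g) : f = g := by
  refine dayη_ext dB fun b' j => (isLan_existsK k.K hK F).whR_ext hL fun a =>
    whL_dayν_ext dB hR ?_
  rw [ecmp_assoc' (whR T _ _), ecmp_assoc' (whR T _ _), ecmp_comp, ecmp_comp]
  exact congrArg _ (ecmp_ecmp_ext (by rw [ecmp_eq_post, h, ← ecmp_eq_post]))

/-- The maps `g₁`, `g₂` given by `φ_lunit` describe the composite after each step: the left unit of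
`A` determines `g₁`, then μ determines `g₂`, and composing with `φ₀` leaves the left unit of `B`. -/
theorem IsInducedMul.lunit (hμ : IsInducedMul dA dB k hK μ)
    (hε : ∀ b, post (dayν dB b) (ε ≫ proj _ _ b) = k.φ₀ b ≫ unitCoproj dA k.K hK b)
    (hL : ∀ x : X, PreservesColims.{w, u} ((secL x).comp V T))
    (hR : ∀ x : X, PreservesColims.{w, u} ((secR x).comp V T))
    {l : ∀ F : EnrichedFunctor V A X, 𝟙_ V ⟶ ((dayTensor dA).obj (dayUnit dA, F) ⟶[V] F)}
    (hl : IsDayLunit dA mX l)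
    {l' : ∀ F : EnrichedFunctor V B X, 𝟙_ V ⟶ ((dayTensor dB).obj (dayUnit dB, F) ⟶[V] F)}
    (hl' : IsDayLunit dB mX l') (F : EnrichedFunctor V A X) :
    pre (whR (dayTensor dB) ε ((existsK k.K hK).obj F))
        (pre (μ (dayUnit dA) F) (l F ≫ (existsK k.K hK).map _ _)) =
      l' ((existsK k.K hK).obj F) := by
  apply hom_ext
  intro b
  apply dayν_existsι_dayη_ext_left hL hR
  intro a₂ j b₂
  obtain ⟨g₁, g₂, h₁, h₂, h₃⟩ := k.φ_lunit a₂ b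
  -- A map out of `J u ⊗ ∫^a P(u, a₂, a) ⊗ K(a, b)`, hence tested at each `a`, where the left unit
  -- constraint over `A` is known.
  have e1 : ∀ u, whR T (dayν dA u) (F.obj a₂) ⨟ post (tgtCoproj dA k.K hK (dayUnit dA) F u a₂ b)
        ((l F ≫ (existsK k.K hK).map _ _) ≫ proj _ _ b) =
      g₁ u ≫ pre (mX.lunit (F.obj a₂)) (existsι k.K hK F a₂ b) := by
    intro u
    apply tens_whiskerLeft_ext
    intro a
    change _ ◁ tgtι pA.P k.K u a₂ b a ≫ _ = _ ◁ tgtι pA.P k.K u a₂ b a ≫ _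
    rw [reassoc_of% (h₁ u a), ← ecmp_comp, ← comp_post, tgtι_tgtCoproj, ← ecmp_post, post_existsι,
      ← post_ecmp, ecmp_assoc', ecmp_post, hl, comp_ecmp, pre_ecmp, ← lact_existsι, comp_pre]
  -- A map out of a coend over `u`; on each coprojection μ is given by `φ`, which reduces the claim
  -- to `e1`.
  have e2 : post (whR T (unitCoproj dA k.K hK j) (F.obj a₂) ⨟ (whL T _ (existsι k.K hK F a₂ b₂) ⨟
        dayη dB ((existsK k.K hK).obj (dayUnit dA)) ((existsK k.K hK).obj F) j b₂ b))
        (pre (μ (dayUnit dA) F) (l F ≫ (existsK k.K hK).map _ _) ≫ proj _ _ b) =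
      g₂ j b₂ ≫ pre (mX.lunit (F.obj a₂)) (existsι k.K hK F a₂ b) := by
    apply tens_whiskerRight_ext
    intro u
    change unitι pA.J k.K j u ▷ _ ≫ _ = unitι pA.J k.K j u ▷ _ ≫ _
    rw [reassoc_of% (h₂ u j b₂), ← comp_post, ← comp_ecmp, ← comp_whR, unitι_unitCoproj, whR_ecmp,
      ecmp_ecmp_shuffleL, whR_ecmp_whL, comp_post, ← ecmp_post, pre_proj, ← post_post, hμ,
      comp_post, ecmp_comp, e1]
  -- The left-hand side becomes the left unit of `B` acting on `K`; the right-hand side is computed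
  -- by `hl'`, and `existsι_map` identifies the two.
  rw [dayη_post_whR_pre, hε, comp_whR, comp_ecmp, comp_post, e2, reassoc_of% (h₃ j b₂),
    ← (sq_whR_whL _ _).symm.lcomm_ecmp, comp_post, ← ecmp_post, hl', ecmp_comp, ← post_ecmp,
    mX.lunit_nat', pre_ecmp, existsι_map, comp_pre]

theorem IsInducedMul.runit (hμ : IsInducedMul dA dB k hK μ)
    (hε : ∀ b, post (dayν dB b) (ε ≫ proj _ _ b) = k.φ₀ b ≫ unitCoproj dA k.K hK b)
    (hL : ∀ x : X, PreservesColims.{w, u} ((secL x).comp V T))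
    (hR : ∀ x : X, PreservesColims.{w, u} ((secR x).comp V T))
    {r : ∀ F : EnrichedFunctor V A X, 𝟙_ V ⟶ ((dayTensor dA).obj (F, dayUnit dA) ⟶[V] F)}
    (hr : IsDayRunit dA mX r)
    {r' : ∀ F : EnrichedFunctor V B X, 𝟙_ V ⟶ ((dayTensor dB).obj (F, dayUnit dB) ⟶[V] F)}
    (hr' : IsDayRunit dB mX r') (F : EnrichedFunctor V A X) :
    pre (whL (dayTensor dB) ((existsK k.K hK).obj F) ε)
        (pre (μ F (dayUnit dA)) (r F ≫ (existsK k.K hK).map _ _)) =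
      r' ((existsK k.K hK).obj F) := by
  apply hom_ext
  intro b
  apply dayν_existsι_dayη_ext_right hL hR
  intro a₁ j b₁
  obtain ⟨g₁, g₂, h₁, h₂, h₃⟩ := k.φ_runit a₁ b
  have e1 : ∀ u, whL T (F.obj a₁) (dayν dA u) ⨟ post (tgtCoproj dA k.K hK F (dayUnit dA) a₁ u b)
        ((r F ≫ (existsK k.K hK).map _ _) ≫ proj _ _ b) =
      g₁ u ≫ pre (mX.runit (F.obj a₁)) (existsι k.K hK F a₁ b) := by
    intro u
    apply tens_whiskerLeft_ext
    intro a
    change _ ◁ tgtι pA.P k.K a₁ u b a ≫ _ = _ ◁ tgtι pA.P k.K a₁ u b a ≫ _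
    rw [reassoc_of% (h₁ u a), ← ecmp_comp, ← comp_post, tgtι_tgtCoproj, ← ecmp_post, post_existsι,
      ← post_ecmp, ecmp_assoc', ecmp_post, hr, comp_ecmp, pre_ecmp, ← lact_existsι, comp_pre]
  have e2 : post (whL T (F.obj a₁) (unitCoproj dA k.K hK j) ⨟ (whR T (existsι k.K hK F a₁ b₁) _ ⨟
        dayη dB ((existsK k.K hK).obj F) ((existsK k.K hK).obj (dayUnit dA)) b₁ j b))
        (pre (μ F (dayUnit dA)) (r F ≫ (existsK k.K hK).map _ _) ≫ proj _ _ b) =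
      g₂ j b₁ ≫ pre (mX.runit (F.obj a₁)) (existsι k.K hK F a₁ b) := by
    apply tens_whiskerRight_ext
    intro u
    change unitι pA.J k.K j u ▷ _ ≫ _ = unitι pA.J k.K j u ▷ _ ≫ _
    rw [reassoc_of% (h₂ u j b₁), ← comp_post, ← comp_ecmp, ← comp_whL, unitι_unitCoproj, whL_ecmp,
      (sq_whR_whL _ _).symm.shuffleR_ecmp, whR_ecmp_whL, comp_post, ← ecmp_post, pre_proj,
      ← post_post, hμ, comp_post, ecmp_comp, e1]
  rw [dayη_post_whL_pre, hε, comp_whL, comp_ecmp, comp_post, e2, reassoc_of% (h₃ j b₁),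
    ← (sq_whR_whL _ _).lcomm_ecmp, comp_post, ← ecmp_post, hr', ecmp_comp, ← post_ecmp,
    mX.runit_nat', pre_ecmp, existsι_map, comp_pre]

end InducedUnits

end Enr

theorem mainTheorem2
    {V : Type v} [Category.{w} V] [MonoidalCategory V] [SymmetricCategory V] [MonoidalClosed V]
    [Limits.HasProducts.{u} V] [Limits.HasEqualizers V]
    [Limits.HasCoproducts.{u} V] [Limits.HasCoequalizers V]
    {A : Type u} [EnrichedCategory V A] {B : Type u} [EnrichedCategory V B]
    {X : Type u₁} [EnrichedCategory V X]
    (T : EnrichedFunctor V (X × X) X) (e : X) (mX : Enr.MonoidalConstraints T e)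
    (hL : ∀ x : X, Enr.PreservesColims.{w, u} ((Enr.secL x).comp V T))
    (hR : ∀ x : X, Enr.PreservesColims.{w, u} ((Enr.secR x).comp V T))
    (pA : Enr.Promonoidal V A) (pB : Enr.Promonoidal V B)
    (dA : Enr.DayColimits pA T e) (dB : Enr.DayColimits pB T e)
    (k : Enr.PromonoidalModule pA pB)
    (hK : ∀ (F : EnrichedFunctor V A X) (b : B), Enr.Colim (k.K.psh b) F) :
    Nonempty (Enr.DayConvolution mX dA) ∧ Nonempty (Enr.DayConvolution mX dB) ∧
      ∀ (mA : Enr.DayConvolution mX dA) (mB : Enr.DayConvolution mX dB),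
        ∃ M : Enr.LaxMonoidal mA.toMonoidalConstraints mB.toMonoidalConstraints
            (Enr.existsK k.K hK),
          Enr.IsInduced k hK M ∧ (k.IsStrong → M.IsStrong) := by
  refine ⟨Enr.nonempty_dayConvolution dA mX hL hR, Enr.nonempty_dayConvolution dB mX hL hR, ?_⟩
  intro mA mB
  -- The constraints are constructed independently of `mA` and `mB`, which enter only through the
  -- equations that their own constraints satisfy on coprojections.
  choose μ hμ hμ' using Enr.exists_μ dA dB k hK hL hR
  obtain ⟨ε, hε, hε'⟩ := Enr.exists_ε dA dB k hK
  have hμ : Enr.IsInducedMul dA dB k hK μ := hμ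
  refine ⟨{
    μ := μ
    ε := ε
    μ_nat := fun F F' G G' => ?_
    μ_assoc := hμ.assoc hL hR mA.isDayAssoc mB.isDayAssoc
    μ_lunit := hμ.lunit hε hL hR mA.lunit_eq mB.lunit_eq
    μ_runit := hμ.runit hε hL hR mA.runit_eq mB.runit_eq }, ⟨?_, ?_⟩, ?_⟩
  · have := hμ.nat hL hR (𝟙 (F ⟶[V] F')) (𝟙 (G ⟶[V] G'))
    rwa [Category.id_comp, Category.id_comp] at this
  · exact fun F G a₁ a₂ b b₁ b₂ => ⟨Enr.tgtCoproj dA k.K hK F G a₁ a₂ b,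
      Enr.tgtι_tgtCoproj dA k.K hK F G a₁ a₂ b, hμ F G a₁ a₂ b b₁ b₂⟩
  · exact fun b => ⟨Enr.unitCoproj dA k.K hK b, Enr.unitι_unitCoproj dA k.K hK b, hε b⟩
  · exact fun h => ⟨fun F G => hμ' F G h.1, hε' h.2⟩

end
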